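/- Fix a countably infinite set $U$ (the universe). A schema $\tau$ is a finite nonempty set of relation symbols with arities in $\mathbb N$; a $\tau$-fact is an expression $R(u_1,\dots,u_k)$ with $R\in\tau$ of arity $k$ and $u_i\in U$; a $\tau$-instance is a finite set of $\tau$-facts. A probabilistic database (PDB) of schema $\tau$ is a discrete probability distribution on $\tau$-instances; its worlds are the instances of positive probability and its facts are the facts that occur in its worlds. Let $\mathsf{PDB}$ be the class of all PDBs over $U$ (of all schemas). A PDB is tuple-independent if $\Pr(f_1\in D,\dots,f_k\in D)=\prod_{i}\Pr(f_i\in D)$ for all pairwise distinct facts $f_1,\dots,f_k$ of it. It is block-independent disjoint if its facts can be partitioned into blocks such that this equation holds for all facts $f_1,\dots,f_k$ from pairwise different blocks, and $\Pr(f,f'\in D)=0$ for distinct $f,f'$ in the same block. Let $\mathsf{TI}$ and $\mathsf{BID}$ be the corresponding classes. $\mathsf{FO}$ denotes first-order logic with equality and constants from $U$. It is evaluated under the active domain semantics: quantifiers and free variables range over the elements of $U$ that occur in the instance or as constants in the formula. $\mathsf{UCQ}$ denotes the formulas built from atoms (relational atoms, and equalities between a variable and a variable or constant) using only $\exists,\wedge,\vee$;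 $\mathsf{CQ}$ those built using only $\exists,\wedge$; and $\mathsf{sjfCQ}$ the formulas in $\mathsf{CQ}$ in which every relation symbol occurs at most once. For $V\in\{\mathsf{sjfCQ},\mathsf{CQ},\mathsf{UCQ},\mathsf{FO}\}$, a $V$-view from schema $\tau$ to schema $\tau'$ consists of one formula over $\tau$ in $V$ for each relation symbol $R\in\tau'$; it maps a $\tau$-instance to the $\tau'$-instance in which each $R$ is the set of answers of its formula. For a class $\mathsf D$ of PDBs, $V(\mathsf D)$ is the class of the image distributions of PDBs in $\mathsf D$ under $V$-views, and $\mathsf D\mid\mathsf{FO}$ is the class of the PDBs obtained from some PDB in $\mathsf D$ by conditioning on a first-order sentence of positive probability. **Theorem.** $\mathsf{FO}(\mathsf{TI})=\mathsf{FO}(\mathsf{BID})=\mathsf{FO}(\mathsf{TI}\mid\mathsf{FO})$. Moreover, the inclusions among the ten classes $\mathsf{TI}$, $\mathsf{BID}$, $\mathsf{sjfCQ}(\mathsf{TI})$, $\mathsf{CQ}(\mathsf{TI})$, $\mathsf{UCQ}(\mathsf{TI})$, $\mathsf{sjfCQ}(\mathsf{BID})$, $\mathsf{CQ}(\mathsf{BID})$,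 $\mathsf{UCQ}(\mathsf{BID})$, $\mathsf{FO}(\mathsf{TI})$, $\mathsf{PDB}$ are exactly those of the Hasse diagram with the following edges: $$\mathsf{TI}\subsetneq\mathsf{sjfCQ}(\mathsf{TI})\subsetneq\mathsf{CQ}(\mathsf{TI})\subsetneq\mathsf{UCQ}(\mathsf{TI}),$$ $$\mathsf{TI}\subsetneq\mathsf{BID}\subsetneq\mathsf{sjfCQ}(\mathsf{BID})\subsetneq\mathsf{CQ}(\mathsf{BID})\subsetneq\mathsf{UCQ}(\mathsf{BID})\subsetneq\mathsf{FO}(\mathsf{TI})\subsetneq\mathsf{PDB},$$ $$\mathsf{sjfCQ}(\mathsf{TI})\subsetneq\mathsf{sjfCQ}(\mathsf{BID}),\quad \mathsf{CQ}(\mathsf{TI})\subsetneq\mathsf{CQ}(\mathsf{BID}),\quad \mathsf{UCQ}(\mathsf{TI})\subsetneq\mathsf{UCQ}(\mathsf{BID}).$$ That is: all these inclusions are proper; one class is contained in another if and only if there is an ascending (possibly empty) path of edges from the first to the second; any two classes that are not connected by an ascending path are incomparable with respect to inclusion. In particular, the ten classes are pairwise distinct. -/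

import Mathlib

universe u

namespace ProbDB

/-- A database schema: a finite, nonempty set of relation symbols with arities. -/
structure Schema where
  Rel : Type
  finite : Finite Rel
  nonempty : Nonempty Rel
  arity : Rel → ℕ

noncomputable instance (τ : Schema) : Fintype τ.Rel :=
  haveI := τ.finite
  Fintype.ofFinite τ.Rel

/-- A `τ`-fact `R(u₁, …, u_k)` over the universe `U`. -/
abbrev Fact (τ : Schema) (U : Type u) : Type u :=
  Σ R : τ.Rel, (Fin (τ.arity R) → U)

/-- A `τ`-instance over `U`: a finite set of facts. -/
abbrev Instance (τ : Schema) (U : Type u) : Type u := Finset (Fact τ U)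

open Classical in
/-- The active domain of an instance. -/
noncomputable def adom {τ : Schema} {U : Type u} (D : Instance τ U) : Finset U :=
  D.biUnion fun f => Finset.univ.image f.2

/-! ### First-order logic with constants from the universe -/

/-- A term in the variables `x₀, …, x_{n-1}`: a variable or a constant of the universe. -/
inductive Term (U : Type u) (n : ℕ) : Type u
  | var (i : Fin n) : Term U n
  | const (c : U) : Term U n

/-- First-order formulas over the schema `τ`, constants in `U`, with free variables among
`x₀, …, x_{n-1}`. A quantifier binds the variable `x_n` of its body. -/
inductive Formula (τ : Schema) (U : Type u) : ℕ → Type u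
  | rel {n : ℕ} (R : τ.Rel) (t : Fin (τ.arity R) → Term U n) : Formula τ U n
  | eq {n : ℕ} (i : Fin n) (t : Term U n) : Formula τ U n
  | neg {n : ℕ} (φ : Formula τ U n) : Formula τ U n
  | and {n : ℕ} (φ ψ : Formula τ U n) : Formula τ U n
  | or {n : ℕ} (φ ψ : Formula τ U n) : Formula τ U n
  | ex {n : ℕ} (φ : Formula τ U (n + 1)) : Formula τ U n
  | all {n : ℕ} (φ : Formula τ U (n + 1)) : Formula τ U n

/-- Value of a term under a valuation of the variables. -/
def Term.val {U : Type u} {n : ℕ} (v : Fin n → U) : Term U n → U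
  | .var i => v i
  | .const c => c

/-- The constants occurring in a term. -/
def Term.consts {U : Type u} {n : ℕ} : Term U n → Finset U
  | .var _ => ∅
  | .const c => {c}

namespace Formula

variable {τ : Schema} {U : Type u}

open Classical in
/-- The set `adom(Φ)` of constants occurring in a formula. -/
noncomputable def consts : {n : ℕ} → Formula τ U n → Finset U
  | _, rel _ t => Finset.univ.biUnion fun i => (t i).consts
  | _, eq _ t => t.consts
  | _, neg φ => φ.consts
  | _, and φ ψ => φ.consts ∪ ψ.consts
  | _, or φ ψ => φ.consts ∪ ψ.consts
  | _, ex φ => φ.consts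
  | _, all φ => φ.consts

/-- Satisfaction in the instance `D` under the valuation `v`, the quantifiers ranging over `A`. -/
def Sat (D : Instance τ U) (A : Finset U) : {n : ℕ} → Formula τ U n → (Fin n → U) → Prop
  | _, rel R t, v => (⟨R, fun i => (t i).val v⟩ : Fact τ U) ∈ D
  | _, eq i t, v => v i = t.val v
  | _, neg φ, v => ¬ φ.Sat D A v
  | _, and φ ψ, v => φ.Sat D A v ∧ ψ.Sat D A v
  | _, or φ ψ, v => φ.Sat D A v ∨ ψ.Sat D A v
  | _, ex φ, v => ∃ a ∈ A, φ.Sat D A (Fin.snoc v a)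
  | _, all φ, v => ∀ a ∈ A, φ.Sat D A (Fin.snoc v a)

open Classical in
/-- `adom(D, Φ) = adom(D) ∪ adom(Φ)`, the range of quantifiers and valuations under the active
domain semantics. -/
noncomputable def range {n : ℕ} (φ : Formula τ U n) (D : Instance τ U) : Finset U :=
  adom D ∪ φ.consts

/-- Active domain semantics `D ⊨ Φ[v]`. -/
def Holds {n : ℕ} (φ : Formula τ U n) (D : Instance τ U) (v : Fin n → U) : Prop :=
  φ.Sat D (φ.range D) v

open Classical in
/-- The answer of the query `Φ(x₀, …, x_{n-1})` on `D`: all tuples over `adom(D, Φ)` that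
satisfy `Φ` in `D`. -/
noncomputable def answers {n : ℕ} (φ : Formula τ U n) (D : Instance τ U) : Finset (Fin n → U) :=
  (Fintype.piFinset fun _ => φ.range D).filter fun a => φ.Holds D a

/-- Conjunctive queries: built from atoms by `∃` and `∧` only. -/
def IsCQ : {n : ℕ} → Formula τ U n → Prop
  | _, rel _ _ => True
  | _, eq _ _ => True
  | _, neg _ => False
  | _, and φ ψ => φ.IsCQ ∧ ψ.IsCQ
  | _, or _ _ => False
  | _, ex φ => φ.IsCQ
  | _, all _ => False

/-- Unions of conjunctive queries: built from atoms by `∃`, `∧` and `∨` only. -/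
def IsUCQ : {n : ℕ} → Formula τ U n → Prop
  | _, rel _ _ => True
  | _, eq _ _ => True
  | _, neg _ => False
  | _, and φ ψ => φ.IsUCQ ∧ ψ.IsUCQ
  | _, or φ ψ => φ.IsUCQ ∧ ψ.IsUCQ
  | _, ex φ => φ.IsUCQ
  | _, all _ => False

/-- The list of all occurrences of relation symbols in a formula. -/
def relOccurrences : {n : ℕ} → Formula τ U n → List τ.Rel
  | _, rel R _ => [R]
  | _, eq _ _ => []
  | _, neg φ => φ.relOccurrences
  | _, and φ ψ => φ.relOccurrences ++ ψ.relOccurrences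
  | _, or φ ψ => φ.relOccurrences ++ ψ.relOccurrences
  | _, ex φ => φ.relOccurrences
  | _, all φ => φ.relOccurrences

/-- Self-join free conjunctive queries: every relation symbol occurs at most once. -/
def IsSjfCQ {n : ℕ} (φ : Formula τ U n) : Prop :=
  φ.IsCQ ∧ φ.relOccurrences.Nodup

end Formula

/-- A first-order view from `τ` to `τ'`: one formula for each relation symbol of `τ'`, with as
many variables as the arity of that symbol. -/
abbrev View (τ τ' : Schema) (U : Type u) : Type u :=
  ∀ R : τ'.Rel, Formula τ U (τ'.arity R)

/-- The image of an instance under a view. -/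
noncomputable def View.apply {τ τ' : Schema} {U : Type u} (V : View τ τ' U)
    (D : Instance τ U) : Instance τ' U :=
  Finset.univ.sigma fun R => (V R).answers D

/-! ### Probabilistic databases -/

/-- A probabilistic database of schema `τ` over `U`: a discrete probability distribution on the
`τ`-instances over `U`. (A smaller sample space is extended by instances of probability `0`.) -/
abbrev PDB (τ : Schema) (U : Type u) : Type u := PMF (Instance τ U)

namespace PDB

variable {τ : Schema} {U : Type u}

/-- The probability of a set of instances. -/
noncomputable def prob (p : PDB τ U) (S : Set (Instance τ U)) : ENNReal := p.toOuterMeasure S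

/-- The possible worlds: the instances of positive probability. -/
def worlds (p : PDB τ U) : Set (Instance τ U) := {D | 0 < p D}

/-- The facts appearing in the possible worlds. -/
def facts (p : PDB τ U) : Set (Fact τ U) := {f | ∃ D ∈ p.worlds, f ∈ D}

/-- Tuple-independence: for all pairwise distinct facts `f₁, …, f_k` of `p`,
`Pr(f₁ ∈ D, …, f_k ∈ D) = ∏ i, Pr(f_i ∈ D)`. -/
def IsTI (p : PDB τ U) : Prop :=
  ∀ s : Finset p.facts,
    p.prob {D | ∀ f ∈ s, f.1 ∈ D} = ∏ f ∈ s, p.prob {D | f.1 ∈ D}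

/-- Block-independent disjointness. The partition of the facts into blocks is given by the
equivalence relation "lies in the same block". -/
def IsBID (p : PDB τ U) : Prop :=
  ∃ sameBlock : Setoid p.facts,
    (∀ s : Finset p.facts, (∀ f ∈ s, ∀ g ∈ s, f ≠ g → ¬ sameBlock f g) →
      p.prob {D | ∀ f ∈ s, f.1 ∈ D} = ∏ f ∈ s, p.prob {D | f.1 ∈ D}) ∧
    (∀ f g : p.facts, sameBlock f g → f ≠ g → p.prob {D | f.1 ∈ D ∧ g.1 ∈ D} = 0)

end PDB

/-- A class of probabilistic databases over the universe `U` (of arbitrary schemas); the order `≤`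
is inclusion of classes. -/
abbrev PDBClass (U : Type u) : Type (max 1 u) := ∀ τ : Schema, Set (PDB τ U)

/-- A class of first-order formulas over `U` (for arbitrary schemas). -/
abbrev Fragment (U : Type u) : Type (max 1 u) := ∀ (τ : Schema) (n : ℕ), Set (Formula τ U n)

/-- `V(D)`: the images of the PDBs of the class `C` under the views all of whose formulas are
in `F`. -/
def viewsOver {U : Type u} (F : Fragment U) (C : PDBClass U) : PDBClass U := fun τ' =>
  {q | ∃ (τ : Schema) (p : PDB τ U) (V : View τ τ' U),
    p ∈ C τ ∧ (∀ R, V R ∈ F τ (τ'.arity R)) ∧ q = p.map V.apply}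

/-- `D | FO`: the PDBs obtained from the PDBs of `C` by conditioning on a first-order sentence of
positive probability. -/
def conditioned {U : Type u} (C : PDBClass U) : PDBClass U := fun τ =>
  {q | ∃ (p : PDB τ U) (φ : Formula τ U 0)
      (h : ∃ D ∈ {D : Instance τ U | φ.Holds D Fin.elim0}, D ∈ p.support),
    p ∈ C τ ∧ q = p.filter {D | φ.Holds D Fin.elim0} h}

variable (U : Type u)

/-- All formulas. -/
def FO : Fragment U := fun _ _ => Set.univ
/-- Unions of conjunctive queries. -/
def UCQ : Fragment U := fun _ _ => {φ | φ.IsUCQ}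
/-- Conjunctive queries. -/
def CQ : Fragment U := fun _ _ => {φ | φ.IsCQ}
/-- Self-join free conjunctive queries. -/
def SjfCQ : Fragment U := fun _ _ => {φ | φ.IsSjfCQ}

/-- The class of all PDBs. -/
def AllPDB : PDBClass U := fun _ => Set.univ
/-- The class of tuple-independent PDBs. -/
def TI : PDBClass U := fun _ => {p | p.IsTI}
/-- The class of block-independent disjoint PDBs. -/
def BID : PDBClass U := fun _ => {p | p.IsBID}

/-! ### The Hasse diagram -/

/-- The nodes of the diagram. -/
inductive Node
  | ti | bid
  | sjfcqTI | cqTI | ucqTI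
  | sjfcqBID | cqBID | ucqBID
  | foTI | pdb

/-- The class of PDBs at a node. -/
def Node.cls : Node → PDBClass U
  | .ti => TI U
  | .bid => BID U
  | .sjfcqTI => viewsOver (SjfCQ U) (TI U)
  | .cqTI => viewsOver (CQ U) (TI U)
  | .ucqTI => viewsOver (UCQ U) (TI U)
  | .sjfcqBID => viewsOver (SjfCQ U) (BID U)
  | .cqBID => viewsOver (CQ U) (BID U)
  | .ucqBID => viewsOver (UCQ U) (BID U)
  | .foTI => viewsOver (FO U) (TI U)
  | .pdb => AllPDB U

/-- The edges of the diagram, `Edge a b` meaning that `b` is drawn directly above `a`. -/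
inductive Edge : Node → Node → Prop
  | ti_bid : Edge .ti .bid
  | ti_sjfcqTI : Edge .ti .sjfcqTI
  | sjfcqTI_cqTI : Edge .sjfcqTI .cqTI
  | cqTI_ucqTI : Edge .cqTI .ucqTI
  | bid_sjfcqBID : Edge .bid .sjfcqBID
  | sjfcqBID_cqBID : Edge .sjfcqBID .cqBID
  | cqBID_ucqBID : Edge .cqBID .ucqBID
  | sjfcqTI_sjfcqBID : Edge .sjfcqTI .sjfcqBID
  | cqTI_cqBID : Edge .cqTI .cqBID
  | ucqTI_ucqBID : Edge .ucqTI .ucqBID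
  | ucqBID_foTI : Edge .ucqBID .foTI
  | foTI_pdb : Edge .foTI .pdb

end ProbDB

/-! The law of a random finite set is determined by the probabilities of the events `s ⊆ D`. If its
blocks are independent, fix a world `T`: inserting elements of blocks that `T` avoids gives distinct
worlds of probability at least `mass p f * p T`, so the masses are summable and the expected size is
finite. Hence only finitely many blocks are certain to contribute, and every world contains a world
of bounded size. Up to normalisation the law is a product of weights, restricted to the sets that
meet each block at most once and each certain block exactly once (`BlockInd.exists_weights`).

For the equalities, first-order views compose, so two simulations suffice. Conditioning is removed
by rejection sampling with finitely many independent trials; setting one successful world aside as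
default value creates the slack that makes the result exact (`conditioned_TI_le`). A
block-independent database arises from a tuple-independent one by tagging each fact with a name of
its block, conditioning on the block constraints and forgetting the tags (`BID_le_FO_conditioned`).

Six separations yield all non-inclusions. UCQ views are monotone and two tuple-independent worlds
have a common superworld, so they cannot produce exclusive facts (`not_BID_le_ucqTI`). Copying one
coin gives facts that are neither independent nor exclusive (`not_sjfcqTI_le_BID`). For
`not_cqTI_le_sjfcqBID` and `not_ucqTI_le_cqBID`, the weaker query would need two different facts
from given families with probability of order `1 / i ^ 2`, hence families of mass of order `1 / i`,
against summability (`BlockInd.not_heavy`). A UCQ image of a block-independent database has minimal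
worlds of bounded size, whereas long directed cycles are minimal models of a first-order sentence
(`not_foTI_le_ucqBID`). Finally, the answer to a unary query is linear in the size of the instance,
so its expected size is finite (`not_AllPDB_le_foTI`). -/

namespace ProbDB

open MeasureTheory Set
open scoped ENNReal NNReal

/-! ### Random finite sets -/

section RandomFinset

variable {α β : Type*} [Countable α]

set_option linter.unusedSectionVars false

/-- Finite measures on finite sets are determined by their values on the events `s ⊆ D`. -/
theorem measure_finset_ext {μ ν : Measure (Finset α)} [IsFiniteMeasure μ]
    (h : ∀ s : Finset α, μ {D | s ⊆ D} = ν {D | s ⊆ D}) : μ = ν := by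
  classical
  -- These events are closed under intersection, and they generate: `{t}` is the event `t ⊆ D` minus
  -- the countably many events `{f} ⊆ D` with `f ∉ t`.
  refine ext_of_generate_finite (Set.range fun s : Finset α => {D : Finset α | s ⊆ D}) ?_ ?_ ?_ ?_
  · refine le_antisymm ?_ (MeasurableSpace.generateFrom_le fun t _ => MeasurableSet.of_discrete)
    have key : ∀ t : Finset α,
        @MeasurableSet _ (MeasurableSpace.generateFrom
          (Set.range fun s : Finset α => {D : Finset α | s ⊆ D})) {t} := by
      intro t
      have : ({t} : Set (Finset α)) =
          {D | t ⊆ D} ∩ ⋂ f : {f // f ∉ t}, {D | {f.1} ⊆ D}ᶜ := by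
        ext D
        simp only [mem_singleton_iff, mem_inter_iff, mem_ofPred_eq, mem_iInter, mem_compl_iff,
          Finset.singleton_subset_iff, Subtype.forall]
        constructor
        · rintro rfl
          exact ⟨subset_rfl, fun a ha => ha⟩
        · rintro ⟨h1, h2⟩
          refine Finset.Subset.antisymm (fun a ha => ?_) h1
          by_contra hc
          exact h2 a hc ha
      rw [this]
      refine @MeasurableSet.inter _ (_) _ _ (MeasurableSpace.measurableSet_generateFrom ⟨t, rfl⟩) ?_
      exact @MeasurableSet.iInter _ _ (_) _ _ fun f =>
        @MeasurableSet.compl _ _ (_) (MeasurableSpace.measurableSet_generateFrom ⟨{f.1}, rfl⟩)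
    intro t _
    have : t = ⋃ x : t, {x.1} := by
      ext; simp
    rw [this]
    exact @MeasurableSet.iUnion _ _ (_) _ _ fun x => key x.1
  · rintro _ ⟨s, rfl⟩ _ ⟨t, rfl⟩ _
    refine ⟨s ∪ t, ?_⟩
    ext D
    simp [Finset.union_subset_iff]
  · rintro _ ⟨s, rfl⟩
    exact h s
  · simpa using h ∅

/-- The probability of the element `f`. -/
noncomputable def mass (p : PMF (Finset α)) (f : α) : ℝ≥0∞ := p.toMeasure {D | f ∈ D}

/-- The random set `p` is block-independent disjoint with block labels `b`. -/
structure BlockInd (p : PMF (Finset α)) (b : α → β) : Prop where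
  indep : ∀ s : Finset α, Set.InjOn b s → p.toMeasure {D | s ⊆ D} = ∏ f ∈ s, mass p f
  excl : ∀ f g, f ≠ g → b f = b g → p.toMeasure {D | f ∈ D ∧ g ∈ D} = 0

theorem mass_le_one (p : PMF (Finset α)) (f : α) : mass p f ≤ 1 := prob_le_one

theorem toMeasure_singleton (p : PMF (Finset α)) (D : Finset α) : p.toMeasure {D} = p D :=
  p.toMeasure_apply_singleton D MeasurableSet.of_discrete

theorem le_toMeasure (p : PMF (Finset α)) {D : Finset α} {S : Set (Finset α)} (h : D ∈ S) :
    p D ≤ p.toMeasure S := by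
  rw [← toMeasure_singleton p D]
  exact measure_mono (by simpa using h)

theorem apply_eq_zero_of_toMeasure (p : PMF (Finset α)) {D : Finset α} {S : Set (Finset α)}
    (h : D ∈ S) (hS : p.toMeasure S = 0) : p D = 0 :=
  le_antisymm (hS ▸ le_toMeasure p h) zero_le

theorem toMeasure_congr_support (p : PMF (Finset α)) {S T : Set (Finset α)}
    (h : ∀ D, p D ≠ 0 → (D ∈ S ↔ D ∈ T)) : p.toMeasure S = p.toMeasure T := by
  refine p.toMeasure_apply_eq_of_inter_support_eq .of_discrete .of_discrete ?_
  ext D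
  simp only [mem_inter_iff, PMF.mem_support_iff]
  exact ⟨fun ⟨a, b⟩ => ⟨(h D b).1 a, b⟩, fun ⟨a, b⟩ => ⟨(h D b).2 a, b⟩⟩

theorem toMeasure_mono_support (p : PMF (Finset α)) {S T : Set (Finset α)}
    (h : ∀ D, p D ≠ 0 → D ∈ S → D ∈ T) : p.toMeasure S ≤ p.toMeasure T := by
  rw [toMeasure_congr_support p (T := S ∩ T) fun D hD => ⟨fun a => ⟨a, h D hD a⟩, fun a => a.1⟩]
  exact measure_mono inter_subset_right

theorem mass_ne_zero_of_mem (p : PMF (Finset α)) {D : Finset α} (hD : p D ≠ 0) {f : α}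
    (hf : f ∈ D) : mass p f ≠ 0 := fun h => hD (apply_eq_zero_of_toMeasure p hf h)

/-- The expected size. -/
theorem tsum_mass (p : PMF (Finset α)) : ∑' f, mass p f = ∑' D, p D * D.card := by
  classical
  calc ∑' f, mass p f = ∑' f, ∑' D, (if f ∈ D then p D else 0) := by
        refine tsum_congr fun f => ?_
        rw [mass, p.toMeasure_apply_eq_tsum]
        exact tsum_congr fun D => by simp [Set.indicator_apply]
    _ = ∑' D, ∑' f, (if f ∈ D then p D else 0) := ENNReal.tsum_comm
    _ = _ := by
        refine tsum_congr fun D => ?_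
        rw [tsum_eq_sum (s := D) (fun f hf => by simp [hf])]
        rw [Finset.sum_congr rfl (fun f hf => if_pos hf)]
        simp [mul_comm]

namespace BlockInd

variable {p : PMF (Finset α)} {b : α → β}

theorem injOn (h : BlockInd p b) {D : Finset α} (hD : p D ≠ 0) : Set.InjOn b D := by
  intro f hf g hg hfg
  by_contra hne
  exact hD (apply_eq_zero_of_toMeasure p (S := {D | f ∈ D ∧ g ∈ D}) ⟨hf, hg⟩ (h.excl f g hne hfg))

theorem toMeasure_eq_zero (h : BlockInd p b) {s : Finset α} (hs : ¬ Set.InjOn b s) :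
    p.toMeasure {D | s ⊆ D} = 0 := by
  refine le_antisymm (le_of_le_of_eq (toMeasure_mono_support p (T := ∅) ?_) measure_empty) zero_le
  intro D hD hsD
  exact hs ((h.injOn hD).mono (by exact_mod_cast hsD))

/-- A positive probability for every consistent set of possible elements. -/
theorem exists_superset (h : BlockInd p b) {s : Finset α} (hs : Set.InjOn b s)
    (hm : ∀ f ∈ s, mass p f ≠ 0) : ∃ D, p D ≠ 0 ∧ s ⊆ D := by
  by_contra! hc
  have h0 : p.toMeasure {D | s ⊆ D} = 0 :=
    le_antisymm (le_of_le_of_eq (toMeasure_mono_support p (T := ∅) fun D hD hsD => hc D hD hsD)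
      measure_empty) zero_le
  rw [h.indep s hs, Finset.prod_eq_zero_iff] at h0
  obtain ⟨f, hf, hf0⟩ := h0
  exact hm f hf hf0

open Classical in
/-- The blocks met by `S` are independent of the remaining blocks. -/
theorem indep_rest (h : BlockInd p b) {S : Finset α} (hS : Set.InjOn b S) (T : Finset α) :
    p.toMeasure {D | S ⊆ D ∧ D.filter (fun f => b f ∉ b '' S) = T} =
      (∏ f ∈ S, mass p f) * p.toMeasure {D | D.filter (fun f => b f ∉ b '' S) = T} := by
  set F : Finset α → Finset α := fun D => D.filter (fun f => b f ∉ b '' S) with hF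
  have hFm : Measurable F := measurable_of_countable F
  have hP : ∏ f ∈ S, mass p f ≠ ∞ := ENNReal.prod_ne_top fun f _ => measure_ne_top _ _
  have key : (p.toMeasure.restrict {D | S ⊆ D}).map F =
      (∏ f ∈ S, mass p f) • p.toMeasure.map F := by
    refine measure_finset_ext fun s => ?_
    rw [Measure.map_apply hFm .of_discrete, Measure.restrict_apply .of_discrete,
      Measure.smul_apply, Measure.map_apply hFm .of_discrete, smul_eq_mul]
    by_cases hs : ∀ f ∈ s, b f ∉ b '' S
    · have e1 : F ⁻¹' {D | s ⊆ D} = {D | s ⊆ D} := by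
        ext D
        simp only [hF, mem_preimage, mem_ofPred_eq]
        exact ⟨fun hh f hf => (Finset.mem_filter.1 (hh hf)).1,
          fun hh f hf => Finset.mem_filter.2 ⟨hh hf, hs f hf⟩⟩
      have hdisj : Disjoint s S := Finset.disjoint_left.2 fun f hf hfS => hs f hf ⟨f, hfS, rfl⟩
      have e2 : {D | s ⊆ D} ∩ {D | S ⊆ D} = {D : Finset α | s ∪ S ⊆ D} := by
        ext D; simp [Finset.union_subset_iff]
      rw [e1, e2]
      by_cases hi : Set.InjOn b s
      · rw [h.indep s hi, h.indep (s ∪ S), Finset.prod_union hdisj, mul_comm]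
        intro f hf g hg hfg
        rcases Finset.mem_union.1 (Finset.mem_coe.1 hf) with hf | hf <;>
          rcases Finset.mem_union.1 (Finset.mem_coe.1 hg) with hg | hg
        · exact hi hf hg hfg
        · exact absurd ⟨g, hg, hfg.symm⟩ (hs f hf)
        · exact absurd ⟨f, hf, hfg⟩ (hs g hg)
        · exact hS hf hg hfg
      · rw [h.toMeasure_eq_zero hi, h.toMeasure_eq_zero (fun hh => hi (hh.mono (by simp))),
          mul_zero]
    · have e1 : F ⁻¹' {D | s ⊆ D} = ∅ := by
        ext D
        simp only [hF, mem_preimage, mem_ofPred_eq, mem_empty_iff_false, iff_false]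
        exact fun hh => hs fun f hf => (Finset.mem_filter.1 (hh hf)).2
      simp [e1]
  have := congrArg (fun μ => μ {T}) key
  simp only [Measure.smul_apply, smul_eq_mul] at this
  rw [Measure.map_apply hFm .of_discrete, Measure.restrict_apply .of_discrete,
      Measure.map_apply hFm .of_discrete] at this
  rw [inter_comm] at this
  exact this

open Classical in
/-- The probability that the part of the random set outside the block `B` is `T`. -/
noncomputable def restProb (p : PMF (Finset α)) (b : α → β) (B : β) (T : Finset α) : ℝ≥0∞ :=
  p.toMeasure {D | D.filter (fun f => b f ≠ B) = T}

/-- The total probability of the elements of a block. -/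
noncomputable def blockMass (p : PMF (Finset α)) (b : α → β) (B : β) : ℝ≥0∞ :=
  ∑' f : {f // b f = B}, mass p f.1

open Classical in
-- By exclusivity a world containing `f` has nothing else from that block, so its part outside
-- determines it; `indep_rest` with `S = {f}` separates the two factors.
theorem apply_insert (h : BlockInd p b) (f : α) {T : Finset α} (hT : ∀ g ∈ T, b g ≠ b f) :
    p (insert f T) = mass p f * restProb p b (b f) T := by
  have h1 := h.indep_rest (S := {f}) (by simp) T
  simp only [Finset.singleton_subset_iff, Finset.coe_singleton, image_singleton,
    mem_singleton_iff, Finset.prod_singleton] at h1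
  rw [restProb, ← h1, ← toMeasure_singleton p]
  refine toMeasure_congr_support p fun D hD => ?_
  simp only [mem_singleton_iff, mem_ofPred_eq]
  constructor
  · rintro rfl
    refine ⟨Finset.mem_insert_self _ _, ?_⟩
    ext g
    simp only [Finset.mem_filter, Finset.mem_insert]
    constructor
    · rintro ⟨rfl | hg, h2⟩
      · exact absurd rfl h2
      · exact hg
    · exact fun hg => ⟨Or.inr hg, hT g hg⟩
  · rintro ⟨h2, rfl⟩
    ext g
    simp only [Finset.mem_filter, Finset.mem_insert]
    constructor
    · intro hg
      by_cases hb : b g = b f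
      · exact Or.inl (h.injOn hD hg h2 hb)
      · exact Or.inr ⟨hg, hb⟩
    · rintro (rfl | hg)
      · exact h2
      · exact hg.1

open Classical in
-- A world whose part outside `B` is `T` has either nothing or exactly one element in `B`; the
-- second case is summed with `apply_insert`. Solving for `p T` gives `apply_eq`.
theorem restProb_eq (h : BlockInd p b) (B : β) {T : Finset α} (hT : ∀ g ∈ T, b g ≠ B) :
    restProb p b B T = p T + blockMass p b B * restProb p b B T := by
  have h1 : restProb p b B T =
      p.toMeasure ({T} ∪ ⋃ f : {f // b f = B}, {insert f.1 T}) := by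
    refine toMeasure_congr_support p fun D hD => ?_
    simp only [mem_ofPred_eq, mem_union, mem_singleton_iff, mem_iUnion, Subtype.exists]
    constructor
    · rintro rfl
      by_cases hc : ∃ f ∈ D, b f = B
      · obtain ⟨f, hf, rfl⟩ := hc
        refine Or.inr ⟨f, rfl, ?_⟩
        ext g
        simp only [Finset.mem_filter, Finset.mem_insert]
        constructor
        · intro hg
          by_cases hb : b g = b f
          · exact Or.inl (h.injOn hD hg hf hb)
          · exact Or.inr ⟨hg, hb⟩
        · rintro (rfl | hg)
          · exact hf
          · exact hg.1
      · push Not at hc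
        left
        rw [Finset.filter_true_of_mem hc]
    · rintro (rfl | ⟨f, rfl, rfl⟩)
      · exact Finset.filter_true_of_mem hT
      · rw [Finset.filter_insert, if_neg (by simp), Finset.filter_true_of_mem hT]
  refine h1.trans ?_
  rw [measure_union _ .of_discrete, measure_iUnion _ (fun _ => .of_discrete), toMeasure_singleton,
    blockMass, ← ENNReal.tsum_mul_right]
  · congr 1
    refine tsum_congr fun f => ?_
    obtain ⟨f, rfl⟩ := f
    rw [toMeasure_singleton, h.apply_insert f hT]
  · rintro ⟨f, hf⟩ ⟨g, hg⟩ hfg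
    simp only [Function.onFun, disjoint_singleton]
    intro heq
    have : f ∈ insert g T := heq ▸ Finset.mem_insert_self f T
    rcases Finset.mem_insert.1 this with rfl | h2
    · exact hfg rfl
    · exact hT f h2 hf
  · rw [disjoint_iUnion_right]
    rintro ⟨f, hf⟩
    simp only [disjoint_singleton]
    intro heq
    exact hT f (heq ▸ Finset.mem_insert_self f T) hf

theorem restProb_ne_top (p : PMF (Finset α)) (b : α → β) (B : β) (T : Finset α) :
    restProb p b B T ≠ ∞ := measure_ne_top _ _

open Classical in
theorem blockMass_le_one (h : BlockInd p b) (B : β) : blockMass p b B ≤ 1 := by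
  obtain ⟨D, hD⟩ := p.support_nonempty
  set T := D.filter (fun f => b f ≠ B) with hTdef
  have hT : ∀ g ∈ T, b g ≠ B := fun g hg => (Finset.mem_filter.1 hg).2
  have hQ : restProb p b B T ≠ 0 := fun h0 =>
    hD (apply_eq_zero_of_toMeasure p (S := {D | D.filter (fun f => b f ≠ B) = T}) rfl h0)
  have h1 : blockMass p b B * restProb p b B T ≤ 1 * restProb p b B T := by
    rw [one_mul]
    exact le_of_le_of_eq le_add_self (h.restProb_eq B hT).symm
  exact (ENNReal.mul_le_mul_iff_left hQ (restProb_ne_top _ _ _ _)).1 h1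

theorem apply_eq (h : BlockInd p b) (B : β) {T : Finset α} (hT : ∀ g ∈ T, b g ≠ B) :
    p T = (1 - blockMass p b B) * restProb p b B T := by
  have h1 := h.restProb_eq B hT
  rw [ENNReal.sub_mul fun _ _ => restProb_ne_top _ _ _ _, one_mul]
  refine (ENNReal.sub_eq_of_eq_add ?_ h1).symm
  exact ENNReal.mul_ne_top (ne_top_of_le_ne_top ENNReal.one_ne_top (h.blockMass_le_one B))
    (restProb_ne_top _ _ _ _)

open Classical in
theorem mass_mul_le (h : BlockInd p b) (f : α) {T : Finset α} (hT : ∀ g ∈ T, b g ≠ b f) :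
    mass p f * p T ≤ p (insert f T) := by
  rw [h.apply_insert f hT]
  gcongr
  exact le_toMeasure p (Finset.filter_true_of_mem hT)

/-- The expected size is finite. -/
theorem tsum_mass_ne_top (h : BlockInd p b) : ∑' f, mass p f ≠ ∞ := by
  classical
  obtain ⟨T, hT⟩ := p.support_nonempty
  have hT0 : p T ≠ 0 := hT
  -- For `f ∈ A` the sets `insert f T` are distinct, so their probabilities sum to at most 1 and the
  -- masses to at most `(p T)⁻¹`. The blocks met by `T` number at most `T.card`, each of mass at
  -- most 1.
  set A : Set α := {f | ∀ g ∈ T, b g ≠ b f}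
  have h1 : ∑' f : A, mass p f.1 ≤ (p T)⁻¹ := by
    rw [ENNReal.le_inv_iff_mul_le, ← ENNReal.tsum_mul_right]
    calc ∑' f : A, mass p f.1 * p T ≤ ∑' f : A, p (insert f.1 T) :=
          ENNReal.tsum_le_tsum fun f => h.mass_mul_le f.1 f.2
      _ ≤ ∑' D, p D := by
          refine ENNReal.tsum_comp_le_tsum_of_injective (f := fun f : A => insert f.1 T) ?_ p
          rintro ⟨f, hf⟩ ⟨g, hg⟩ heq
          have : f ∈ insert g T := (show insert f T = insert g T from heq) ▸
            Finset.mem_insert_self f T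
          rcases Finset.mem_insert.1 this with rfl | h2
          · rfl
          · exact absurd rfl (hf f h2)
      _ = 1 := p.tsum_coe
  have h2 : ∑' f : ↑(⋃ g ∈ T, {f | b f = b g}), mass p f.1 ≤ T.card := by
    refine (ENNReal.tsum_biUnion_le (mass p) T fun g => {f | b f = b g}).trans ?_
    refine (Finset.sum_le_card_nsmul T _ 1 fun g _ => h.blockMass_le_one (b g)).trans ?_
    simp
  have h3 : ∑' f, mass p f ≤ (p T)⁻¹ + T.card := by
    calc ∑' f, mass p f = ∑' f : (univ : Set α), mass p f.1 := by rw [tsum_univ]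
      _ ≤ ∑' f : ↑(A ∪ ⋃ g ∈ T, {f | b f = b g}), mass p f.1 := by
          refine ENNReal.tsum_mono_subtype _ fun f _ => ?_
          by_cases hf : f ∈ A
          · exact Or.inl hf
          · right
            simp only [A, mem_ofPred_eq, not_forall, not_not] at hf
            obtain ⟨g, hg, hgf⟩ := hf
            simp only [mem_iUnion, mem_ofPred_eq]
            exact ⟨g, hg, hgf.symm⟩
      _ ≤ _ := (ENNReal.tsum_union_le _ _ _).trans (add_le_add h1 h2)
  refine ne_top_of_le_ne_top ?_ h3
  exact ENNReal.add_ne_top.2 ⟨ENNReal.inv_ne_top.2 hT0, ENNReal.natCast_ne_top _⟩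

/-- Only boundedly many blocks are certain to contribute an element. -/
theorem card_special_le (p : PMF (Finset α)) (b : α → β) (K : Finset β) (hK : ∀ B ∈ K, blockMass p b B = 1) :
    (K.card : ℝ≥0∞) ≤ ∑' f, mass p f := by
  classical
  have : (K.card : ℝ≥0∞) = ∑ B ∈ K, blockMass p b B := by
    rw [Finset.sum_congr rfl hK]; simp
  rw [this]
  calc ∑ B ∈ K, blockMass p b B = ∑ B ∈ K, ∑' f, (if b f = B then mass p f else 0) := by
        refine Finset.sum_congr rfl fun B _ => ?_
        rw [blockMass, show (∑' f : {f // b f = B}, mass p f.1) = ∑' f : ↑{f | b f = B}, mass p f.1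
          from rfl, tsum_subtype]
        exact tsum_congr fun f => by simp [Set.indicator_apply]
    _ = ∑' f, ∑ B ∈ K, (if b f = B then mass p f else 0) :=
        (Summable.tsum_finsetSum fun _ _ => ENNReal.summable).symm
    _ ≤ _ := ENNReal.tsum_le_tsum fun f => by
        rw [Finset.sum_ite_eq]
        split_ifs <;> simp

theorem finite_special (h : BlockInd p b) : {B | blockMass p b B = 1}.Finite := by
  by_contra hinf
  obtain ⟨n, hn⟩ := ENNReal.exists_nat_gt h.tsum_mass_ne_top
  obtain ⟨K, hK, hKn⟩ := Set.Infinite.exists_subset_card_eq hinf n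
  have := card_special_le p b K fun B hB => hK hB
  rw [hKn] at this
  exact absurd this (not_le.2 hn)

open Classical in
/-- Removing an element of a block that may be empty leaves a possible world. -/
theorem apply_erase_ne_zero (h : BlockInd p b) {D : Finset α} (hD : p D ≠ 0) {f : α} (hf : f ∈ D)
    (hB : blockMass p b (b f) ≠ 1) : p (D.erase f) ≠ 0 := by
  have hT : ∀ g ∈ D.erase f, b g ≠ b f := fun g hg hgf =>
    (Finset.mem_erase.1 hg).1 (h.injOn hD (Finset.mem_erase.1 hg).2 hf hgf)
  have h1 := h.apply_insert f hT
  rw [Finset.insert_erase hf] at h1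
  rw [h.apply_eq (b f) hT]
  refine mul_ne_zero (tsub_pos_of_lt (lt_of_le_of_ne (h.blockMass_le_one _) hB)).ne' ?_
  exact right_ne_zero_of_mul (h1 ▸ hD)

open Classical in
-- Elements of uncertain blocks can be erased one at a time by `apply_erase_ne_zero`.
theorem apply_filter_special_ne_zero (h : BlockInd p b) {D : Finset α} (hD : p D ≠ 0) :
    p (D.filter fun f => blockMass p b (b f) = 1) ≠ 0 := by
  induction hn : (D.filter fun f => blockMass p b (b f) ≠ 1).card generalizing D with
  | zero =>
    rw [Finset.card_eq_zero, Finset.filter_eq_empty_iff] at hn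
    rwa [Finset.filter_true_of_mem fun f hf => not_not.1 (hn hf)]
  | succ n ih =>
    obtain ⟨f, hf⟩ : (D.filter fun f => blockMass p b (b f) ≠ 1).Nonempty := by
      rw [← Finset.card_pos, hn]; omega
    have hf' := Finset.mem_filter.1 hf
    have := ih (h.apply_erase_ne_zero hD hf'.1 hf'.2) (by
      rw [Finset.filter_erase, Finset.card_erase_of_mem hf, hn]; omega)
    rwa [Finset.filter_erase, Finset.erase_eq_of_notMem (by simp [hf'.2])] at this

open Classical in
/-- Every world contains a world of bounded size. -/
theorem exists_bounded_subworld (h : BlockInd p b) :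
    ∃ N : ℕ, ∀ D, p D ≠ 0 → ∃ G ⊆ D, p G ≠ 0 ∧ G.card ≤ N := by
  obtain ⟨N, hN⟩ := ENNReal.exists_nat_gt h.tsum_mass_ne_top
  refine ⟨N, fun D hD => ⟨_, Finset.filter_subset _ _, h.apply_filter_special_ne_zero hD, ?_⟩⟩
  -- `b` is injective on a world, so `G` has at most as many elements as there are blocks of mass 1,
  -- a number bounded by the expected size.
  set G := D.filter fun f => blockMass p b (b f) = 1
  have h1 : (G.image b).card = G.card :=
    Finset.card_image_of_injOn ((h.injOn hD).mono (by exact_mod_cast Finset.filter_subset _ _))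
  have h2 := card_special_le p b (G.image b) (by
    simp only [Finset.mem_image]
    rintro B ⟨f, hf, rfl⟩
    exact (Finset.mem_filter.1 hf).2)
  rw [h1] at h2
  exact_mod_cast (h2.trans_lt hN).le

/-- Two different elements from two given sets. -/
theorem toMeasure_meets_le (h : BlockInd p b) {F F' : Set α} (hF : Disjoint F F') :
    p.toMeasure {D | (∃ f ∈ F, f ∈ D) ∧ ∃ f ∈ F', f ∈ D} ≤
      (∑' f : F, mass p f.1) * ∑' f : F', mass p f.1 := by
  classical
  have h1 : {D : Finset α | (∃ f ∈ F, f ∈ D) ∧ ∃ f ∈ F', f ∈ D} ⊆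
      ⋃ f : F, ⋃ g : F', {D | f.1 ∈ D ∧ g.1 ∈ D} := by
    rintro D ⟨⟨f, hf, hfD⟩, g, hg, hgD⟩
    simp only [mem_iUnion]
    exact ⟨⟨f, hf⟩, ⟨g, hg⟩, hfD, hgD⟩
  refine (measure_mono h1).trans ((measure_iUnion_le _).trans ?_)
  rw [← ENNReal.tsum_mul_right]
  refine ENNReal.tsum_le_tsum fun f => (measure_iUnion_le _).trans ?_
  rw [← ENNReal.tsum_mul_left]
  refine ENNReal.tsum_le_tsum fun g => ?_
  have hne : f.1 ≠ g.1 := fun e => Set.disjoint_left.1 hF f.2 (e ▸ g.2)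
  by_cases hb : b f.1 = b g.1
  · rw [h.excl _ _ hne hb]; exact zero_le
  · have := h.indep {f.1, g.1} (by
      intro x hx y hy hxy
      simp only [Finset.coe_insert, Finset.coe_singleton, mem_insert_iff, mem_singleton_iff]
        at hx hy
      rcases hx with rfl | rfl <;> rcases hy with rfl | rfl
      · rfl
      · exact absurd hxy hb
      · exact absurd hxy.symm hb
      · rfl)
    rw [Finset.prod_pair hne] at this
    rw [← this]
    exact measure_mono fun D hD => by
      simp only [mem_ofPred_eq, Finset.insert_subset_iff, Finset.singleton_subset_iff]
      exact hD

end BlockInd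

end RandomFinset

end ProbDB

/-! ### Construction of independent sets, and a bound on pairs of facts -/

namespace ProbDB

open MeasureTheory Set
open scoped ENNReal NNReal

section IndependentSets

variable {α β : Type*} [Countable α]

set_option linter.unusedSectionVars false

/-- Summing over all points forces `c = 1`; normalising constants need not be computed. -/
theorem PMF.eq_of_proportional {γ : Type*} {p q : PMF γ} (c : ℝ≥0∞) (h : ∀ x, p x = c * q x) :
    p = q := by
  have h1 : (1 : ℝ≥0∞) = c * 1 := by
    calc (1 : ℝ≥0∞) = ∑' x, p x := p.tsum_coe.symm
      _ = ∑' x, c * q x := tsum_congr h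
      _ = c * 1 := by rw [ENNReal.tsum_mul_left, q.tsum_coe]
  rw [mul_one] at h1
  exact PMF.ext fun x => by rw [h x, ← h1, one_mul]

/-- The independent random finite set with odds `o`. -/
theorem exists_independent (o : α → ℝ≥0) (ho : Summable o) :
    ∃ p : PMF (Finset α), p ∅ ≠ 0 ∧ (∀ D, p D = p ∅ * ∏ f ∈ D, (o f : ℝ≥0∞)) ∧
      BlockInd p id ∧ ∀ f, mass p f = o f / (1 + o f) := by
  classical
  set w : Finset α → ℝ≥0∞ := fun D => ∏ f ∈ D, (o f : ℝ≥0∞) with hw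
  have hsum : ∑' D, w D ≠ ∞ := by
    -- Formally `∑' D, w D` is the product of the factors `1 + o f`, which converges because the
    -- odds are summable.
    have h1 : Summable fun D : Finset α => ∏ f ∈ D, o f := by
      rw [← NNReal.summable_coe]
      simpa using summable_finsetProd_of_summable_norm (f := fun f => (o f : ℝ))
        (by simpa using NNReal.summable_coe.2 ho)
    have h2 := ENNReal.tsum_coe_ne_top_iff_summable.2 h1
    simpa [hw] using h2
  have hsum0 : ∑' D, w D ≠ 0 := fun h => by
    have := ENNReal.tsum_eq_zero.1 h ∅
    simp [hw] at this
  set p := PMF.normalize w hsum0 hsum with hp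
  have hpD : ∀ D, p D = w D * (∑' D, w D)⁻¹ := fun D => PMF.normalize_apply _ _ D
  have hp0 : p ∅ = (∑' D, w D)⁻¹ := by rw [hpD]; simp [hw]
  have hpD' : ∀ D, p D = p ∅ * w D := fun D => by rw [hpD, hp0, mul_comm]
  -- Inserting `f` maps the sets without `f` bijectively onto those with `f` and multiplies the
  -- weight by `o f`. So among the supersets of `s`, those with `f` and those without are in the
  -- ratio `o f : 1`.
  have step : ∀ (s : Finset α) (f : α), f ∉ s →
      p.toMeasure {D | insert f s ⊆ D} = o f / (1 + o f) * p.toMeasure {D | s ⊆ D} := by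
    intro s f hf
    set a := p.toMeasure {D | s ⊆ D ∧ f ∉ D} with ha
    have h1 : p.toMeasure {D | insert f s ⊆ D} = o f * a := by
      have e1 : p.toMeasure {D | insert f s ⊆ D} =
          ∑' D : {D : Finset α // f ∉ D}, if s ⊆ D.1 then p (insert f D.1) else 0 := by
        rw [p.toMeasure_apply_eq_tsum]
        have hinj : Function.Injective (fun D : {D : Finset α // f ∉ D} => insert f D.1) := by
          rintro ⟨D, hD⟩ ⟨E, hE⟩ h
          have := congrArg (fun X => X.erase f) h
          simpa [Finset.erase_insert hD, Finset.erase_insert hE] using this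
        rw [← hinj.tsum_eq]
        · refine tsum_congr fun D => ?_
          have : insert f s ⊆ insert f D.1 ↔ s ⊆ D.1 := by
            constructor
            · intro h g hg
              have := h (Finset.mem_insert_of_mem hg)
              rcases Finset.mem_insert.1 this with rfl | h
              · exact absurd hg hf
              · exact h
            · exact Finset.insert_subset_insert f
          simp [Set.indicator_apply, this]
        · intro D hD
          have hD' : insert f s ⊆ D := by
            by_contra hc
            exact hD (by simp [hc])
          have hfD : f ∈ D := hD' (Finset.mem_insert_self f s)
          exact ⟨⟨D.erase f, by simp⟩, Finset.insert_erase hfD⟩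
      have e2 : a = ∑' D : {D : Finset α // f ∉ D}, if s ⊆ D.1 then p D.1 else 0 := by
        rw [ha, p.toMeasure_apply_eq_tsum]
        refine Eq.trans ?_ (tsum_subtype {D : Finset α | f ∉ D}
          fun D => if s ⊆ D then p D else 0).symm
        refine tsum_congr fun D => ?_
        by_cases h1 : s ⊆ D <;> by_cases h2 : f ∈ D <;> simp [h1, h2]
      rw [e1, e2, ← ENNReal.tsum_mul_left]
      refine tsum_congr fun D => ?_
      split_ifs with h
      · rw [hpD', hpD' D.1]
        simp only [hw]
        rw [Finset.prod_insert D.2]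
        ring
      · simp
    have h2 : p.toMeasure {D | s ⊆ D} = o f * a + a := by
      rw [← h1, ha, ← measure_union _ .of_discrete]
      · congr 1
        ext D
        simp only [mem_ofPred_eq, mem_union, Finset.insert_subset_iff]
        tauto
      · rw [Set.disjoint_left]
        intro D hD hD'
        exact hD'.2 (hD (Finset.mem_insert_self f s))
    rw [h1, h2, show (o f : ℝ≥0∞) * a + a = (1 + o f) * a by ring, ← mul_assoc,
      ENNReal.div_mul_cancel (by simp) (by simp)]
  have all : ∀ s : Finset α, p.toMeasure {D | s ⊆ D} = ∏ f ∈ s, (o f / (1 + o f) : ℝ≥0∞) := by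
    intro s
    induction s using Finset.induction_on with
    | empty => simp
    | insert f s hf ih => rw [step s f hf, Finset.prod_insert hf, ih]
  have hm : ∀ f, mass p f = o f / (1 + o f) := fun f => by
    have := all {f}
    simpa [mass] using this
  refine ⟨p, ?_, hpD', ⟨fun s _ => ?_, fun f g hne he => absurd he hne⟩, hm⟩
  · rw [hp0]; exact ENNReal.inv_ne_zero.2 hsum
  · rw [all s]
    exact Finset.prod_congr rfl fun f _ => (hm f).symm

/-- The independent random set over an injective sequence, with odds `w n`. -/
theorem exists_independent_seq (t : ℕ → α) (ht : Function.Injective t) (w : ℕ → ℝ≥0)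
    (hw : Summable w) :
    ∃ p : PMF (Finset α), p ∅ ≠ 0 ∧ BlockInd p id ∧ (∀ n, mass p (t n) = w n / (1 + w n)) ∧
      ∀ f, f ∉ Set.range t → mass p f = 0 := by
  obtain ⟨p, h0, -, h2, h3⟩ := exists_independent (Function.extend t w 0)
    ((Function.Injective.summable_iff ht (f := Function.extend t w 0) (by
      intro x hx
      rw [Function.extend_apply' _ _ _ hx]; rfl)).1 (by
      rwa [Function.extend_comp ht]))
  refine ⟨p, h0, h2, fun n => ?_, fun f hf => ?_⟩
  · rw [h3, ht.extend_apply]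
  · rw [h3, Function.extend_apply' _ _ _ hf]
    simp

theorem tsum_tsum_mass_le (p : PMF (Finset α)) (F : ℕ → Set α)
    (hF : Pairwise (Function.onFun Disjoint F)) :
    ∑' i, ∑' f : F i, mass p f.1 ≤ ∑' f, mass p f := by
  rw [← ENNReal.tsum_biUnion fun i _ j _ hij => hF hij]
  exact ENNReal.tsum_comp_le_tsum_of_injective Subtype.val_injective _

/-- In a block-independent set, the events of meeting both `F i` and `F' i` cannot have
probabilities of the order `1 / i ^ 2`. -/
theorem BlockInd.not_heavy {p : PMF (Finset α)} {b : α → β} (h : BlockInd p b) (F F' : ℕ → Set α)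
    (hF : Pairwise (Function.onFun Disjoint F)) (hF' : Pairwise (Function.onFun Disjoint F'))
    (hd : ∀ i, Disjoint (F i) (F' i)) (c : ℝ) (hc : 0 < c)
    (hp : ∀ i : ℕ, ENNReal.ofReal (c / (i + 1) ^ 2) ≤
      p.toMeasure {D | (∃ f ∈ F i, f ∈ D) ∧ ∃ f ∈ F' i, f ∈ D}) : False := by
  set u : ℕ → ℝ≥0∞ := fun i => ∑' f : F i, mass p f.1
  set v : ℕ → ℝ≥0∞ := fun i => ∑' f : F' i, mass p f.1
  have hu : ∑' i, u i ≠ ∞ := ne_top_of_le_ne_top h.tsum_mass_ne_top (tsum_tsum_mass_le p F hF)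
  have hv : ∑' i, v i ≠ ∞ := ne_top_of_le_ne_top h.tsum_mass_ne_top (tsum_tsum_mass_le p F' hF')
  have hui : ∀ i, u i ≠ ∞ := ENNReal.ne_top_of_tsum_ne_top hu
  have hvi : ∀ i, v i ≠ ∞ := ENNReal.ne_top_of_tsum_ne_top hv
  have hus : Summable fun i => (u i).toReal := ENNReal.summable_toReal hu
  have hvs : Summable fun i => (v i).toReal := ENNReal.summable_toReal hv
  -- The square of the left side is `c / (i + 1) ^ 2 ≤ u i * v i ≤ (u i + v i) ^ 2`. Summed over
  -- `i`, this contradicts the divergence of the harmonic series.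
  have hle : ∀ i : ℕ, Real.sqrt c * (1 / ((i + 1 : ℕ) : ℝ)) ≤ (u i).toReal + (v i).toReal := by
    intro i
    have h1 : ENNReal.ofReal (c / (i + 1) ^ 2) ≤ u i * v i :=
      (hp i).trans (h.toMeasure_meets_le (hd i))
    have h2 : c / (i + 1) ^ 2 ≤ (u i).toReal * (v i).toReal := by
      rw [← ENNReal.toReal_mul]
      exact (ENNReal.ofReal_le_iff_le_toReal (ENNReal.mul_ne_top (hui i) (hvi i))).1 h1
    have hu0 : 0 ≤ (u i).toReal := ENNReal.toReal_nonneg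
    have hv0 : 0 ≤ (v i).toReal := ENNReal.toReal_nonneg
    have h3 : (Real.sqrt c * (1 / ((i + 1 : ℕ) : ℝ))) ^ 2 = c / (i + 1) ^ 2 := by
      rw [mul_pow, Real.sq_sqrt hc.le]
      push_cast
      rw [div_pow, one_pow]; ring
    refine le_of_sq_le_sq ?_ (add_nonneg hu0 hv0)
    rw [h3]
    nlinarith [sq_nonneg (u i).toReal, sq_nonneg (v i).toReal, mul_nonneg hu0 hv0]
  have hs : Summable fun i : ℕ => Real.sqrt c * (1 / ((i + 1 : ℕ) : ℝ)) :=
    Summable.of_nonneg_of_le (fun i => by positivity) hle (hus.add hvs)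
  have hs2 : Summable fun i : ℕ => (1 / ((i + 1 : ℕ) : ℝ)) :=
    (summable_mul_left_iff (Real.sqrt_pos.2 hc).ne').1 hs
  exact Real.not_summable_one_div_natCast
    ((summable_nat_add_iff (f := fun n : ℕ => 1 / (n : ℝ)) 1).1 hs2)

end IndependentSets

end ProbDB

/-! ### First-order views as definable maps of instances -/

namespace ProbDB

open MeasureTheory Set
open scoped ENNReal NNReal

universe v

variable {U : Type v}

/-! ### Substitution -/

namespace Term

def subst {m n : ℕ} (s : Fin m → Term U n) : Term U m → Term U n
  | .var i => s i
  | .const c => .const c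

def weaken {n : ℕ} : Term U n → Term U (n + 1)
  | .var i => .var i.castSucc
  | .const c => .const c

theorem val_subst {m n : ℕ} (s : Fin m → Term U n) (t : Term U m) (v : Fin n → U) :
    (t.subst s).val v = t.val fun i => (s i).val v := by
  cases t <;> rfl

theorem val_weaken {n : ℕ} (t : Term U n) (v : Fin n → U) (a : U) :
    t.weaken.val (Fin.snoc v a : Fin (n + 1) → U) = t.val v := by
  cases t <;> simp [weaken, val]

def lift {m n : ℕ} (s : Fin m → Term U n) : Fin (m + 1) → Term U (n + 1) :=
  Fin.snoc (fun i => (s i).weaken) (.var (Fin.last n))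

theorem val_lift {m n : ℕ} (s : Fin m → Term U n) (v : Fin n → U) (a : U) :
    (fun i => (lift s i).val (Fin.snoc v a : Fin (n + 1) → U)) =
      (Fin.snoc (fun i => (s i).val v) a : Fin (m + 1) → U) := by
  funext i
  refine Fin.lastCases ?_ (fun i => ?_) i
  · simp [lift, val]
  · simp [lift, val_weaken]

end Term

namespace Formula

variable {τ : Schema}

/-- Free of constants, so it never enlarges the range of a formula; true also when the range is
empty. -/
def verum {n : ℕ} : Formula τ U n := .all (.eq (Fin.last n) (.var (Fin.last n)))

theorem sat_verum {n : ℕ} (D : Instance τ U) (A : Finset U) (v : Fin n → U) :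
    (verum : Formula τ U n).Sat D A v := by
  intro a _
  simp [Sat, Term.val]

open Classical in
-- The atom `eq` needs a variable on its left, which substitution may turn into a constant; an
-- equality of two constants is decided outright.
noncomputable def termEq {n : ℕ} : Term U n → Term U n → Formula τ U n
  | .var i, t => .eq i t
  | .const c, .var j => .eq j (.const c)
  | .const c, .const d => if c = d then verum else .neg verum

theorem sat_termEq {n : ℕ} (s t : Term U n) (D : Instance τ U) (A : Finset U) (v : Fin n → U) :
    (termEq s t : Formula τ U n).Sat D A v ↔ s.val v = t.val v := by
  rcases s with i | c <;> rcases t with j | d <;> simp only [termEq, Sat, Term.val]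
  · exact eq_comm
  · split_ifs with h <;> simp [h, sat_verum, Sat]

noncomputable def subst : {m : ℕ} → Formula τ U m → {n : ℕ} → (Fin m → Term U n) → Formula τ U n
  | _, rel R t, _, s => .rel R fun i => (t i).subst s
  | _, eq i t, _, s => termEq (s i) (t.subst s)
  | _, neg φ, _, s => .neg (φ.subst s)
  | _, and φ ψ, _, s => .and (φ.subst s) (ψ.subst s)
  | _, or φ ψ, _, s => .or (φ.subst s) (ψ.subst s)
  | _, ex φ, _, s => .ex (φ.subst (Term.lift s))
  | _, all φ, _, s => .all (φ.subst (Term.lift s))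

theorem sat_subst (D : Instance τ U) (A : Finset U) {m : ℕ} (φ : Formula τ U m) :
    ∀ {n : ℕ} (s : Fin m → Term U n) (v : Fin n → U),
      (φ.subst s).Sat D A v ↔ φ.Sat D A fun i => (s i).val v := by
  induction φ with
  | rel R t => intro n s v; simp only [subst, Sat, Term.val_subst]
  | eq i t => intro n s v; simp only [subst, sat_termEq, Sat, Term.val_subst]
  | neg φ ih => intro n s v; simp only [subst, Sat, ih]
  | and φ ψ ih₁ ih₂ => intro n s v; simp only [subst, Sat, ih₁, ih₂]
  | or φ ψ ih₁ ih₂ => intro n s v; simp only [subst, Sat, ih₁, ih₂]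
  | ex φ ih => intro n s v; simp only [subst, Sat, ih, Term.val_lift]
  | all φ ih => intro n s v; simp only [subst, Sat, ih, Term.val_lift]

/-- Conjoining such a formula adds prescribed constants to the range of quantification without
changing satisfaction over a given range. -/
theorem exists_tautology (n : ℕ) (C : Finset U) : ∃ φ : Formula τ U n, C ⊆ φ.consts ∧
    ∀ D A v, φ.Sat D A v := by
  classical
  induction C using Finset.induction_on with
  | empty => exact ⟨verum, by simp, fun D A v => sat_verum D A v⟩
  | insert c C _ ih =>
    obtain ⟨φ, h1, h2⟩ := ih
    -- The first disjunct is always true; the second one serves only to mention `c`.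
    refine ⟨.and (.or verum (.ex (.eq (Fin.last n) (.const c)))) φ, ?_,
      fun D A v => ⟨Or.inl (sat_verum D A v), h2 D A v⟩⟩
    simp only [consts, Term.consts]
    exact Finset.insert_subset (by simp) (h1.trans Finset.subset_union_right)

end Formula

/-! ### Definable relations -/

variable {σ τ τ' : Schema}

theorem mem_adom {D : Instance τ U} {a : U} : a ∈ adom D ↔ ∃ f ∈ D, ∃ i, f.2 i = a := by
  simp [adom]

theorem adom_mono {D D' : Instance τ U} (h : D ⊆ D') : adom D ⊆ adom D' := fun a ha => by
  rw [mem_adom] at ha ⊢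
  obtain ⟨f, hf, hi⟩ := ha
  exact ⟨f, h hf, hi⟩

open Classical in
/-- A relation between instances and tuples that is expressed by a domain independent formula. -/
def Definable (n : ℕ) (P : Instance σ U → (Fin n → U) → Prop) : Prop :=
  ∃ φ : Formula σ U n, ∀ D A v, adom D ∪ φ.consts ⊆ A → (φ.Sat D A v ↔ P D v)

namespace Definable

variable {n : ℕ} {P Q : Instance σ U → (Fin n → U) → Prop}

theorem congr (hP : Definable n P) (h : ∀ D v, P D v ↔ Q D v) : Definable n Q := by
  have : P = Q := by
    funext D v; exact propext (h D v)
  exact this ▸ hP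

open Classical in
theorem exists_consts (hP : Definable n P) (C : Finset U) :
    ∃ φ : Formula σ U n, C ⊆ φ.consts ∧
      ∀ D A v, adom D ∪ φ.consts ⊆ A → (φ.Sat D A v ↔ P D v) := by
  obtain ⟨φ, hφ⟩ := hP
  obtain ⟨ψ, h1, h2⟩ := Formula.exists_tautology (τ := σ) n C
  refine ⟨.and φ ψ, h1.trans Finset.subset_union_right, fun D A v hA => ?_⟩
  simp only [Formula.Sat, h2, and_true]
  refine hφ D A v (Finset.Subset.trans ?_ hA)
  exact Finset.union_subset_union_right Finset.subset_union_left

theorem neg (hP : Definable n P) : Definable n fun D v => ¬ P D v := by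
  obtain ⟨φ, hφ⟩ := hP
  exact ⟨.neg φ, fun D A v hA => not_congr (hφ D A v hA)⟩

theorem and (hP : Definable n P) (hQ : Definable n Q) : Definable n fun D v => P D v ∧ Q D v := by
  classical
  obtain ⟨φ, hφ⟩ := hP
  obtain ⟨ψ, hψ⟩ := hQ
  refine ⟨.and φ ψ, fun D A v hA => and_congr (hφ D A v ?_) (hψ D A v ?_)⟩ <;>
  · refine Finset.Subset.trans (Finset.union_subset_union_right ?_) hA
    simp [Formula.consts]

theorem or (hP : Definable n P) (hQ : Definable n Q) : Definable n fun D v => P D v ∨ Q D v :=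
  (hP.neg.and hQ.neg).neg.congr fun D v => by tauto

theorem imp (hP : Definable n P) (hQ : Definable n Q) : Definable n fun D v => P D v → Q D v :=
  (hP.neg.or hQ).congr fun D v => by tauto

theorem of_const (p : Prop) : Definable (σ := σ) (U := U) n fun _ _ => p := by
  by_cases hp : p
  · exact ⟨.verum, fun D A v _ => by simp [hp, Formula.sat_verum]⟩
  · exact ⟨.neg .verum, fun D A v _ => by simp [hp, Formula.Sat, Formula.sat_verum]⟩

theorem exists_mem_finset {ι : Type*} (s : Finset ι) {P : ι → Instance σ U → (Fin n → U) → Prop}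
    (h : ∀ i ∈ s, Definable n (P i)) : Definable n fun D v => ∃ i ∈ s, P i D v := by
  classical
  induction s using Finset.induction_on with
  | empty => exact (of_const False).congr fun D v => by simp
  | insert i s _ ih =>
    exact ((h i (Finset.mem_insert_self i s)).or
      (ih fun j hj => h j (Finset.mem_insert_of_mem hj))).congr fun D v => by simp

theorem exists_finite {ι : Type*} [Finite ι] {P : ι → Instance σ U → (Fin n → U) → Prop}
    (h : ∀ i, Definable n (P i)) : Definable n fun D v => ∃ i, P i D v := by
  have := Fintype.ofFinite ι
  exact (exists_mem_finset Finset.univ fun i _ => h i).congr fun D v => by simp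

theorem forall_finite {ι : Type*} [Finite ι] {P : ι → Instance σ U → (Fin n → U) → Prop}
    (h : ∀ i, Definable n (P i)) : Definable n fun D v => ∀ i, P i D v :=
  (exists_finite fun i => (h i).neg).neg.congr fun D v => by simp

theorem subst {m : ℕ} {P : Instance σ U → (Fin m → U) → Prop} (hP : Definable m P)
    (s : Fin m → Term U n) : Definable n fun D v => P D fun i => (s i).val v := by
  classical
  obtain ⟨φ, hφ⟩ := hP
  -- Substitution deletes constants where `termEq` decides an equality; the tautology restores them,
  -- so that the range still contains those of `φ`.
  obtain ⟨ψ, h1, h2⟩ := Formula.exists_tautology (τ := σ) n φ.consts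
  refine ⟨.and (φ.subst s) ψ, fun D A v hA => ?_⟩
  simp only [Formula.Sat, h2, and_true, Formula.sat_subst]
  refine hφ D A _ (Finset.Subset.trans (Finset.union_subset_union_right ?_) hA)
  exact h1.trans Finset.subset_union_right

theorem reindex {m : ℕ} {P : Instance σ U → (Fin m → U) → Prop} (hP : Definable m P)
    (e : Fin m → Fin n) : Definable n fun D v => P D fun i => v (e i) :=
  hP.subst fun i => .var (e i)

theorem mem (R : σ.Rel) : Definable (σ.arity R) fun (D : Instance σ U) v => ⟨R, v⟩ ∈ D :=
  ⟨.rel R fun i => .var i, fun _ _ _ _ => Iff.rfl⟩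

theorem eq (i j : Fin n) : Definable n fun (_ : Instance σ U) v => v i = v j :=
  ⟨.eq i (.var j), fun _ _ _ _ => Iff.rfl⟩

theorem eq_const (i : Fin n) (c : U) : Definable n fun (_ : Instance σ U) v => v i = c :=
  ⟨.eq i (.const c), fun _ _ _ _ => Iff.rfl⟩

open Classical in
-- The bound `hC` makes the quantifier independent of the range: every witness lies in `adom D ∪ C`,
-- and a formula that mentions all of `C` has these elements in its range.
theorem ex {P : Instance σ U → (Fin (n + 1) → U) → Prop} (hP : Definable (n + 1) P)
    (C : Finset U) (hC : ∀ D w, P D w → w (Fin.last n) ∈ adom D ∪ C) :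
    Definable n fun D v => ∃ a, P D (Fin.snoc v a) := by
  obtain ⟨φ, h1, h2⟩ := hP.exists_consts C
  refine ⟨.ex φ, fun D A v hA => ?_⟩
  simp only [Formula.Sat, Formula.consts] at hA ⊢
  constructor
  · rintro ⟨a, _, ha⟩
    exact ⟨a, (h2 D A _ hA).1 ha⟩
  · rintro ⟨a, ha⟩
    have := hC D _ ha
    rw [Fin.snoc_last] at this
    exact ⟨a, hA (Finset.union_subset_union_right h1 this), (h2 D A _ hA).2 ha⟩

open Classical in
theorem ex_block (k : ℕ) {P : Instance σ U → (Fin (n + k) → U) → Prop}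
    (hP : Definable (n + k) P) (C : Finset U)
    (hC : ∀ D w, P D w → ∀ j, w (Fin.natAdd n j) ∈ adom D ∪ C) :
    Definable n fun D v => ∃ y : Fin k → U, P D (Fin.append v y) := by
  induction k with
  | zero =>
    refine hP.congr fun D v => ?_
    have : ∀ y : Fin 0 → U, Fin.append v y = v := fun y => by
      rw [Subsingleton.elim y Fin.elim0, Fin.append_elim0]; rfl
    simp [this]
  | succ k ih =>
    have h1 : Definable (n + k) fun D w => ∃ a, P D (Fin.snoc w a : Fin (n + k + 1) → U) :=
      ex (n := n + k) hP C fun D w hw => hC D w hw (Fin.last k)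
    refine (ih h1 ?_).congr fun D v => ?_
    · rintro D w ⟨a, ha⟩ j
      have h2 := hC D _ ha j.castSucc
      have h3 : (Fin.snoc w a : Fin (n + k + 1) → U) (Fin.natAdd n j).castSucc =
        w (Fin.natAdd n j) := Fin.snoc_castSucc (α := fun _ => U) a w (Fin.natAdd n j)
      rw [← h3]
      exact h2
    · constructor
      · rintro ⟨y, a, h⟩
        refine ⟨Fin.snoc y a, ?_⟩
        rwa [Fin.append_snoc]
      · rintro ⟨y, h⟩
        refine ⟨Fin.init y, y (Fin.last k), ?_⟩
        rw [← Fin.append_snoc, Fin.snoc_init_self]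
        exact h

end Definable

/-! ### Definable maps between instances -/

open Classical in
/-- A map between instances that is given by a first-order view. -/
structure DefMap (F : Instance σ U → Instance τ U) : Prop where
  mem : ∀ R, Definable (τ.arity R) fun D v => ⟨R, v⟩ ∈ F D
  bounded : ∃ C : Finset U, ∀ D, adom (F D) ⊆ adom D ∪ C

namespace DefMap

variable {F : Instance σ U → Instance τ U}

/-- Elements of `adom (F D)` are arguments of facts of `F D`, and all arguments of such a fact lie
in the bounded set `adom D ∪ C`, so they can be quantified. -/
theorem mem_adom_definable (hF : DefMap F) {n : ℕ} (i : Fin n) :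
    Definable n fun D v => v i ∈ adom (F D) := by
  classical
  obtain ⟨C, hC⟩ := hF.bounded
  have h1 : ∀ (R : τ.Rel) (j : Fin (τ.arity R)), Definable n fun D v =>
      ∃ y : Fin (τ.arity R) → U, (⟨R, fun k => Fin.append v y (Fin.natAdd n k)⟩ : Fact τ U) ∈ F D ∧
        Fin.append v y (Fin.natAdd n j) = Fin.append v y (Fin.castAdd _ i) := fun R j => by
    refine Definable.ex_block (τ.arity R) (P := fun D w =>
      (⟨R, fun k => w (Fin.natAdd n k)⟩ : Fact τ U) ∈ F D ∧ w (Fin.natAdd n j) =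
        w (Fin.castAdd _ i)) (((hF.mem R).reindex (Fin.natAdd n)).and (.eq _ _)) C ?_
    rintro D w ⟨hw, -⟩ k
    exact hC D (mem_adom.2 ⟨_, hw, k, rfl⟩)
  have := τ.finite
  refine (Definable.exists_finite fun R => Definable.exists_finite fun j => h1 R j).congr
    fun D v => ?_
  simp only [Fin.append_right, Fin.append_left, mem_adom]
  constructor
  · rintro ⟨R, j, y, h, hj⟩
    exact ⟨_, h, j, hj⟩
  · rintro ⟨⟨R, y⟩, h, j, hj⟩
    exact ⟨R, j, y, h, hj⟩

open Classical in
-- Composition of queries: atoms are replaced by the formulas that define `F`, and quantifiers are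
-- relativised to `adom (F D) ∪ C`, which is definable and bounded.
theorem sat_definable (hF : DefMap F) (C : Finset U) {n : ℕ} (φ : Formula τ U n) :
    Definable n fun D v => φ.Sat (F D) (adom (F D) ∪ C) v := by
  induction φ with
  | rel R t => exact (hF.mem R).subst t
  | eq i t => exact ⟨.eq i t, fun _ _ _ _ => Iff.rfl⟩
  | neg φ ih => exact ih.neg
  | and φ ψ ih₁ ih₂ => exact ih₁.and ih₂
  | or φ ψ ih₁ ih₂ => exact ih₁.or ih₂
  | @ex n φ ih =>
    obtain ⟨C', hC'⟩ := hF.bounded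
    have hg : Definable (n + 1) fun D w => w (Fin.last n) ∈ adom (F D) ∪ C :=
      ((hF.mem_adom_definable (Fin.last n)).or
        (Definable.exists_mem_finset C fun c _ => .eq_const (Fin.last n) c)).congr
        fun D w => by simp
    refine (Definable.ex (hg.and ih) (C' ∪ C) ?_).congr fun D v => ?_
    · rintro D w ⟨hw, -⟩
      rcases Finset.mem_union.1 hw with h | h
      · have := Finset.mem_union.1 (hC' D h)
        simp only [Finset.mem_union]; tauto
      · simp only [Finset.mem_union]; tauto
    · simp [Formula.Sat]
  | @all n φ ih =>
    obtain ⟨C', hC'⟩ := hF.bounded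
    have hg : Definable (n + 1) fun D w => w (Fin.last n) ∈ adom (F D) ∪ C :=
      ((hF.mem_adom_definable (Fin.last n)).or
        (Definable.exists_mem_finset C fun c _ => .eq_const (Fin.last n) c)).congr
        fun D w => by simp
    refine (Definable.ex (hg.and ih.neg) (C' ∪ C) ?_).neg.congr fun D v => ?_
    · rintro D w ⟨hw, -⟩
      rcases Finset.mem_union.1 hw with h | h
      · have := Finset.mem_union.1 (hC' D h)
        simp only [Finset.mem_union]; tauto
      · simp only [Finset.mem_union]; tauto
    · simp [Formula.Sat]

/-- Definable relations are stable under definable maps. -/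
theorem definable_comp (hF : DefMap F) {n : ℕ} {P : Instance τ U → (Fin n → U) → Prop}
    (hP : Definable n P) : Definable n fun D v => P (F D) v := by
  obtain ⟨φ, hφ⟩ := hP
  exact (hF.sat_definable φ.consts φ).congr fun D v => hφ (F D) _ v subset_rfl

theorem comp {G : Instance τ U → Instance τ' U} (hG : DefMap G) (hF : DefMap F) :
    DefMap fun D => G (F D) := by
  classical
  refine ⟨fun R => hF.definable_comp (hG.mem R), ?_⟩
  obtain ⟨C, hC⟩ := hF.bounded
  obtain ⟨C', hC'⟩ := hG.bounded
  refine ⟨C ∪ C', fun D a ha => ?_⟩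
  have h1 := Finset.mem_union.1 (hC' _ ha)
  simp only [Finset.mem_union]
  rcases h1 with h1 | h1
  · have := Finset.mem_union.1 (hC _ h1)
    tauto
  · tauto

theorem id : DefMap fun D : Instance σ U => D :=
  ⟨fun R => .mem R, ∅, fun D => by simp⟩

theorem const (D₀ : Instance τ U) : DefMap fun _ : Instance σ U => D₀ := by
  classical
  refine ⟨fun R => ?_, adom D₀, fun D => by simp⟩
  have : ∀ f ∈ D₀, Definable (σ := σ) (τ.arity R) fun _ v => (⟨R, v⟩ : Fact τ U) = f := by
    rintro ⟨R', u⟩ -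
    by_cases h : R = R'
    · subst h
      have : Finite (Fin (τ.arity R)) := inferInstance
      refine (Definable.forall_finite fun i => .eq_const i (u i)).congr fun D v => ?_
      simp [funext_iff]
    · exact (Definable.of_const False).congr fun D v => by simp [h]
  exact (Definable.exists_mem_finset D₀ this).congr fun D v => by simp

open Classical in
theorem ite {F' : Instance σ U → Instance τ U} (hF : DefMap F) (hF' : DefMap F')
    {P : Instance σ U → Prop} (hP : Definable 0 fun D _ => P D) :
    DefMap fun D => if P D then F D else F' D := by
  refine ⟨fun R => ?_, ?_⟩
  · have h1 : Definable (τ.arity R) fun D _ => P D := hP.reindex Fin.elim0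
    refine ((h1.and (hF.mem R)).or (h1.neg.and (hF'.mem R))).congr fun D v => ?_
    by_cases h : P D <;> simp [h]
  · obtain ⟨C, hC⟩ := hF.bounded
    obtain ⟨C', hC'⟩ := hF'.bounded
    refine ⟨C ∪ C', fun D a ha => ?_⟩
    simp only [Finset.mem_union]
    split_ifs at ha
    · have := Finset.mem_union.1 (hC D ha); tauto
    · have := Finset.mem_union.1 (hC' D ha); tauto

end DefMap

theorem Formula.mem_answers {n : ℕ} (φ : Formula τ U n) (D : Instance τ U) (v : Fin n → U) :
    v ∈ φ.answers D ↔ (∀ i, v i ∈ φ.range D) ∧ φ.Sat D (φ.range D) v := by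
  classical
  exact Finset.mem_filter.trans (and_congr Fintype.mem_piFinset Iff.rfl)

theorem View.mem_apply (V : View τ τ' U) (D : Instance τ U) (R : τ'.Rel)
    (v : Fin (τ'.arity R) → U) : (⟨R, v⟩ : Fact τ' U) ∈ V.apply D ↔
      (∀ i, v i ∈ (V R).range D) ∧ (V R).Sat D ((V R).range D) v := by
  simp [View.apply, Formula.mem_answers]

theorem View.defMap (V : View τ τ' U) : DefMap V.apply := by
  classical
  refine ⟨fun R => ?_, Finset.univ.biUnion fun R => (V R).consts, fun D a ha => ?_⟩
  · have h1 : ∀ i : Fin (τ'.arity R), Definable (τ'.arity R) fun (D : Instance τ U) v =>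
        v i ∈ (V R).range D := fun i =>
      ((DefMap.id.mem_adom_definable i).or
        (Definable.exists_mem_finset (V R).consts fun c _ => .eq_const i c)).congr
        fun D w => by simp [Formula.range]
    refine ((Definable.forall_finite h1).and
      (DefMap.id.sat_definable (V R).consts (V R))).congr fun D v => ?_
    rw [View.mem_apply]
    rfl
  · obtain ⟨⟨R, v⟩, hv, i, rfl⟩ := mem_adom.1 ha
    have := ((V.mem_apply D R v).1 hv).1 i
    simp only [Formula.range, Finset.mem_union, Finset.mem_biUnion] at this ⊢
    rcases this with h | h
    · exact Or.inl h
    · exact Or.inr ⟨R, Finset.mem_univ _, h⟩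

/-- The formulas are made to mention the bound `C`, so that the restriction of answers to the active
domain loses no fact of `F D`. -/
theorem DefMap.exists_view {F : Instance τ U → Instance τ' U} (hF : DefMap F) :
    ∃ V : View τ τ' U, V.apply = F := by
  classical
  obtain ⟨C, hC⟩ := hF.bounded
  choose φ h1 h2 using fun R => (hF.mem R).exists_consts C
  refine ⟨φ, funext fun D => ?_⟩
  ext ⟨R, v⟩
  rw [View.mem_apply, h2 R D ((φ R).range D) v subset_rfl]
  constructor
  · exact fun h => h.2
  · refine fun h => ⟨fun i => ?_, h⟩
    exact Finset.union_subset_union_right (h1 R) (hC D (mem_adom.2 ⟨_, h, i, rfl⟩))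

theorem mem_viewsOver_FO {C : PDBClass U} {q : PDB τ' U} :
    q ∈ viewsOver (FO U) C τ' ↔ ∃ (τ : Schema) (p : PDB τ U) (F : Instance τ U → Instance τ' U),
      p ∈ C τ ∧ DefMap F ∧ q = p.map F := by
  constructor
  · rintro ⟨τ, p, V, hp, -, rfl⟩
    exact ⟨τ, p, V.apply, hp, V.defMap, rfl⟩
  · rintro ⟨τ, p, F, hp, hF, rfl⟩
    obtain ⟨V, rfl⟩ := hF.exists_view
    exact ⟨τ, p, V, hp, fun _ => trivial, rfl⟩

theorem viewsOver_FO_le {C C' : PDBClass U} (h : C ≤ viewsOver (FO U) C') :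
    viewsOver (FO U) C ≤ viewsOver (FO U) C' := by
  intro τ' q hq
  obtain ⟨τ, p, F, hp, hF, rfl⟩ := mem_viewsOver_FO.1 hq
  obtain ⟨σ, p₀, G, hp₀, hG, rfl⟩ := mem_viewsOver_FO.1 (h τ hp)
  exact mem_viewsOver_FO.2 ⟨σ, p₀, _, hp₀, hF.comp hG, PMF.map_comp _ _ _⟩

theorem viewsOver_mono {F F' : Fragment U} {C C' : PDBClass U} (hF : ∀ τ n, F τ n ⊆ F' τ n)
    (hC : C ≤ C') : viewsOver F C ≤ viewsOver F' C' := by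
  rintro τ' q ⟨τ, p, V, hp, hV, rfl⟩
  exact ⟨τ, p, V, hC τ hp, fun R => hF _ _ (hV R), rfl⟩

end ProbDB

/-! ### Product weights of block-independent databases -/

namespace ProbDB

open MeasureTheory Set
open scoped ENNReal NNReal

/-! ### The weights of a block-independent set -/

section Weights

variable {α β : Type*} [Countable α]

open Classical in
-- The weight of `f` is its mass if its block has mass 1, and otherwise its mass divided by the
-- probability that its block is empty. Conditioning a tuple-independent law with odds `o` on the
-- block constraints produces the same shape.
theorem BlockInd.exists_weights {p : PMF (Finset α)} {b : α → β} (h : BlockInd p b) :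
    ∃ (o : α → ℝ≥0) (c : ℝ≥0∞), Summable o ∧ ∀ D, p D =
      if Set.InjOn b D ∧ ∀ B, blockMass p b B = 1 → ∃ f ∈ D, b f = B
        then c * ∏ f ∈ D, (o f : ℝ≥0∞) else 0 := by
  set S : Set β := {B | blockMass p b B = 1} with hSdef
  -- Deleting the certain blocks gives a block-independent law `p'` under which every block may be
  -- empty, hence `p' ∅ ≠ 0`; the constant will be `c = p' ∅`.
  set Φ : Finset α → Finset α := fun D => D.filter fun f => b f ∉ S with hΦ
  set p' := p.map Φ with hp'
  have hmap : ∀ X : Set (Finset α), p'.toMeasure X = p.toMeasure (Φ ⁻¹' X) := fun X =>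
    PMF.toMeasure_map_apply _ _ _ (measurable_of_countable Φ) .of_discrete
  have hsub : ∀ s : Finset α, (∀ f ∈ s, b f ∉ S) →
      p'.toMeasure {D | s ⊆ D} = p.toMeasure {D | s ⊆ D} := by
    intro s hs
    rw [hmap]
    congr 1
    ext D
    simp only [hΦ, mem_preimage, mem_ofPred_eq]
    exact ⟨fun hh f hf => (Finset.mem_filter.1 (hh hf)).1,
      fun hh f hf => Finset.mem_filter.2 ⟨hh hf, hs f hf⟩⟩
  have hsub0 : ∀ s : Finset α, (∃ f ∈ s, b f ∈ S) → p'.toMeasure {D | s ⊆ D} = 0 := by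
    rintro s ⟨f, hf, hfS⟩
    rw [hmap, show Φ ⁻¹' {D | s ⊆ D} = ∅ from ?_, measure_empty]
    ext D
    simp only [hΦ, mem_preimage, mem_ofPred_eq, mem_empty_iff_false, iff_false]
    exact fun hh => (Finset.mem_filter.1 (hh hf)).2 hfS
  have hmass : ∀ f, b f ∉ S → mass p' f = mass p f := fun f hf => by
    simpa [mass] using hsub {f} (by simpa using hf)
  have hmass0 : ∀ f, b f ∈ S → mass p' f = 0 := fun f hf => by
    simpa [mass] using hsub0 {f} ⟨f, by simp, hf⟩
  have h' : BlockInd p' b := by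
    refine ⟨fun s hs => ?_, fun f g hne hb => ?_⟩
    · by_cases hc : ∀ f ∈ s, b f ∉ S
      · rw [hsub s hc, h.indep s hs]
        exact Finset.prod_congr rfl fun f hf => (hmass f (hc f hf)).symm
      · push Not at hc
        obtain ⟨f, hf, hfS⟩ := hc
        rw [hsub0 s ⟨f, hf, hfS⟩, Finset.prod_eq_zero hf (hmass0 f hfS)]
    · rw [hmap]
      refine le_antisymm (le_of_le_of_eq (measure_mono ?_) (h.excl f g hne hb)) zero_le
      rintro D ⟨h1, h2⟩
      exact ⟨(Finset.mem_filter.1 h1).1, (Finset.mem_filter.1 h2).1⟩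
  have hbm : ∀ B, B ∉ S → blockMass p' b B = blockMass p b B := fun B hB =>
    tsum_congr fun f => hmass f.1 (by rw [f.2]; exact hB)
  have hbm1 : ∀ B, blockMass p' b B ≠ 1 := by
    intro B
    by_cases hB : B ∈ S
    · have : blockMass p' b B = 0 :=
        ENNReal.tsum_eq_zero.2 fun f => hmass0 f.1 (by rw [f.2]; exact hB)
      simp [this]
    · rw [hbm B hB]; exact hB
  have h0 : p' ∅ ≠ 0 := by
    obtain ⟨D, hD⟩ := p'.support_nonempty
    have := h'.apply_filter_special_ne_zero hD
    rwa [Finset.filter_false_of_mem fun f _ => hbm1 _] at this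
  have hr : ∀ f, b f ∉ S → 1 - blockMass p b (b f) ≠ 0 := fun f hf =>
    (tsub_pos_of_lt (lt_of_le_of_ne (h.blockMass_le_one _) hf)).ne'
  set o : α → ℝ≥0∞ := fun f => if b f ∈ S then mass p f else mass p f / (1 - blockMass p b (b f))
    with ho
  have hins : ∀ f, b f ∉ S → ∀ T : Finset α, (∀ g ∈ T, b g ≠ b f) →
      p' (insert f T) = o f * p' T := by
    intro f hf T hT
    rw [h'.apply_insert f hT, h'.apply_eq (b f) hT, hmass f hf, hbm _ hf, ← mul_assoc]
    congr 1
    simp only [ho, if_neg hf]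
    rw [ENNReal.div_mul_cancel (hr f hf) (ne_top_of_le_ne_top ENNReal.one_ne_top tsub_le_self)]
  have hprod : ∀ N : Finset α, Set.InjOn b N → (∀ f ∈ N, b f ∉ S) →
      p' N = p' ∅ * ∏ f ∈ N, o f := by
    intro N
    induction N using Finset.induction_on with
    | empty => simp
    | insert f N hf ih =>
      intro hi hs
      rw [hins f (hs f (Finset.mem_insert_self f N)) N, ih (hi.mono (by simp))
        (fun g hg => hs g (Finset.mem_insert_of_mem hg)), Finset.prod_insert hf]
      · ring
      · intro g hg hgf
        have : g = f := hi (by simp [hg]) (by simp) hgf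
        exact hf (this ▸ hg)
  have hosum : ∑' f, o f ≠ ∞ := by
    -- In an uncertain block the odds are `p' {f} / p' ∅`, and the probabilities of distinct
    -- singletons sum to at most 1.
    have h1 : ∀ f, o f ≤ mass p f + (p' ∅)⁻¹ * p' {f} := by
      intro f
      by_cases hf : b f ∈ S
      · simp [ho, hf]
      · have := hins f hf ∅ (by simp)
        rw [LawfulSingleton.insert_empty_eq] at this
        rw [this, mul_comm (o f), ← mul_assoc, ENNReal.inv_mul_cancel h0 (p'.apply_ne_top _),
          one_mul]
        exact le_add_self
    refine ne_top_of_le_ne_top ?_ (ENNReal.tsum_le_tsum h1)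
    rw [ENNReal.tsum_add, ENNReal.tsum_mul_left]
    refine ENNReal.add_ne_top.2 ⟨h.tsum_mass_ne_top, ENNReal.mul_ne_top
      (ENNReal.inv_ne_top.2 h0) (ne_top_of_le_ne_top ENNReal.one_ne_top ?_)⟩
    rw [← p'.tsum_coe]
    exact ENNReal.tsum_comp_le_tsum_of_injective Finset.singleton_injective p'
  have hotop : ∀ f, o f ≠ ∞ := ENNReal.ne_top_of_tsum_ne_top hosum
  refine ⟨fun f => (o f).toNNReal, p' ∅, ?_, fun D => ?_⟩
  · rw [← ENNReal.tsum_coe_ne_top_iff_summable]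
    simpa [ENNReal.coe_toNNReal (hotop _)] using hosum
  simp only [ENNReal.coe_toNNReal (hotop _)]
  split_ifs with hc
  · obtain ⟨hi, hs⟩ := hc
    set A := D.filter fun f => b f ∈ S with hA
    have hAS : b '' A = S := by
      ext B
      constructor
      · rintro ⟨f, hf, rfl⟩
        exact (Finset.mem_filter.1 (Finset.mem_coe.1 hf)).2
      · intro hB
        obtain ⟨f, hf, rfl⟩ := hs B hB
        exact ⟨f, Finset.mem_coe.2 (Finset.mem_filter.2 ⟨hf, hB⟩), rfl⟩
    have hAD : A ⊆ D := Finset.filter_subset _ _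
    -- `A` fills all certain blocks, so it determines a world there, independently of the other
    -- blocks.
    have key : p.toMeasure {E | A ⊆ E ∧ E.filter (fun f => b f ∉ S) = Φ D} =
        (∏ f ∈ A, mass p f) * p.toMeasure {E | E.filter (fun f => b f ∉ S) = Φ D} := by
      have := h.indep_rest (S := A) (hi.mono (by exact_mod_cast hAD)) (Φ D)
      simp only [hAS] at this
      convert this
    have e1 : p.toMeasure {E | A ⊆ E ∧ E.filter (fun f => b f ∉ S) = Φ D} = p D := by
      rw [← toMeasure_singleton]
      refine toMeasure_congr_support p fun E hE => ?_
      simp only [mem_ofPred_eq, mem_singleton_iff]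
      constructor
      · rintro ⟨h1, h2⟩
        ext f
        by_cases hf : b f ∈ S
        · constructor
          · intro hfE
            obtain ⟨g, hg, hgf⟩ := hs _ hf
            have hgE : g ∈ E := h1 (Finset.mem_filter.2 ⟨hg, hgf.symm ▸ hf⟩)
            exact (h.injOn hE hgE hfE hgf) ▸ hg
          · exact fun hfD => h1 (Finset.mem_filter.2 ⟨hfD, hf⟩)
        · have := congrArg (f ∈ ·) h2
          simpa [hΦ, hf] using this
      · rintro rfl
        exact ⟨hAD, rfl⟩
    have e2 : p.toMeasure {E | E.filter (fun f => b f ∉ S) = Φ D} = p' (Φ D) := by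
      rw [← toMeasure_singleton, hmap]
      rfl
    rw [e1, e2, hprod (Φ D) (hi.mono (by exact_mod_cast Finset.filter_subset _ _))
      (fun f hf => (Finset.mem_filter.1 hf).2)] at key
    rw [key, ← Finset.prod_filter_mul_prod_filter_not D (fun f => b f ∈ S),
      Finset.prod_congr rfl fun f hf => (show mass p f = o f from ?_)]
    · ring
    · simp only [ho, if_pos (Finset.mem_filter.1 hf).2]
  · by_contra hD
    -- A world that missed a block of mass 1 would have probability 0, by the factor `1 - blockMass
    -- p b B` in `apply_eq`.
    refine hc ⟨h.injOn hD, fun B hB => ?_⟩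
    by_contra! hne
    exact hD (by rw [h.apply_eq B hne, hB]; simp)

end Weights

universe v

variable {U : Type v} [Countable U] {τ : Schema}

/-! ### Tuple-independent and block-independent databases -/

theorem prob_eq (p : PDB τ U) (S : Set (Instance τ U)) : p.prob S = p.toMeasure S :=
  (p.toMeasure_apply_eq_toOuterMeasure S).symm

theorem mass_eq_zero_of_notMem_facts (p : PDB τ U) {f : Fact τ U} (hf : f ∉ p.facts) :
    mass p f = 0 := by
  refine le_antisymm (le_of_le_of_eq (toMeasure_mono_support p (T := ∅) ?_) measure_empty) zero_le
  intro D hD hfD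
  exact hf ⟨D, pos_iff_ne_zero.2 hD, hfD⟩

theorem prob_subtype (p : PDB τ U) (s : Finset p.facts) :
    p.prob {D | ∀ f ∈ s, f.1 ∈ D} = p.toMeasure {D | s.map (.subtype _) ⊆ D} := by
  rw [prob_eq]
  congr 1
  ext D
  simp [Finset.subset_iff]

theorem prod_prob_subtype (p : PDB τ U) (s : Finset p.facts) :
    ∏ f ∈ s, p.prob {D | f.1 ∈ D} = ∏ f ∈ s.map (.subtype _), mass p f := by
  rw [Finset.prod_map]
  exact Finset.prod_congr rfl fun f _ => prob_eq p _

theorem BlockInd.isTI {p : PDB τ U} (h : BlockInd p id) : p.IsTI := fun s => by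
  rw [prob_subtype, prod_prob_subtype, h.indep _ (Function.injective_id.injOn)]

/-- The given blocks partition only the possible facts. All other facts receive the label `none`;
having mass 0, they satisfy both conditions. -/
theorem PDB.IsBID.exists_blockInd {p : PDB τ U} (h : p.IsBID) :
    ∃ (β : Type v) (b : Fact τ U → β), Countable β ∧ BlockInd p b := by
  classical
  obtain ⟨r, h1, h2⟩ := h
  refine ⟨Option (Quotient r), fun f => if hf : f ∈ p.facts then some (Quotient.mk r ⟨f, hf⟩)
    else none, inferInstance, fun s hs => ?_, fun f g hne hb => ?_⟩
  · by_cases hc : ∀ f ∈ s, f ∈ p.facts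
    · have hsub : (s.subtype (· ∈ p.facts)).map (.subtype _) = s := Finset.subtype_map_of_mem hc
      rw [← hsub, ← prod_prob_subtype, ← prob_subtype]
      refine h1 _ fun f hf g hg hne hr => hne ?_
      refine Subtype.ext (hs (Finset.mem_subtype.1 hf) (Finset.mem_subtype.1 hg) ?_)
      simp only [f.2, g.2, dif_pos]
      exact congrArg some (Quotient.sound hr)
    · push Not at hc
      obtain ⟨f, hf, hfp⟩ := hc
      rw [Finset.prod_eq_zero hf (mass_eq_zero_of_notMem_facts p hfp)]
      refine le_antisymm (le_of_le_of_eq (measure_mono fun D hD => hD hf)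
        (mass_eq_zero_of_notMem_facts p hfp)) zero_le
  · by_cases hf : f ∈ p.facts <;> by_cases hg : g ∈ p.facts <;> simp [hf, hg] at hb
    · rw [← prob_eq]
      exact h2 ⟨f, hf⟩ ⟨g, hg⟩ (Quotient.exact hb) fun e => hne (congrArg Subtype.val e)
    · exact le_antisymm (le_of_le_of_eq (measure_mono fun D hD => hD.1)
        (mass_eq_zero_of_notMem_facts p hf)) zero_le

omit [Countable U] in
theorem PDB.IsTI.isBID {p : PDB τ U} (h : p.IsTI) : p.IsBID :=
  ⟨⊥, fun s _ => h s, fun _ _ hr hne => absurd hr hne⟩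

omit [Countable U] in
theorem TI_le_BID : TI U ≤ BID U := fun _ _ hp => PDB.IsTI.isBID hp

theorem PDB.IsTI.blockInd {p : PDB τ U} (h : p.IsTI) : BlockInd p id := by
  classical
  refine ⟨fun s _ => ?_, fun f g hne hb => absurd hb hne⟩
  by_cases hc : ∀ f ∈ s, f ∈ p.facts
  · have hsub : (s.subtype (· ∈ p.facts)).map (.subtype _) = s := Finset.subtype_map_of_mem hc
    rw [← hsub, ← prod_prob_subtype, ← prob_subtype]
    exact h _
  · push Not at hc
    obtain ⟨f, hf, hfp⟩ := hc
    rw [Finset.prod_eq_zero hf (mass_eq_zero_of_notMem_facts p hfp)]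
    refine le_antisymm (le_of_le_of_eq (measure_mono fun D hD => hD hf)
      (mass_eq_zero_of_notMem_facts p hfp)) zero_le

/-- A database with at most one fact is tuple-independent. -/
theorem isTI_of_subsingleton (p : PDB τ U) (h : Subsingleton (Fact τ U)) : p.IsTI := by
  refine BlockInd.isTI ⟨fun s _ => ?_, fun f g hne _ => absurd (Subsingleton.elim f g) hne⟩
  rcases s.eq_empty_or_nonempty with rfl | ⟨f, hf⟩
  · simp
  · have : s = {f} := by
      ext g; simp [Subsingleton.elim g f, hf]
    rw [this]
    simp [mass]

/-- The schema with one relation symbol. -/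
def uniSchema (k : ℕ) : Schema := ⟨Unit, inferInstance, inferInstance, fun _ => k⟩

end ProbDB

/-! ### Independent repetition and the removal of conditioning -/

namespace ProbDB

open MeasureTheory Set
open scoped ENNReal NNReal

universe v

variable {U : Type v} {σ τ τ' τ₁ τ₂ : Schema}

/-! ### Independent pairs of databases -/

/-- The disjoint union of two schemas. -/
def sumSchema (τ₁ τ₂ : Schema) : Schema where
  Rel := τ₁.Rel ⊕ τ₂.Rel
  finite := inferInstance
  nonempty := τ₁.nonempty.map Sum.inl
  arity := Sum.elim τ₁.arity τ₂.arity

def inlFact (τ₁ τ₂ : Schema) : Fact τ₁ U ↪ Fact (sumSchema τ₁ τ₂) U where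
  toFun f := ⟨Sum.inl f.1, f.2⟩
  inj' := by
    rintro ⟨R, u⟩ ⟨R', u'⟩ h
    obtain ⟨h1, h2⟩ := Sigma.mk.inj_iff.1 h
    obtain rfl := Sum.inl_injective h1
    exact congrArg (Sigma.mk R) (eq_of_heq h2)

def inrFact (τ₁ τ₂ : Schema) : Fact τ₂ U ↪ Fact (sumSchema τ₁ τ₂) U where
  toFun f := ⟨Sum.inr f.1, f.2⟩
  inj' := by
    rintro ⟨R, u⟩ ⟨R', u'⟩ h
    obtain ⟨h1, h2⟩ := Sigma.mk.inj_iff.1 h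
    obtain rfl := Sum.inr_injective h1
    exact congrArg (Sigma.mk R) (eq_of_heq h2)

theorem inlFact_ne_inrFact (f : Fact τ₁ U) (g : Fact τ₂ U) :
    inlFact τ₁ τ₂ f ≠ inrFact τ₁ τ₂ g := fun h => by
  have := (Sigma.mk.inj_iff.1 h).1
  exact Sum.inl_ne_inr this

theorem sumSchema_cases (f : Fact (sumSchema τ₁ τ₂) U) :
    (∃ g, f = inlFact τ₁ τ₂ g) ∨ ∃ g, f = inrFact τ₁ τ₂ g := by
  obtain ⟨R | R, u⟩ := f
  · exact Or.inl ⟨⟨R, u⟩, rfl⟩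
  · exact Or.inr ⟨⟨R, u⟩, rfl⟩

noncomputable def leftPart (D : Instance (sumSchema τ₁ τ₂) U) : Instance τ₁ U :=
  D.preimage (inlFact τ₁ τ₂) (inlFact τ₁ τ₂).injective.injOn

noncomputable def rightPart (D : Instance (sumSchema τ₁ τ₂) U) : Instance τ₂ U :=
  D.preimage (inrFact τ₁ τ₂) (inrFact τ₁ τ₂).injective.injOn

open Classical in
noncomputable def joinParts (D : Instance τ₁ U) (E : Instance τ₂ U) :
    Instance (sumSchema τ₁ τ₂) U :=
  D.map (inlFact τ₁ τ₂) ∪ E.map (inrFact τ₁ τ₂)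

theorem mem_leftPart {D : Instance (sumSchema τ₁ τ₂) U} {f : Fact τ₁ U} :
    f ∈ leftPart D ↔ inlFact τ₁ τ₂ f ∈ D := Finset.mem_preimage

theorem mem_rightPart {D : Instance (sumSchema τ₁ τ₂) U} {f : Fact τ₂ U} :
    f ∈ rightPart D ↔ inrFact τ₁ τ₂ f ∈ D := Finset.mem_preimage

theorem inl_mem_joinParts {D : Instance τ₁ U} {E : Instance τ₂ U} {f : Fact τ₁ U} :
    inlFact τ₁ τ₂ f ∈ joinParts D E ↔ f ∈ D := by
  classical
  rw [joinParts, Finset.mem_union, Finset.mem_map']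
  refine or_iff_left fun h => ?_
  obtain ⟨g, -, hg⟩ := Finset.mem_map.1 h
  exact inlFact_ne_inrFact f g hg.symm

theorem inr_mem_joinParts {D : Instance τ₁ U} {E : Instance τ₂ U} {f : Fact τ₂ U} :
    inrFact τ₁ τ₂ f ∈ joinParts D E ↔ f ∈ E := by
  classical
  rw [joinParts, Finset.mem_union, Finset.mem_map']
  refine or_iff_right fun h => ?_
  obtain ⟨g, -, hg⟩ := Finset.mem_map.1 h
  exact inlFact_ne_inrFact g f hg

theorem leftPart_joinParts (D : Instance τ₁ U) (E : Instance τ₂ U) :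
    leftPart (joinParts D E) = D := by
  ext f; rw [mem_leftPart, inl_mem_joinParts]

theorem rightPart_joinParts (D : Instance τ₁ U) (E : Instance τ₂ U) :
    rightPart (joinParts D E) = E := by
  ext f; rw [mem_rightPart, inr_mem_joinParts]

theorem joinParts_parts (D : Instance (sumSchema τ₁ τ₂) U) :
    joinParts (leftPart D) (rightPart D) = D := by
  ext f
  rcases sumSchema_cases f with ⟨g, rfl⟩ | ⟨g, rfl⟩
  · rw [inl_mem_joinParts, mem_leftPart]
  · rw [inr_mem_joinParts, mem_rightPart]

theorem subset_joinParts {s : Instance (sumSchema τ₁ τ₂) U} {D : Instance τ₁ U}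
    {E : Instance τ₂ U} : s ⊆ joinParts D E ↔ leftPart s ⊆ D ∧ rightPart s ⊆ E := by
  constructor
  · refine fun h => ⟨fun f hf => ?_, fun f hf => ?_⟩
    · exact inl_mem_joinParts.1 (h (mem_leftPart.1 hf))
    · exact inr_mem_joinParts.1 (h (mem_rightPart.1 hf))
  · rintro ⟨h1, h2⟩ f hf
    rcases sumSchema_cases f with ⟨g, rfl⟩ | ⟨g, rfl⟩
    · exact inl_mem_joinParts.2 (h1 (mem_leftPart.2 hf))
    · exact inr_mem_joinParts.2 (h2 (mem_rightPart.2 hf))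

theorem defMap_leftPart : DefMap (leftPart (U := U) (τ₁ := τ₁) (τ₂ := τ₂)) := by
  classical
  refine ⟨fun R => ?_, ∅, fun D a ha => ?_⟩
  · exact (Definable.mem (σ := sumSchema τ₁ τ₂) (Sum.inl R)).congr fun D v =>
      (mem_leftPart (D := D) (f := ⟨R, v⟩)).symm
  · obtain ⟨f, hf, i, rfl⟩ := mem_adom.1 ha
    rw [Finset.union_empty]
    exact mem_adom.2 ⟨_, mem_leftPart.1 hf, i, rfl⟩

theorem defMap_rightPart : DefMap (rightPart (U := U) (τ₁ := τ₁) (τ₂ := τ₂)) := by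
  classical
  refine ⟨fun R => ?_, ∅, fun D a ha => ?_⟩
  · exact (Definable.mem (σ := sumSchema τ₁ τ₂) (Sum.inr R)).congr fun D v =>
      (mem_rightPart (D := D) (f := ⟨R, v⟩)).symm
  · obtain ⟨f, hf, i, rfl⟩ := mem_adom.1 ha
    rw [Finset.union_empty]
    exact mem_adom.2 ⟨_, mem_rightPart.1 hf, i, rfl⟩

/-- The law of an independent pair. -/
noncomputable def pairPDB (p : PDB τ₁ U) (q : PDB τ₂ U) : PDB (sumSchema τ₁ τ₂) U :=
  p.bind fun D => q.map (joinParts D)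

theorem toMeasure_pairPDB [Countable U] (p : PDB τ₁ U) (q : PDB τ₂ U)
    (s : Instance (sumSchema τ₁ τ₂) U) :
    (pairPDB p q).toMeasure {D | s ⊆ D} =
      p.toMeasure {D | leftPart s ⊆ D} * q.toMeasure {D | rightPart s ⊆ D} := by
  rw [pairPDB, PMF.toMeasure_bind_apply _ _ _ .of_discrete, p.toMeasure_apply_eq_tsum,
    ← ENNReal.tsum_mul_right]
  refine tsum_congr fun D => ?_
  rw [PMF.toMeasure_map_apply _ _ _ (measurable_of_countable _) .of_discrete]
  by_cases h : leftPart s ⊆ D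
  · simp [h, subset_joinParts]
  · simp [h, subset_joinParts]

theorem isTI_pairPDB [Countable U] {p : PDB τ₁ U} {q : PDB τ₂ U} (hp : p.IsTI) (hq : q.IsTI) :
    (pairPDB p q).IsTI := by
  classical
  have hl : ∀ f, mass (pairPDB p q) (inlFact τ₁ τ₂ f) = mass p f := fun f => by
    have h := toMeasure_pairPDB p q {inlFact τ₁ τ₂ f}
    have h1 : leftPart {inlFact τ₁ τ₂ f} = {f} := by
      ext g; simp [mem_leftPart]
    have h2 : rightPart {inlFact τ₁ τ₂ f} = (∅ : Instance τ₂ U) := by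
      ext g; simp [mem_rightPart, (inlFact_ne_inrFact f g).symm]
    simpa [h1, h2, mass] using h
  have hr : ∀ f, mass (pairPDB p q) (inrFact τ₁ τ₂ f) = mass q f := fun f => by
    have h := toMeasure_pairPDB p q {inrFact τ₁ τ₂ f}
    have h1 : rightPart {inrFact τ₁ τ₂ f} = {f} := by
      ext g; simp [mem_rightPart]
    have h2 : leftPart {inrFact τ₁ τ₂ f} = (∅ : Instance τ₁ U) := by
      ext g; simp [mem_leftPart, inlFact_ne_inrFact g f]
    simpa [h1, h2, mass] using h
  refine BlockInd.isTI ⟨fun s _ => ?_, fun f g hne he => absurd he hne⟩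
  rw [toMeasure_pairPDB, hp.blockInd.indep _ Function.injective_id.injOn,
    hq.blockInd.indep _ Function.injective_id.injOn]
  conv_rhs => rw [← joinParts_parts s]
  rw [joinParts, Finset.prod_union, Finset.prod_map, Finset.prod_map]
  · simp [hl, hr]
  · rw [Finset.disjoint_left]
    intro f hf hf'
    obtain ⟨g, -, rfl⟩ := Finset.mem_map.1 hf
    obtain ⟨g', -, hg'⟩ := Finset.mem_map.1 hf'
    exact inlFact_ne_inrFact g g' hg'.symm

open Classical in
-- Both sources are placed independently in the disjoint union of their schemas; one first-order
-- view inspects the left part and decides which part to evaluate.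
theorem bind_mem_FO_TI [Countable U] {p : PDB τ₁ U} (hp : p.IsTI) {q : PDB τ' U}
    (hq : q ∈ viewsOver (FO U) (TI U) τ') {K : Instance τ₁ U → Instance τ' U} (hK : DefMap K)
    {P : Instance τ₁ U → Prop} (hP : Definable 0 fun D _ => P D) :
    (p.bind fun D => if P D then PMF.pure (K D) else q) ∈ viewsOver (FO U) (TI U) τ' := by
  obtain ⟨τ₂, q₀, F, hq₀, hF, rfl⟩ := mem_viewsOver_FO.1 hq
  refine mem_viewsOver_FO.2 ⟨sumSchema τ₁ τ₂, pairPDB p q₀, _, isTI_pairPDB hp hq₀,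
    (hK.comp defMap_leftPart).ite (hF.comp defMap_rightPart)
      (defMap_leftPart.definable_comp hP), ?_⟩
  rw [pairPDB, PMF.map_bind]
  congr 1
  funext D
  rw [PMF.map_comp]
  simp only [Function.comp_def, leftPart_joinParts, rightPart_joinParts]
  split_ifs
  · exact (PMF.map_const q₀ (K D)).symm
  · rfl

/-! ### Definable properties of instances -/

/-- A quantifier over facts is a finite disjunction over relation symbols, each with a block of
quantifiers for the arguments. -/
theorem Definable.ex_fact {n : ℕ} {Q : Instance σ U → Fact σ U → (Fin n → U) → Prop}
    (h : ∀ R, Definable (n + σ.arity R) fun D w =>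
      Q D ⟨R, fun i => w (Fin.natAdd n i)⟩ fun i => w (Fin.castAdd _ i)) :
    Definable n fun D v => ∃ f ∈ D, Q D f v := by
  classical
  have h1 : ∀ R, Definable n fun D v => ∃ y : Fin (σ.arity R) → U,
      (⟨R, fun i => Fin.append v y (Fin.natAdd n i)⟩ : Fact σ U) ∈ D ∧
        Q D ⟨R, fun i => Fin.append v y (Fin.natAdd n i)⟩
          fun i => Fin.append v y (Fin.castAdd _ i) := fun R => by
    refine Definable.ex_block (σ.arity R) (P := fun D w =>
      (⟨R, fun i => w (Fin.natAdd n i)⟩ : Fact σ U) ∈ D ∧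
        Q D ⟨R, fun i => w (Fin.natAdd n i)⟩ fun i => w (Fin.castAdd _ i))
      (((Definable.mem R).reindex (Fin.natAdd n)).and (h R)) ∅ ?_
    rintro D w ⟨hw, -⟩ j
    rw [Finset.union_empty]
    exact mem_adom.2 ⟨_, hw, j, rfl⟩
  have := σ.finite
  refine (Definable.exists_finite h1).congr fun D v => ?_
  simp only [Fin.append_right, Fin.append_left, Sigma.exists]

theorem Definable.forall_fact {n : ℕ} {Q : Instance σ U → Fact σ U → (Fin n → U) → Prop}
    (h : ∀ R, Definable (n + σ.arity R) fun D w =>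
      Q D ⟨R, fun i => w (Fin.natAdd n i)⟩ fun i => w (Fin.castAdd _ i)) :
    Definable n fun D v => ∀ f ∈ D, Q D f v :=
  (Definable.ex_fact (Q := fun D f v => ¬ Q D f v) fun R => (h R).neg).neg.congr
    fun D v => by push Not; rfl

theorem Definable.fact_mem (f : Fact σ U) : Definable 0 fun D _ => f ∈ D :=
  (Definable.mem f.1).subst fun i => .const (f.2 i)

theorem Definable.eq_instance (D₀ : Instance σ U) : Definable 0 fun D _ => D = D₀ := by
  have h1 : Definable 0 fun (D : Instance σ U) _ => ∀ f ∈ D, f ∈ D₀ :=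
    Definable.forall_fact (Q := fun _ f _ => f ∈ D₀) fun R =>
      ((DefMap.const (σ := σ) D₀).mem R).reindex (Fin.natAdd 0)
  have h2 : Definable 0 fun (D : Instance σ U) _ => ∃ f ∈ D₀, f ∉ D :=
    Definable.exists_mem_finset D₀ fun f _ => (Definable.fact_mem f).neg
  refine (h1.and h2.neg).congr fun D v => ?_
  push Not
  exact ⟨fun h => Finset.Subset.antisymm h.1 h.2, fun h => h ▸ ⟨fun _ h => h, fun _ h => h⟩⟩

theorem Definable.same_fact {n : ℕ} (R R' : σ.Rel) (e : Fin (σ.arity R) → Fin n)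
    (e' : Fin (σ.arity R') → Fin n) : Definable n fun (_ : Instance σ U) w =>
      (⟨R, fun i => w (e i)⟩ : Fact σ U) = ⟨R', fun i => w (e' i)⟩ := by
  by_cases h : R = R'
  · subst h
    refine (Definable.forall_finite fun i => Definable.eq (e i) (e' i)).congr fun D v => ?_
    simp [funext_iff]
  · exact (Definable.of_const False).congr fun D v => by simp [h]

theorem Formula.holds_definable (φ : Formula σ U 0) :
    Definable 0 fun (D : Instance σ U) _ => φ.Holds D Fin.elim0 :=
  (DefMap.id.sat_definable φ.consts φ).congr fun D v => by
    rw [Subsingleton.elim v Fin.elim0]; rfl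

/-! ### Conditioning -/

/-- Both have total mass 1. The probability of the default value in a sampling scheme therefore
needs no computation. -/
theorem PMF.eq_of_eq_off {γ : Type*} {p q : PMF γ} (x₀ : γ) (h : ∀ x, x ≠ x₀ → p x = q x) :
    p = q := by
  classical
  refine PMF.ext fun x => ?_
  by_cases hx : x = x₀
  · subst hx
    have h1 := p.tsum_coe
    have h2 := q.tsum_coe
    rw [ENNReal.tsum_eq_add_tsum_ite x] at h1 h2
    have h3 : ∑' y, (if y = x then 0 else p y) = ∑' y, (if y = x then 0 else q y) :=
      tsum_congr fun y => by split_ifs with hy <;> [rfl; exact h y hy]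
    rw [h3, ← h2] at h1
    refine (ENNReal.add_left_inj ?_).1 h1
    refine ne_top_of_le_ne_top ENNReal.one_ne_top ?_
    rw [← h2]; exact le_add_self
  · exact h x hx

open Classical in
/-- The first success in `k` independent trials, with the default value `D₀`. -/
noncomputable def firstSuccess {γ : Type*} (p : PMF γ) (S : Set γ) (x₀ : γ) : ℕ → PMF γ
  | 0 => PMF.pure x₀
  | k + 1 => p.bind fun x => if x ∈ S then PMF.pure x else firstSuccess p S x₀ k

open Classical in
-- The summand for `j` accounts for exactly `j` failures before the success at `x`.
theorem firstSuccess_apply {γ : Type*} (p : PMF γ) (S : Set γ) (x₀ : γ) {x : γ}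
    (hx : x ≠ x₀) (k : ℕ) : firstSuccess p S x₀ k x =
      (∑ j ∈ Finset.range k, (∑' y, Sᶜ.indicator p y) ^ j) * S.indicator p x := by
  induction k with
  | zero => simp [firstSuccess, hx]
  | succ k ih =>
    have h1 : ∀ y, p y * (if y ∈ S then PMF.pure y else firstSuccess p S x₀ k) x =
        (if x = y then S.indicator p y else 0) +
          Sᶜ.indicator p y * firstSuccess p S x₀ k x := by
      intro y
      by_cases hy : y ∈ S
      · simp [hy, PMF.pure_apply]
      · simp [hy]
    rw [firstSuccess, PMF.bind_apply, tsum_congr h1, ENNReal.tsum_add, tsum_ite_eq',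
      ENNReal.tsum_mul_right, ih, Finset.sum_range_succ', ← mul_assoc, Finset.mul_sum]
    simp only [pow_succ', pow_zero]
    ring

theorem firstSuccess_mem [Countable U] {p : PDB τ U} (hp : p.IsTI) {S : Set (Instance τ U)}
    (hS : Definable 0 fun D _ => D ∈ S) (D₀ : Instance τ U) (k : ℕ) :
    firstSuccess p S D₀ k ∈ viewsOver (FO U) (TI U) τ := by
  induction k with
  | zero =>
    exact mem_viewsOver_FO.2 ⟨τ, p, _, hp, DefMap.const D₀, (PMF.map_const p D₀).symm⟩
  | succ k ih => exact bind_mem_FO_TI hp ih DefMap.id hS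

instance (k : ℕ) : Unique (uniSchema k).Rel := inferInstanceAs (Unique Unit)

instance : Unique (Fact (uniSchema 0) U) where
  default := ⟨(), Fin.elim0⟩
  uniq := by
    rintro ⟨⟨⟩, u⟩
    exact congrArg (Sigma.mk ()) (Subsingleton.elim (α := Fin 0 → U) u Fin.elim0)

/-- The database with one fact without arguments, of probability `1 - s`. -/
noncomputable def coinPDB (s : ℝ≥0∞) (hs : s ≤ 1) : PDB (uniSchema 0) U :=
  (PMF.ofFintype (fun b => cond b s (1 - s)) (by simp [hs]) : PMF Bool).map
    fun b => cond b ∅ {default}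

theorem coinPDB_bind {γ : Type*} (s : ℝ≥0∞) (hs : s ≤ 1) (p q : PMF γ) (x : γ)
    {_ : ∀ D : Instance (uniSchema 0) U, Decidable (D = ∅)} :
    ((coinPDB s hs : PDB (uniSchema 0) U).bind fun D => if D = ∅ then p else q) x =
      s * p x + (1 - s) * q x := by
  rw [coinPDB, PMF.bind_map, PMF.bind_apply, tsum_bool, add_comm]
  simp

/-- Finite rejection sampling. A success `D₀` of positive probability is set aside as default value.
After `k` rounds each other success `D` has probability `c * p D`, where `c` tends to `1 / q₀` and
`q₀ < q` is the probability of success without `D₀`. Some finite `k` therefore gives `c > 1 / q`,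
and a coin that falls back on `D₀` reduces the factor to exactly `1 / q`. -/
theorem conditioned_TI_le [Countable U] : conditioned (TI U) ≤ viewsOver (FO U) (TI U) := by
  classical
  rintro τ q ⟨p, φ, h, hp, rfl⟩
  set S : Set (Instance τ U) := {D | φ.Holds D Fin.elim0} with hS
  obtain ⟨D₀, hD₀S, hD₀⟩ := id h
  set S' : Set (Instance τ U) := {D | D ∈ S ∧ D ≠ D₀} with hS'
  have hSdef : Definable 0 fun D _ => D ∈ S' := φ.holds_definable.and (.neg (.eq_instance D₀))
  set a : ℝ≥0∞ := ∑' D, S'ᶜ.indicator p D with ha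
  set q₀ : ℝ≥0∞ := ∑' D, S'.indicator p D with hq₀
  set q : ℝ≥0∞ := ∑' D, S.indicator p D with hq
  have hqtop : q ≠ ∞ := p.tsum_coe_indicator_ne_top S
  have hq₀top : q₀ ≠ ∞ := p.tsum_coe_indicator_ne_top S'
  have hsum : q₀ + a = 1 := by
    rw [hq₀, ha, ← ENNReal.tsum_add, ← p.tsum_coe]
    exact tsum_congr fun D => by by_cases hD : D ∈ S' <;> simp [hD]
  have hatop : a ≠ ∞ := p.tsum_coe_indicator_ne_top _
  have hq₀q : q₀ < q := by
    have : q = p D₀ + q₀ := by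
      rw [hq, ENNReal.tsum_eq_add_tsum_ite D₀, Set.indicator_of_mem hD₀S]
      congr 1
      refine tsum_congr fun D => ?_
      by_cases h1 : D = D₀ <;> by_cases h2 : D ∈ S <;> simp [hS', h1, h2]
    rw [this]
    rw [add_comm]
    exact ENNReal.lt_add_right hq₀top hD₀
  have hgeo : q⁻¹ < ∑' j : ℕ, a ^ j := by
    rw [ENNReal.tsum_geometric, ← hsum, ENNReal.add_sub_cancel_right hatop]
    exact ENNReal.inv_lt_inv.2 hq₀q
  rw [ENNReal.tsum_eq_iSup_nat, lt_iSup_iff] at hgeo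
  obtain ⟨k, hk⟩ := hgeo
  set c := ∑ j ∈ Finset.range k, a ^ j with hc
  have hq0 : q ≠ 0 := (pos_of_gt hq₀q).ne'
  have hc0 : c ≠ 0 := (pos_of_gt hk).ne'
  have hctop : c ≠ ∞ := ENNReal.sum_ne_top.2 fun j _ => ENNReal.pow_ne_top hatop
  set s := q⁻¹ * c⁻¹ with hs
  have hsc : s * c = q⁻¹ := by
    rw [hs, mul_assoc, ENNReal.inv_mul_cancel hc0 hctop, mul_one]
  have hs1 : s ≤ 1 := by
    rw [hs, ← ENNReal.mul_inv_cancel hc0 hctop]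
    gcongr
  have hs1' : 1 - s ≤ 1 := tsub_le_self
  -- The coin gives the empty instance with probability `1 - s`, and then the output is `D₀`;
  -- otherwise the trials are run.
  have hmem := bind_mem_FO_TI (isTI_of_subsingleton (coinPDB (1 - s) hs1' : PDB (uniSchema 0) U)
    inferInstance) (firstSuccess_mem hp hSdef D₀ k) (DefMap.const D₀) (.eq_instance ∅)
  convert hmem using 1
  refine PMF.eq_of_eq_off D₀ fun D hD => ?_
  refine Eq.trans ?_ (coinPDB_bind _ _ _ _ _).symm
  change p.filter S h D = _
  rw [firstSuccess_apply p S' D₀ hD k, PMF.filter_apply, PMF.pure_apply,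
    if_neg hD, mul_zero, zero_add, ENNReal.sub_sub_cancel ENNReal.one_ne_top hs1, ← mul_assoc,
    hsc, mul_comm]
  congr 1
  by_cases h2 : D ∈ S <;> simp [hS', hD, h2]

theorem TI_le_conditioned : TI U ≤ conditioned (TI U) := by
  intro τ p hp
  obtain ⟨D, hD⟩ := p.support_nonempty
  have hall : {D : Instance τ U | (Formula.verum : Formula τ U 0).Holds D Fin.elim0} = univ :=
    eq_univ_of_forall fun D => Formula.sat_verum _ _ _
  refine ⟨p, .verum, ⟨D, by rw [hall]; trivial, hD⟩, hp, PMF.ext fun E => ?_⟩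
  rw [PMF.filter_apply]
  simp [hall, p.tsum_coe]

theorem FO_conditioned_TI [Countable U] :
    viewsOver (FO U) (conditioned (TI U)) = viewsOver (FO U) (TI U) :=
  le_antisymm (viewsOver_FO_le conditioned_TI_le)
    (viewsOver_mono (fun _ _ => subset_rfl) TI_le_conditioned)

end ProbDB

/-! ### Simulation of blocks by labels -/

namespace ProbDB

open MeasureTheory Set
open scoped ENNReal NNReal

universe v

variable {U : Type v} {τ : Schema}

/-! ### Block-independent databases as conditioned tuple-independent ones -/

/-- The schema with one additional argument, for a block label. -/
def tagSchema (τ : Schema) : Schema := ⟨τ.Rel, τ.finite, τ.nonempty, fun R => τ.arity R + 1⟩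

def tagFact (g : Fact τ U → U) : Fact τ U ↪ Fact (tagSchema τ) U where
  toFun f := ⟨f.1, (Fin.snoc f.2 (g f) : Fin (τ.arity f.1 + 1) → U)⟩
  inj' := by
    rintro ⟨R, u⟩ ⟨R', u'⟩ h
    obtain ⟨h1, h2⟩ := Sigma.mk.inj_iff.1 h
    have h1' : R = R' := h1
    subst h1'
    exact congrArg (Sigma.mk R) (Fin.snoc_inj.1 (eq_of_heq h2)).1

def untagFact (f : Fact (tagSchema τ) U) : Fact τ U :=
  ⟨f.1, Fin.init (n := τ.arity f.1) (α := fun _ => U) f.2⟩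

def factLabel (f : Fact (tagSchema τ) U) : U := f.2 (Fin.last (τ.arity f.1))

theorem untagFact_tagFact (g : Fact τ U → U) (f : Fact τ U) : untagFact (tagFact g f) = f :=
  congrArg (Sigma.mk f.1) (Fin.init_snoc (α := fun _ => U) (g f) f.2)

theorem factLabel_tagFact (g : Fact τ U → U) (f : Fact τ U) : factLabel (tagFact g f) = g f :=
  Fin.snoc_last (α := fun _ => U) (g f) f.2

open Classical in
noncomputable def untag (D : Instance (tagSchema τ) U) : Instance τ U := D.image untagFact

theorem untag_map (g : Fact τ U → U) (D : Instance τ U) : untag (D.map (tagFact g)) = D := by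
  classical
  ext f
  simp only [untag, Finset.mem_image, Finset.mem_map]
  constructor
  · rintro ⟨_, ⟨f', hf', rfl⟩, rfl⟩
    rwa [untagFact_tagFact]
  · exact fun hf => ⟨_, ⟨f, hf, rfl⟩, untagFact_tagFact g f⟩

theorem defMap_untag : DefMap (untag (τ := τ) (U := U)) := by
  classical
  refine ⟨fun R => ?_, ∅, fun D a ha => ?_⟩
  · refine (Definable.ex (Definable.mem (σ := tagSchema τ) R) ∅ ?_).congr fun D v => ?_
    · intro D w hw
      rw [Finset.union_empty]
      exact mem_adom.2 ⟨_, hw, Fin.last _, rfl⟩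
    · simp only [untag, Finset.mem_image]
      constructor
      · rintro ⟨a, ha⟩
        exact ⟨_, ha, congrArg (Sigma.mk R) (Fin.init_snoc (α := fun _ => U) a v)⟩
      · rintro ⟨⟨R', w⟩, hw, h⟩
        obtain ⟨h1, h2⟩ := Sigma.mk.inj_iff.1 h
        have h1' : R' = R := h1
        subst h1'
        obtain rfl : Fin.init (n := τ.arity R') (α := fun _ => U) w = v := eq_of_heq h2
        have e : (⟨R', Fin.snoc (α := fun _ => U) (Fin.init (n := τ.arity R') (α := fun _ => U) w)
            (w (Fin.last (τ.arity R')))⟩ : Fact (tagSchema τ) U) = ⟨R', w⟩ :=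
          congrArg (Sigma.mk R') (Fin.snoc_init_self (α := fun _ => U) w)
        exact ⟨w (Fin.last (τ.arity R')), e.symm ▸ hw⟩
  · obtain ⟨f, hf, i, rfl⟩ := mem_adom.1 ha
    obtain ⟨f', hf', rfl⟩ := Finset.mem_image.1 hf
    rw [Finset.union_empty]
    exact mem_adom.2 ⟨f', hf', i.castSucc, rfl⟩

/-- At most one fact for every label, and at least one for the labels in `A`. -/
def LabelCondition (A : Finset U) (D : Instance (tagSchema τ) U) : Prop :=
  (∀ f ∈ D, ∀ f' ∈ D, factLabel f = factLabel f' → f = f') ∧ ∀ a ∈ A, ∃ f ∈ D, factLabel f = a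

theorem definable_labelCondition (A : Finset U) :
    Definable 0 fun (D : Instance (tagSchema τ) U) _ => LabelCondition A D := by
  refine Definable.and ?_ ?_
  · refine Definable.forall_fact (Q := fun D f _ => ∀ f' ∈ D, factLabel f = factLabel f' → f = f')
      fun R => ?_
    refine Definable.forall_fact (Q := fun (D : Instance (tagSchema τ) U) f'
      (w : Fin (0 + (tagSchema τ).arity R) → U) =>
        factLabel (⟨R, fun i => w (Fin.natAdd 0 i)⟩ : Fact (tagSchema τ) U) = factLabel f' →
          (⟨R, fun i => w (Fin.natAdd 0 i)⟩ : Fact (tagSchema τ) U) = f') fun R' => ?_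
    exact Definable.imp
      ((Definable.eq (Fin.castAdd _ (Fin.natAdd 0 (Fin.last (τ.arity R))))
        (Fin.natAdd _ (Fin.last (τ.arity R')))).congr fun _ _ => Iff.rfl)
      (.same_fact R R' _ _)
  · refine (Definable.exists_mem_finset A (P := fun a D _ => ¬ ∃ f ∈ D, factLabel f = a)
      fun a _ => Definable.neg ?_).neg.congr fun D v => by push Not; rfl
    exact Definable.ex_fact (Q := fun _ f _ => factLabel f = a) fun R =>
      (Definable.eq_const (Fin.natAdd 0 (Fin.last (τ.arity R))) a).congr fun _ _ => Iff.rfl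

/-- The weights of `exists_weights` become the odds of independent tagged facts. The label condition
cuts out exactly the admissible sets, on which both laws are proportional to the product of the
weights; `untag` then forgets the labels. -/
theorem BID_le_FO_conditioned [Countable U] [Infinite U] :
    BID U ≤ viewsOver (FO U) (conditioned (TI U)) := by
  classical
  intro τ p hp
  obtain ⟨β, b, hβ, h⟩ := PDB.IsBID.exists_blockInd hp
  obtain ⟨o, c, ho, hpD⟩ := h.exists_weights
  -- There are only countably many blocks, and the infinite universe has a name for each.
  obtain ⟨ℓ, hℓ⟩ : ∃ ℓ : β → U, Function.Injective ℓ := by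
    obtain ⟨e⟩ := nonempty_equiv_of_countable (α := ℕ) (β := U)
    obtain ⟨g, hg⟩ := exists_injective_nat β
    exact ⟨e ∘ g, e.injective.comp hg⟩
  set t : Fact τ U ↪ Fact (tagSchema τ) U := tagFact (ℓ ∘ b) with ht
  set A : Finset U := h.finite_special.toFinset.image ℓ with hA
  -- Facts that carry a wrong label get odds 0.
  obtain ⟨q, hq0, hqD, hq, -⟩ := exists_independent (Function.extend t o 0)
    ((Function.Injective.summable_iff t.injective (f := Function.extend t o 0) (by
      intro x hx
      rw [Function.extend_apply' _ _ _ hx]; rfl)).1 (by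
      rwa [Function.extend_comp t.injective]))
  have hcond : ∀ D : Instance τ U, LabelCondition A (D.map t) ↔
      Set.InjOn b D ∧ ∀ B, BlockInd.blockMass p b B = 1 → ∃ f ∈ D, b f = B := by
    intro D
    refine and_congr ⟨fun hh f hf g hg hfg => ?_, fun hh f hf g hg hfg => ?_⟩
      ⟨fun hh B hB => ?_, fun hh a ha => ?_⟩
    · refine t.injective (hh _ (Finset.mem_map_of_mem t hf) _ (Finset.mem_map_of_mem t hg) ?_)
      rw [ht, factLabel_tagFact, factLabel_tagFact]
      exact congrArg ℓ hfg
    · obtain ⟨f, hf', rfl⟩ := Finset.mem_map.1 hf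
      obtain ⟨g, hg', rfl⟩ := Finset.mem_map.1 hg
      rw [ht, factLabel_tagFact, factLabel_tagFact] at hfg
      rw [hh hf' hg' (hℓ hfg)]
    · obtain ⟨f, hf, hfB⟩ := hh (ℓ B)
        (Finset.mem_image_of_mem ℓ (h.finite_special.mem_toFinset.2 hB))
      obtain ⟨f, hf', rfl⟩ := Finset.mem_map.1 hf
      rw [ht, factLabel_tagFact] at hfB
      exact ⟨f, hf', hℓ hfB⟩
    · obtain ⟨B, hB, rfl⟩ := Finset.mem_image.1 ha
      obtain ⟨f, hf, rfl⟩ := hh B (h.finite_special.mem_toFinset.1 hB)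
      exact ⟨t f, Finset.mem_map_of_mem t hf, by rw [ht, factLabel_tagFact]; rfl⟩
  have hqt : ∀ D : Instance τ U, q (D.map t) = q ∅ * ∏ f ∈ D, (o f : ℝ≥0∞) := by
    intro D
    rw [hqD, Finset.prod_map]
    simp only [t.injective.extend_apply]
  have hqt0 : ∀ E : Instance (tagSchema τ) U, (¬ ∃ D : Instance τ U, D.map t = E) → q E = 0 := by
    intro E hE
    obtain ⟨f, hf, hft⟩ : ∃ f ∈ E, f ∉ Set.range t := by
      by_contra! hc
      refine hE ⟨E.preimage t t.injective.injOn, ?_⟩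
      ext f
      simp only [Finset.mem_map, Finset.mem_preimage]
      constructor
      · rintro ⟨g, hg, rfl⟩; exact hg
      · intro hf
        obtain ⟨g, rfl⟩ := hc f hf
        exact ⟨g, hf, rfl⟩
    rw [hqD, Finset.prod_eq_zero hf (by rw [Function.extend_apply' _ _ _ hft]; rfl), mul_zero]
  obtain ⟨φ, hφ⟩ := definable_labelCondition (τ := τ) A
  have hφS : {D | φ.Holds D Fin.elim0} = {D | LabelCondition A D} := by
    ext D
    exact hφ D (φ.range D) Fin.elim0 subset_rfl
  have hmapt : ∀ D : Instance τ U, p.map (Finset.map t) (D.map t) = p D := by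
    intro D
    rw [PMF.map_apply]
    simp [(Finset.map_injective t).eq_iff]
  have hqne : ∀ D, p D ≠ 0 → LabelCondition A (D.map t) ∧ q (D.map t) ≠ 0 := by
    intro D hD
    rw [hpD D] at hD
    split_ifs at hD with hc
    · refine ⟨(hcond D).2 hc, ?_⟩
      rw [hqt]
      exact mul_ne_zero hq0 (right_ne_zero_of_mul hD)
    · exact absurd rfl hD
  have hex : ∃ D ∈ {D : Instance (tagSchema τ) U | φ.Holds D Fin.elim0}, D ∈ q.support := by
    obtain ⟨D, hD⟩ := p.support_nonempty
    rw [hφS]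
    exact ⟨_, (hqne D hD).1, (hqne D hD).2⟩
  have key : p.map (Finset.map t) = q.filter _ hex := by
    set Z := ∑' D, ({D | φ.Holds D Fin.elim0} : Set (Instance (tagSchema τ) U)).indicator q D
      with hZ
    have hZtop : Z ≠ ∞ := q.tsum_coe_indicator_ne_top _
    have hZ0 : Z ≠ 0 := by
      obtain ⟨D, hD, hD'⟩ := hex
      refine fun h0 => hD' ?_
      have := ENNReal.tsum_eq_zero.1 h0 D
      rwa [Set.indicator_of_mem hD] at this
    refine PMF.eq_of_proportional (c * (q ∅)⁻¹ * Z) fun E => ?_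
    rw [PMF.filter_apply, ← hZ]
    by_cases hE : ∃ D : Instance τ U, D.map t = E
    · obtain ⟨D, rfl⟩ := hE
      rw [hmapt, hpD D, hφS]
      by_cases hc : LabelCondition A (D.map t)
      · rw [if_pos ((hcond D).1 hc), Set.indicator_of_mem (by exact hc), hqt]
        calc c * ∏ f ∈ D, (o f : ℝ≥0∞)
            = c * ((q ∅)⁻¹ * q ∅) * (Z * Z⁻¹) * ∏ f ∈ D, (o f : ℝ≥0∞) := by
              rw [ENNReal.inv_mul_cancel hq0 (q.apply_ne_top _), ENNReal.mul_inv_cancel hZ0 hZtop,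
                mul_one, mul_one]
          _ = _ := by ring
      · rw [if_neg fun hh => hc ((hcond D).2 hh), Set.indicator_of_notMem (by exact hc)]
        simp
    · have h1 : p.map (Finset.map t) E = 0 := by
        rw [PMF.apply_eq_zero_iff, PMF.mem_support_map_iff]
        rintro ⟨D, -, hD⟩
        exact hE ⟨D, hD⟩
      rw [h1, Set.indicator_apply]
      split_ifs <;> simp [hqt0 E hE]
  refine mem_viewsOver_FO.2 ⟨tagSchema τ, _, untag, ⟨q, φ, hex, hq.isTI, rfl⟩, defMap_untag, ?_⟩
  rw [← key, PMF.map_comp]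
  have : untag ∘ Finset.map t = id := funext fun D => untag_map _ D
  rw [this, PMF.map_id]

theorem BID_le_FO_TI [Countable U] [Infinite U] : BID U ≤ viewsOver (FO U) (TI U) :=
  FO_conditioned_TI (U := U) ▸ BID_le_FO_conditioned

theorem FO_BID [Countable U] [Infinite U] : viewsOver (FO U) (BID U) = viewsOver (FO U) (TI U) :=
  le_antisymm (viewsOver_FO_le BID_le_FO_TI) (viewsOver_mono (fun _ _ => subset_rfl) TI_le_BID)

end ProbDB

/-! ### Separation of the fragments of conjunctive queries -/

namespace ProbDB

open MeasureTheory Set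
open scoped ENNReal NNReal

universe v

variable {U : Type v} {τ : Schema}

/-! ### Variables of conjunctive queries -/

theorem eq_of_eqvGen {γ δ : Type*} {r : γ → γ → Prop} {v : γ → δ} (h : ∀ i j, r i j → v i = v j)
    {i j : γ} (hij : Relation.EqvGen r i j) : v i = v j := by
  induction hij with
  | rel _ _ h' => exact h _ _ h'
  | refl _ => rfl
  | symm _ _ _ ih => exact ih.symm
  | trans _ _ _ _ _ ih₁ ih₂ => exact ih₁.trans ih₂

open Classical in
/-- Every conjunctive query comes with relations between its free variables (`r`), between the
free variables and constants (`κ`), and between the free variables and the argument positions of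
its atoms (`ρ`). Variables that are not related to constants or atoms may be changed. -/
theorem Formula.IsCQ.exists_relations {n : ℕ} {φ : Formula τ U n} (hφ : φ.IsCQ) :
    ∃ (ι : Type) (lab : ι → τ.Rel) (r : Fin n → Fin n → Prop) (κ : Fin n → U → Prop)
      (ρ : Fin n → (Σ o, Fin (τ.arity (lab o))) → Prop),
      (∀ o, lab o ∈ φ.relOccurrences) ∧ (φ.relOccurrences.Nodup → Function.Injective lab) ∧
      (∀ D A v, φ.Sat D A v → (∀ i j, r i j → v i = v j) ∧ (∀ i c, κ i c → v i = c) ∧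
        ∃ g : ∀ o, Fin (τ.arity (lab o)) → U,
          (∀ o, (⟨lab o, g o⟩ : Fact τ U) ∈ D) ∧ ∀ i x, ρ i x → g x.1 x.2 = v i) ∧
      ∀ E : Set (Fin n), (∀ i j, r i j → (i ∈ E ↔ j ∈ E)) →
        (∀ i ∈ E, (∀ c, ¬ κ i c) ∧ ∀ x, ¬ ρ i x) →
        ∀ D A v a, a ∈ A → φ.Sat D A v → φ.Sat D A fun i => if i ∈ E then a else v i := by
  induction φ with
  | rel R t =>
    refine ⟨Unit, fun _ => R, fun _ _ => False, fun _ _ => False, fun i x => t x.2 = .var i,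
      fun _ => by simp [relOccurrences], fun _ _ _ _ => rfl, fun D A v h => ⟨by simp, by simp,
        fun _ k => (t k).val v, fun _ => h, fun i x hx => congrArg (fun s => Term.val v s) hx⟩, ?_⟩
    intro E _ hE D A v a _ h
    simp only [Sat] at h ⊢
    convert h using 3 with k
    cases hk : t k with
    | var i =>
      simp only [Term.val]
      rw [if_neg fun hi => (hE i hi).2 ⟨(), k⟩ hk]
    | const c => rfl
  | eq i t =>
    cases t with
    | var j =>
      refine ⟨Empty, Empty.elim, fun a b => a = i ∧ b = j, fun _ _ => False, fun _ _ => False,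
        fun o => o.elim, fun _ o => o.elim, fun D A v h => ⟨?_, by simp,
          fun o => o.elim, fun o => o.elim, by simp⟩, ?_⟩
      · rintro _ _ ⟨rfl, rfl⟩; exact h
      · intro E hE _ D A v a _ h
        simp only [Sat, Term.val] at h ⊢
        have := hE i j ⟨rfl, rfl⟩
        by_cases hi : i ∈ E
        · rw [if_pos hi, if_pos (this.1 hi)]
        · rw [if_neg hi, if_neg fun hj => hi (this.2 hj), h]
    | const c =>
      refine ⟨Empty, Empty.elim, fun _ _ => False, fun a d => a = i ∧ d = c, fun _ _ => False,
        fun o => o.elim, fun _ o => o.elim, fun D A v h => ⟨by simp, ?_,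
          fun o => o.elim, fun o => o.elim, by simp⟩, ?_⟩
      · rintro _ _ ⟨rfl, rfl⟩; exact h
      · intro E _ hE D A v a _ h
        simp only [Sat, Term.val] at h ⊢
        rw [if_neg fun hi => (hE i hi).1 c ⟨rfl, rfl⟩, h]
  | neg φ _ => exact hφ.elim
  | or φ ψ _ _ => exact hφ.elim
  | all φ _ => exact hφ.elim
  | and φ ψ ih₁ ih₂ =>
    obtain ⟨ι₁, l₁, r₁, κ₁, ρ₁, a₁, b₁, c₁, d₁⟩ := ih₁ hφ.1
    obtain ⟨ι₂, l₂, r₂, κ₂, ρ₂, a₂, b₂, c₂, d₂⟩ := ih₂ hφ.2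
    refine ⟨ι₁ ⊕ ι₂, Sum.elim l₁ l₂, fun i j => r₁ i j ∨ r₂ i j, fun i c => κ₁ i c ∨ κ₂ i c,
      fun i x => match x with
        | ⟨.inl o, k⟩ => ρ₁ i ⟨o, k⟩
        | ⟨.inr o, k⟩ => ρ₂ i ⟨o, k⟩, ?_, ?_, ?_, ?_⟩
    · rintro (o | o)
      · exact List.mem_append_left _ (a₁ o)
      · exact List.mem_append_right _ (a₂ o)
    · intro hnd
      obtain ⟨h1, h2, h3⟩ := List.nodup_append.1 hnd
      rintro (o | o) (o' | o') h
      · exact congrArg _ (b₁ h1 h)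
      · exact absurd h (h3 _ (a₁ o) _ (a₂ o'))
      · exact absurd h.symm (h3 _ (a₁ o') _ (a₂ o))
      · exact congrArg _ (b₂ h2 h)
    · rintro D A v ⟨h1, h2⟩
      obtain ⟨e₁, f₁, g₁, m₁, n₁⟩ := c₁ D A v h1
      obtain ⟨e₂, f₂, g₂, m₂, n₂⟩ := c₂ D A v h2
      refine ⟨fun i j h => h.elim (e₁ i j) (e₂ i j), fun i c h => h.elim (f₁ i c) (f₂ i c),
        fun o => match o with
          | .inl o => g₁ o
          | .inr o => g₂ o, ?_, ?_⟩
      · rintro (o | o)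
        · exact m₁ o
        · exact m₂ o
      · rintro i ⟨o | o, k⟩ h
        · exact n₁ i ⟨o, k⟩ h
        · exact n₂ i ⟨o, k⟩ h
    · intro E hE hE' D A v a ha h
      exact ⟨d₁ E (fun i j h => hE i j (Or.inl h)) (fun i hi => ⟨fun c hc => (hE' i hi).1 c
          (Or.inl hc), fun x hx => (hE' i hi).2 ⟨.inl x.1, x.2⟩ hx⟩) D A v a ha h.1,
        d₂ E (fun i j h => hE i j (Or.inr h)) (fun i hi => ⟨fun c hc => (hE' i hi).1 c
          (Or.inr hc), fun x hx => (hE' i hi).2 ⟨.inr x.1, x.2⟩ hx⟩) D A v a ha h.2⟩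
  | @ex n φ ih =>
    obtain ⟨ι, l, r, κ, ρ, a, b, c, d⟩ := ih hφ
    -- Free variables may be linked through the bound one, so the relation is closed to an
    -- equivalence before that variable is dropped.
    refine ⟨ι, l, fun i j => Relation.EqvGen r i.castSucc j.castSucc,
      fun i c => ∃ j, Relation.EqvGen r i.castSucc j ∧ κ j c,
      fun i x => ∃ j, Relation.EqvGen r i.castSucc j ∧ ρ j x, a, b, ?_, ?_⟩
    · rintro D A v ⟨y, -, hy⟩
      obtain ⟨e, f, g, m, n⟩ := c D A _ hy
      have hv : ∀ i, (Fin.snoc v y : Fin _ → U) i.castSucc = v i := fun i => by simp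
      refine ⟨fun i j hij => ?_, ?_, g, m, ?_⟩
      · rw [← hv i, ← hv j]; exact eq_of_eqvGen e hij
      · rintro i c ⟨j, hij, hj⟩
        rw [← hv i, eq_of_eqvGen e hij]; exact f j c hj
      · rintro i x ⟨j, hij, hj⟩
        rw [← hv i, eq_of_eqvGen e hij]; exact n j x hj
    · rintro E hE hE' D A v y hyA ⟨z, hz, hsat⟩
      -- If the bound variable is linked to `E`, it has to change along with it and its witness
      -- becomes `y`; otherwise the old witness `z` stays.
      set E' : Set (Fin (n + 1)) := {j | ∃ i ∈ E, Relation.EqvGen r i.castSucc j} with hE'def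
      have h1 : ∀ i : Fin n, i.castSucc ∈ E' ↔ i ∈ E := fun i =>
        ⟨fun ⟨k, hk, hki⟩ => (hE k i hki).1 hk, fun hi => ⟨i, hi, .refl _⟩⟩
      have h2 := d E' (fun i j hij => ⟨fun ⟨k, hk, h⟩ => ⟨k, hk, h.trans _ _ _ (.rel _ _ hij)⟩,
        fun ⟨k, hk, h⟩ => ⟨k, hk, h.trans _ _ _ (.symm _ _ (.rel _ _ hij))⟩⟩)
        (fun j ⟨k, hk, hkj⟩ => ⟨fun c hc => (hE' k hk).1 c ⟨j, hkj, hc⟩,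
          fun x hx => (hE' k hk).2 x ⟨j, hkj, hx⟩⟩) D A _ y hyA hsat
      refine ⟨if Fin.last n ∈ E' then y else z, by split_ifs <;> assumption, ?_⟩
      convert h2 using 1
      funext j
      refine Fin.lastCases ?_ (fun i => ?_) j
      · simp
      · simp only [Fin.snoc_castSucc, h1]

/-- A free variable of a conjunctive query is bound by an atom, or by a constant, or it may be
replaced by any other element. -/
theorem Formula.IsCQ.trichotomy {n : ℕ} {φ : Formula τ U n} (hφ : φ.IsCQ) :
    ∃ (ι : Type) (lab : ι → τ.Rel) (ρ : Fin n → (Σ o, Fin (τ.arity (lab o))) → Prop),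
      (φ.relOccurrences.Nodup → Function.Injective lab) ∧
      (∀ D A v, φ.Sat D A v → ∃ g : ∀ o, Fin (τ.arity (lab o)) → U,
          (∀ o, (⟨lab o, g o⟩ : Fact τ U) ∈ D) ∧ ∀ i x, ρ i x → g x.1 x.2 = v i) ∧
      ∀ i, (∃ x, ρ i x) ∨ (∃ c, ∀ D A v, φ.Sat D A v → v i = c) ∨
        ∀ D A v a, a ∈ A → φ.Sat D A v →
          ∃ v', v' i = a ∧ (∀ j, v' j = a ∨ v' j = v j) ∧ φ.Sat D A v' := by
  classical
  obtain ⟨ι, l, r, κ, ρ, -, b, c, d⟩ := hφ.exists_relations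
  refine ⟨ι, l, fun i x => ∃ j, Relation.EqvGen r i j ∧ ρ j x, b, fun D A v h => ?_, fun i => ?_⟩
  · obtain ⟨e, -, g, m, n⟩ := c D A v h
    refine ⟨g, m, ?_⟩
    rintro i x ⟨j, hij, hj⟩
    rw [eq_of_eqvGen e hij]; exact n j x hj
  · by_cases h1 : ∃ x, ∃ j, Relation.EqvGen r i j ∧ ρ j x
    · exact Or.inl h1
    by_cases h2 : ∃ c, ∃ j, Relation.EqvGen r i j ∧ κ j c
    · obtain ⟨a, j, hij, hj⟩ := h2
      refine Or.inr (Or.inl ⟨a, fun D A v h => ?_⟩)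
      obtain ⟨e, f, -⟩ := c D A v h
      rw [eq_of_eqvGen e hij]; exact f j a hj
    · refine Or.inr (Or.inr fun D A v a ha h => ?_)
      refine ⟨_, ?_, fun j => ?_, d {j | Relation.EqvGen r i j} (fun j k hjk =>
        ⟨fun hj => Relation.EqvGen.trans _ _ _ hj (.rel _ _ hjk),
          fun hk => Relation.EqvGen.trans _ _ _ hk (.symm _ _ (.rel _ _ hjk))⟩)
        (fun j hj => ⟨fun c hc => h2 ⟨c, j, hj, hc⟩, fun x hx => h1 ⟨x, j, hj, hx⟩⟩)
        D A v a ha h⟩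
      · exact if_pos (.refl i)
      · split_ifs
        · exact Or.inl rfl
        · exact Or.inr rfl

/-! ### Databases with one relation -/

def uniFact {k : ℕ} (u : Fin k → U) : Fact (uniSchema k) U := ⟨(), u⟩

theorem uniFact_injective {k : ℕ} : Function.Injective (uniFact (U := U) (k := k)) :=
  fun _ _ h => eq_of_heq (Sigma.mk.inj_iff.1 h).2

theorem mem_apply_uni {k : ℕ} (V : View τ (uniSchema k) U) (D : Instance τ U) (u : Fin k → U) :
    uniFact u ∈ V.apply D ↔ (∀ i, u i ∈ (V ()).range D) ∧ (V ()).Sat D ((V ()).range D) u :=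
  V.mem_apply D () u

/-- The facts of the relation `R` that satisfy a condition on their arguments. -/
def factsWith (R : τ.Rel) (P : (Fin (τ.arity R) → U) → Prop) : Set (Fact τ U) :=
  {f | ∃ g, f = ⟨R, g⟩ ∧ P g}

theorem disjoint_factsWith {R : τ.Rel} {P Q : (Fin (τ.arity R) → U) → Prop}
    (h : ∀ g, P g → ¬ Q g) : Disjoint (factsWith R P) (factsWith R Q) := by
  rw [Set.disjoint_left]
  rintro _ ⟨g, rfl, hg⟩ ⟨g', he, hg'⟩
  obtain rfl := eq_of_heq (Sigma.mk.inj_iff.1 he).2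
  exact h g hg hg'

theorem disjoint_factsWith_of_ne {R R' : τ.Rel} (h : R ≠ R') {P : (Fin (τ.arity R) → U) → Prop}
    {Q : (Fin (τ.arity R') → U) → Prop} : Disjoint (factsWith R P) (factsWith R' Q) := by
  rw [Set.disjoint_left]
  rintro _ ⟨g, rfl, hg⟩ ⟨g', he, hg'⟩
  exact h (Sigma.mk.inj_iff.1 he).1

theorem summable_inv_sq : Summable fun i : ℕ => (1 / ((i : ℝ≥0) + 1) ^ 2) := by
  rw [← NNReal.summable_coe]
  have := (summable_nat_add_iff (f := fun n : ℕ => 1 / (n : ℝ) ^ 2) 1).2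
    (Real.summable_one_div_nat_pow.2 one_lt_two)
  simpa using this

/-- Since `w ≤ 1`, `w / (1 + w) ≥ w / 2`. -/
theorem half_le_odds (i : ℕ) : ENNReal.ofReal ((1 / 2) / (i + 1) ^ 2) ≤
    ((1 / ((i : ℝ≥0) + 1) ^ 2 : ℝ≥0) : ℝ≥0∞) / (1 + (1 / ((i : ℝ≥0) + 1) ^ 2 : ℝ≥0)) := by
  set w : ℝ≥0 := 1 / ((i : ℝ≥0) + 1) ^ 2 with hw
  have hw1 : w ≤ 1 := by
    rw [hw]
    exact div_le_one_of_le₀ (one_le_pow₀ (by simp)) (by positivity)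
  have h1 : ENNReal.ofReal ((1 / 2) / (i + 1) ^ 2) = ((w / 2 : ℝ≥0) : ℝ≥0∞) := by
    rw [ENNReal.ofReal, ENNReal.coe_inj]
    ext
    rw [Real.coe_toNNReal _ (by positivity)]
    simp only [hw]
    push_cast
    ring
  rw [h1, show (1 : ℝ≥0∞) = ((1 : ℝ≥0) : ℝ≥0∞) from rfl, ← ENNReal.coe_add,
    ← ENNReal.coe_div (by positivity), ENNReal.coe_le_coe]
  gcongr
  calc 1 + w ≤ 1 + 1 := by gcongr
    _ = 2 := by norm_num

section Countable

variable [Countable U] [Infinite U]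

theorem exists_enumeration : ∃ e : ℕ → U, Function.Injective e := by
  obtain ⟨e⟩ := nonempty_equiv_of_countable (α := ℕ) (β := U)
  exact ⟨e, e.injective⟩

omit [Infinite U] in
theorem toMeasure_map_eq {σ σ' : Schema} {p : PDB σ U} {p' : PDB σ' U}
    {F : Instance σ U → Instance τ U} {F' : Instance σ' U → Instance τ U}
    (h : p.map F = p'.map F') (X : Set (Instance τ U)) :
    p.toMeasure (F ⁻¹' X) = p'.toMeasure (F' ⁻¹' X) := by
  rw [← PMF.toMeasure_map_apply _ _ _ (measurable_of_countable F) .of_discrete, h,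
    PMF.toMeasure_map_apply _ _ _ (measurable_of_countable F') .of_discrete]

omit [Countable U] [Infinite U] in
theorem exists_world_of_map_eq {σ σ' : Schema} {p : PDB σ U} {p' : PDB σ' U}
    {F : Instance σ U → Instance τ U} {F' : Instance σ' U → Instance τ U}
    (h : p.map F = p'.map F') {D' : Instance σ' U} (hD' : p' D' ≠ 0) :
    ∃ D, p D ≠ 0 ∧ F D = F' D' := by
  have : F' D' ∈ (p.map F).support := by
    rw [h, PMF.mem_support_map_iff]
    exact ⟨D', hD', rfl⟩
  rwa [PMF.mem_support_map_iff] at this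

omit [Infinite U] in
theorem exists_world_of_pos {p : PDB τ U} {X : Set (Instance τ U)} (h : p.toMeasure X ≠ 0) :
    ∃ D ∈ X, p D ≠ 0 := by
  by_contra! hc
  exact h (le_antisymm (le_of_le_of_eq (toMeasure_mono_support p (T := ∅) fun D hD hDX =>
    hD (hc D hDX)) measure_empty) zero_le)

/-! ### Unions of conjunctive queries are more powerful than conjunctive queries -/

/-- The constant second coordinate forces `z` into the range of any query that has the same nonempty
answers. An unconstrained first variable could then take the value `z`, which is no endpoint of the
facts used below. -/
def endpointFormula (z : U) : Formula (uniSchema 2) U 2 :=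
  .and (.or (.ex (.rel () ![.var 0, .var 2])) (.ex (.rel () ![.var 2, .var 0]))) (.eq 1 (.const z))

omit [Countable U] [Infinite U] in
theorem sat_endpointFormula (z : U) (D : Instance (uniSchema 2) U) (A : Finset U)
    (v : Fin 2 → U) : (endpointFormula z).Sat D A v ↔
      ((∃ a ∈ A, uniFact ![v 0, a] ∈ D) ∨ ∃ a ∈ A, uniFact ![a, v 0] ∈ D) ∧ v 1 = z := by
  have h1 : ∀ a, (fun i => (![.var 0, .var 2] i : Term U 3).val (Fin.snoc v a : Fin 3 → U)) =
      ![v 0, a] := fun a => by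
    funext i; fin_cases i <;> rfl
  have h2 : ∀ a, (fun i => (![.var 2, .var 0] i : Term U 3).val (Fin.snoc v a : Fin 3 → U)) =
      ![a, v 0] := fun a => by
    funext i; fin_cases i <;> rfl
  refine and_congr (or_congr (exists_congr fun a => and_congr_right fun _ => ?_)
    (exists_congr fun a => and_congr_right fun _ => ?_)) Iff.rfl
  · rw [← h1]; rfl
  · rw [← h2]; rfl

/-- An edge `a i → b i`, of probability of order `1 / (i + 1) ^ 2`, puts both endpoints into the
answer. If an atom binds the first variable of a conjunctive query, these two answers need two
different facts of that atom's relation, which `BlockInd.not_heavy` excludes. A first variable equal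
to a constant cannot give both endpoints, and a free one could become `z`. -/
theorem not_ucqTI_le_cqBID :
    ¬ viewsOver (UCQ U) (TI U) ≤ viewsOver (CQ U) (BID U) := by
  classical
  intro hle
  obtain ⟨e, he⟩ := exists_enumeration (U := U)
  set z := e 0 with hz
  set a : ℕ → U := fun i => e (2 * i + 1) with ha
  set b : ℕ → U := fun i => e (2 * i + 2) with hb
  set t : ℕ → Fact (uniSchema 2) U := fun i => uniFact ![a i, b i] with ht
  have htinj : Function.Injective t := fun i j hij => by
    have h1 := congrFun (uniFact_injective hij) 0
    have h2 : 2 * i + 1 = 2 * j + 1 := he h1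
    omega
  obtain ⟨p, -, hp, hpt, hp0⟩ := exists_independent_seq t htinj _ summable_inv_sq
  set V : View (uniSchema 2) (uniSchema 2) U := fun _ => endpointFormula z with hV
  obtain ⟨σ, p', V', hp', hV', heq⟩ := hle (uniSchema 2) ⟨_, p, V, hp.isTI,
    fun _ => ⟨⟨trivial, trivial⟩, trivial⟩, rfl⟩
  obtain ⟨β, blk, -, hblk⟩ := PDB.IsBID.exists_blockInd hp'
  have hz0 : ∀ D', p' D' ≠ 0 → ∀ u : Fin 2 → U, uniFact u ∈ V'.apply D' → u 0 ≠ z := by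
    intro D' hD' u hu hu0
    obtain ⟨D, hD, hDD'⟩ := exists_world_of_map_eq heq hD'
    rw [← hDD', mem_apply_uni] at hu
    replace hu := (sat_endpointFormula z D _ u).1 hu.2
    rcases hu.1 with ⟨y, -, hy⟩ | ⟨y, -, hy⟩
    · have := mass_ne_zero_of_mem p hD hy
      obtain ⟨i, hi⟩ := not_not.1 fun hc => this (hp0 _ hc)
      have h1 : a i = u 0 := congrFun (uniFact_injective hi) 0
      have h2 := he (h1.trans hu0)
      omega
    · have := mass_ne_zero_of_mem p hD hy
      obtain ⟨i, hi⟩ := not_not.1 fun hc => this (hp0 _ hc)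
      have h1 : b i = u 0 := congrFun (uniFact_injective hi) 1
      have h2 := he (h1.trans hu0)
      omega
  set X : ℕ → Set (Instance (uniSchema 2) U) := fun i =>
    {D | uniFact ![a i, z] ∈ D ∧ uniFact ![b i, z] ∈ D} with hX
  have hXp : ∀ i : ℕ, ENNReal.ofReal ((1 / 2) / (i + 1) ^ 2) ≤ p'.toMeasure (V'.apply ⁻¹' X i) := by
    intro i
    rw [← toMeasure_map_eq heq]
    refine (half_le_odds i).trans ?_
    rw [← hpt i]
    refine measure_mono fun D hD => ?_
    have hDa : a i ∈ (endpointFormula z).range D := Finset.mem_union_left _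
      (mem_adom.2 ⟨_, hD, (0 : Fin 2), rfl⟩)
    have hDb : b i ∈ (endpointFormula z).range D := Finset.mem_union_left _
      (mem_adom.2 ⟨_, hD, (1 : Fin 2), rfl⟩)
    have hDz : z ∈ (endpointFormula z).range D := Finset.mem_union_right _ (by
      simp [endpointFormula, Formula.consts, Term.consts])
    refine ⟨(mem_apply_uni V D _).2 ⟨?_, (sat_endpointFormula z D _ _).2
      ⟨Or.inl ⟨b i, hDb, hD⟩, rfl⟩⟩, (mem_apply_uni V D _).2 ⟨?_, (sat_endpointFormula z D _ _).2
      ⟨Or.inr ⟨a i, hDa, hD⟩, rfl⟩⟩⟩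
    · intro j; fin_cases j <;> assumption
    · intro j; fin_cases j <;> assumption
  have hXw : ∀ i, ∃ D' ∈ V'.apply ⁻¹' X i, p' D' ≠ 0 := fun i =>
    exists_world_of_pos (ne_of_gt (lt_of_lt_of_le (ENNReal.ofReal_pos.2 (by positivity)) (hXp i)))
  obtain ⟨ι, lab, ρ, -, hρ, htri⟩ :=
    Formula.IsCQ.trichotomy (n := 2) (φ := V' ()) (hV' ())
  rcases htri (0 : Fin 2) with ⟨⟨o, k⟩, hok⟩ | ⟨c, hc⟩ | hfree
  · refine hblk.not_heavy (fun i => factsWith (lab o) fun g => g k = a i)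
      (fun i => factsWith (lab o) fun g => g k = b i) ?_ ?_ ?_ (1 / 2) (by norm_num)
      fun i => (hXp i).trans (measure_mono ?_)
    · intro i j hij
      refine disjoint_factsWith fun g h1 h2 => hij ?_
      have := he (h1.symm.trans h2); omega
    · intro i j hij
      refine disjoint_factsWith fun g h1 h2 => hij ?_
      have := he (h1.symm.trans h2); omega
    · intro i
      refine disjoint_factsWith fun g h1 h2 => ?_
      have := he (h1.symm.trans h2); omega
    · rintro D' ⟨h1, h2⟩
      obtain ⟨g, hg, hg'⟩ := hρ _ _ _ ((mem_apply_uni V' D' _).1 h1).2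
      obtain ⟨g₂, hg₂, hg₂'⟩ := hρ _ _ _ ((mem_apply_uni V' D' _).1 h2).2
      exact ⟨⟨_, ⟨g o, rfl, hg' 0 ⟨o, k⟩ hok⟩, hg o⟩, ⟨_, ⟨g₂ o, rfl, hg₂' 0 ⟨o, k⟩ hok⟩, hg₂ o⟩⟩
  · obtain ⟨D', ⟨h1, h2⟩, -⟩ := hXw 0
    have e1 : a 0 = c := hc _ _ _ ((mem_apply_uni V' D' _).1 h1).2
    have e2 : b 0 = c := hc _ _ _ ((mem_apply_uni V' D' _).1 h2).2
    have := he (e1.trans e2.symm); omega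
  · obtain ⟨D', ⟨h1, -⟩, hD'⟩ := hXw 0
    obtain ⟨h3, h4⟩ := (mem_apply_uni V' D' _).1 h1
    have hzr : z ∈ (V' ()).range D' := h3 1
    obtain ⟨u, hu0, huv, hu⟩ := hfree _ _ _ z hzr h4
    refine hz0 D' hD' u ((mem_apply_uni V' D' u).2 ⟨fun j => ?_, hu⟩) hu0
    rcases huv j with h | h
    · rw [h]; exact hzr
    · rw [h]; exact h3 j

/-! ### Self-joins -/

/-- The last coordinate again serves to force `z` into the range. -/
def squareFormula (z : U) : Formula (uniSchema 1) U 3 :=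
  .and (.and (.rel () ![.var 0]) (.rel () ![.var 1])) (.eq 2 (.const z))

omit [Countable U] [Infinite U] in
theorem sat_squareFormula (z : U) (D : Instance (uniSchema 1) U) (A : Finset U)
    (v : Fin 3 → U) : (squareFormula z).Sat D A v ↔
      (uniFact ![v 0] ∈ D ∧ uniFact ![v 1] ∈ D) ∧ v 2 = z := by
  have h1 : ∀ j : Fin 3, (fun i => (![.var j] i : Term U 3).val v) = ![v j] := fun j => by
    funext i; fin_cases i; rfl
  rw [← h1, ← h1]
  rfl

/-- If different atoms bind the first two variables, their relation symbols differ and a diagonal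
answer needs a fact of each. If one atom binds both, the answers `(a 0, a (i + 1))` and `(a (i + 1),
a 0)` need two different facts. Either case contradicts `BlockInd.not_heavy`. -/
theorem not_cqTI_le_sjfcqBID :
    ¬ viewsOver (CQ U) (TI U) ≤ viewsOver (SjfCQ U) (BID U) := by
  classical
  intro hle
  obtain ⟨e, he⟩ := exists_enumeration (U := U)
  set z := e 0 with hz
  set a : ℕ → U := fun i => e (i + 1) with ha
  have hainj : Function.Injective a := fun i j hij => by
    have := he hij; omega
  have haz : ∀ i, a i ≠ z := fun i h => by
    have := he h; omega
  set t : ℕ → Fact (uniSchema 1) U := fun i => uniFact ![a i] with ht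
  have htinj : Function.Injective t := fun i j hij => hainj (congrFun (uniFact_injective hij) 0)
  obtain ⟨p, -, hp, hpt, hp0⟩ := exists_independent_seq t htinj _ summable_inv_sq
  have hpt' : ∀ i : ℕ, ENNReal.ofReal ((1 / 2) / (i + 1) ^ 2) ≤ mass p (t i) := fun i => by
    rw [hpt i]; exact half_le_odds i
  set V : View (uniSchema 1) (uniSchema 3) U := fun _ => squareFormula z with hV
  obtain ⟨σ, p', V', hp', hV', heq⟩ := hle (uniSchema 3) ⟨_, p, V, hp.isTI,
    fun _ => ⟨⟨trivial, trivial⟩, trivial⟩, rfl⟩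
  obtain ⟨β, blk, -, hblk⟩ := PDB.IsBID.exists_blockInd hp'
  have hz0 : ∀ D', p' D' ≠ 0 → ∀ u : Fin 3 → U, uniFact u ∈ V'.apply D' → u 0 ≠ z ∧ u 1 ≠ z := by
    intro D' hD' u hu
    obtain ⟨D, hD, hDD'⟩ := exists_world_of_map_eq heq hD'
    rw [← hDD', mem_apply_uni] at hu
    replace hu := (sat_squareFormula z D _ u).1 hu.2
    have key : ∀ y : U, uniFact ![y] ∈ D → y ≠ z := by
      rintro y hy rfl
      obtain ⟨i, hi⟩ := not_not.1 fun hc => mass_ne_zero_of_mem p hD hy (hp0 _ hc)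
      exact haz i (congrFun (uniFact_injective hi) 0)
    exact ⟨key _ hu.1.1, key _ hu.1.2⟩
  have hmem : ∀ (D : Instance (uniSchema 1) U) (i j : ℕ), t i ∈ D → t j ∈ D →
      uniFact ![a i, a j, z] ∈ V.apply D := by
    intro D i j hi hj
    have hDi : a i ∈ (squareFormula z).range D := Finset.mem_union_left _
      (mem_adom.2 ⟨_, hi, (0 : Fin 1), rfl⟩)
    have hDj : a j ∈ (squareFormula z).range D := Finset.mem_union_left _
      (mem_adom.2 ⟨_, hj, (0 : Fin 1), rfl⟩)
    have hDz : z ∈ (squareFormula z).range D := Finset.mem_union_right _ (by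
      simp [squareFormula, Formula.consts, Term.consts])
    refine (mem_apply_uni V D _).2 ⟨?_, (sat_squareFormula z D _ _).2 ⟨⟨hi, hj⟩, rfl⟩⟩
    intro k; fin_cases k <;> assumption
  set X : ℕ → Set (Instance (uniSchema 3) U) := fun i => {D | uniFact ![a i, a i, z] ∈ D} with hX
  have hXp : ∀ i : ℕ, ENNReal.ofReal ((1 / 2) / (i + 1) ^ 2) ≤ p'.toMeasure (V'.apply ⁻¹' X i) := by
    intro i
    rw [← toMeasure_map_eq heq]
    exact (hpt' i).trans (measure_mono fun D hD => hmem D i i hD hD)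
  set Y : ℕ → Set (Instance (uniSchema 3) U) := fun i =>
    {D | uniFact ![a 0, a (i + 1), z] ∈ D ∧ uniFact ![a (i + 1), a 0, z] ∈ D} with hY
  have hYp : ∀ i : ℕ, ENNReal.ofReal ((1 / 16) / (i + 1) ^ 2) ≤
      p'.toMeasure (V'.apply ⁻¹' Y i) := by
    intro i
    rw [← toMeasure_map_eq heq]
    have hne : t 0 ≠ t (i + 1) := fun h => by simpa using htinj h
    have h1 := hp.indep {t 0, t (i + 1)} Function.injective_id.injOn
    rw [Finset.prod_pair hne] at h1
    -- Both masses contribute a factor `1 / 2`, and `i + 2 ≤ 2 * (i + 1)` costs another `1 / 4`.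
    calc ENNReal.ofReal ((1 / 16) / (i + 1) ^ 2)
        ≤ ENNReal.ofReal ((1 / 2) / ((0 : ℕ) + 1) ^ 2 * ((1 / 2) / ((i + 1 : ℕ) + 1) ^ 2)) := by
          refine ENNReal.ofReal_le_ofReal ?_
          push_cast
          rw [div_mul_div_comm, div_le_div_iff₀ (by positivity) (by positivity)]
          nlinarith [(Nat.cast_nonneg i : (0 : ℝ) ≤ i)]
      _ ≤ mass p (t 0) * mass p (t (i + 1)) := by
          rw [ENNReal.ofReal_mul (by positivity)]
          exact mul_le_mul' (hpt' 0) (hpt' (i + 1))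
      _ ≤ _ := by
          rw [← h1]
          refine measure_mono fun D hD => ?_
          have hD' : {t 0, t (i + 1)} ⊆ D := hD
          rw [Finset.insert_subset_iff, Finset.singleton_subset_iff] at hD'
          exact ⟨hmem D 0 (i + 1) hD'.1 hD'.2, hmem D (i + 1) 0 hD'.2 hD'.1⟩
  have hXw : ∀ i, ∃ D' ∈ V'.apply ⁻¹' X i, p' D' ≠ 0 := fun i =>
    exists_world_of_pos (ne_of_gt (lt_of_lt_of_le (ENNReal.ofReal_pos.2 (by positivity)) (hXp i)))
  obtain ⟨ι, lab, ρ, hlab, hρ, htri⟩ :=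
    Formula.IsCQ.trichotomy (n := 3) (φ := V' ()) (hV' ()).1
  replace hlab := hlab (hV' ()).2
  -- Two different diagonal answers exclude a constant, and a free variable could take the value
  -- `z`.
  have hbound : ∀ i : Fin 3, i = 0 ∨ i = 1 → ∃ x, ρ i x := by
    intro i hi
    have hiX : ∀ j, ![a j, a j, z] i = a j := fun j => by rcases hi with rfl | rfl <;> rfl
    rcases htri i with h | ⟨c, hc⟩ | hfree
    · exact h
    · obtain ⟨D₀, h0, -⟩ := hXw 0
      obtain ⟨D₁, h1, -⟩ := hXw 1
      have e0 := hc _ _ _ ((mem_apply_uni V' D₀ _).1 h0).2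
      have e1 := hc _ _ _ ((mem_apply_uni V' D₁ _).1 h1).2
      rw [hiX] at e0 e1
      exact absurd (hainj (e0.trans e1.symm)) (by simp)
    · obtain ⟨D', h1, hD'⟩ := hXw 0
      obtain ⟨h3, h4⟩ := (mem_apply_uni V' D' _).1 h1
      have hzr : z ∈ (V' ()).range D' := h3 2
      obtain ⟨u, hu0, huv, hu⟩ := hfree _ _ _ z hzr h4
      have := hz0 D' hD' u ((mem_apply_uni V' D' u).2 ⟨fun j => by
        rcases huv j with h | h
        · rw [h]; exact hzr
        · rw [h]; exact h3 j, hu⟩)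
      rcases hi with rfl | rfl
      · exact absurd hu0 this.1
      · exact absurd hu0 this.2
  obtain ⟨⟨o, k⟩, hok⟩ := hbound 0 (Or.inl rfl)
  obtain ⟨⟨o', k'⟩, hok'⟩ := hbound 1 (Or.inr rfl)
  by_cases hoo : o = o'
  · subst hoo
    refine hblk.not_heavy (fun i => factsWith (lab o) fun g => g k = a 0 ∧ g k' = a (i + 1))
      (fun i => factsWith (lab o) fun g => g k = a (i + 1) ∧ g k' = a 0) ?_ ?_ ?_ (1 / 16)
      (by norm_num) fun i => (hYp i).trans (measure_mono ?_)
    · intro i j hij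
      refine disjoint_factsWith fun g h1 h2 => hij ?_
      have := hainj (h1.2.symm.trans h2.2); omega
    · intro i j hij
      refine disjoint_factsWith fun g h1 h2 => hij ?_
      have := hainj (h1.1.symm.trans h2.1); omega
    · intro i
      refine disjoint_factsWith fun g h1 h2 => ?_
      have := hainj (h1.1.symm.trans h2.1); omega
    · rintro D' ⟨h1, h2⟩
      obtain ⟨g, hg, hg'⟩ := hρ _ _ _ ((mem_apply_uni V' D' _).1 h1).2
      obtain ⟨g₂, hg₂, hg₂'⟩ := hρ _ _ _ ((mem_apply_uni V' D' _).1 h2).2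
      exact ⟨⟨_, ⟨g o, rfl, hg' 0 ⟨o, k⟩ hok, hg' 1 ⟨o, k'⟩ hok'⟩, hg o⟩,
        ⟨_, ⟨g₂ o, rfl, hg₂' 0 ⟨o, k⟩ hok, hg₂' 1 ⟨o, k'⟩ hok'⟩, hg₂ o⟩⟩
  · refine hblk.not_heavy (fun i => factsWith (lab o) fun g => g k = a i)
      (fun i => factsWith (lab o') fun g => g k' = a i) ?_ ?_ ?_ (1 / 2) (by norm_num)
      fun i => (hXp i).trans (measure_mono ?_)
    · intro i j hij
      exact disjoint_factsWith fun g h1 h2 => hij (hainj (h1.symm.trans h2))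
    · intro i j hij
      exact disjoint_factsWith fun g h1 h2 => hij (hainj (h1.symm.trans h2))
    · exact fun i => disjoint_factsWith_of_ne fun h => hoo (hlab h)
    · intro D' h1
      obtain ⟨g, hg, hg'⟩ := hρ _ _ _ ((mem_apply_uni V' D' _).1 h1).2
      exact ⟨⟨_, ⟨g o, rfl, hg' 0 ⟨o, k⟩ hok⟩, hg o⟩, ⟨_, ⟨g o', rfl, hg' 1 ⟨o', k'⟩ hok'⟩, hg o'⟩⟩

end Countable

end ProbDB

/-! ### Separations by monotonicity, correlation and size -/

namespace ProbDB

open MeasureTheory Set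
open scoped ENNReal NNReal

universe v

variable {U : Type v} {τ : Schema}

/-! ### Monotonicity -/

theorem Formula.IsUCQ.sat_mono {D D' : Instance τ U} (hD : D ⊆ D') {A A' : Finset U} (hA : A ⊆ A')
    {n : ℕ} {φ : Formula τ U n} (hφ : φ.IsUCQ) {v : Fin n → U} (h : φ.Sat D A v) :
    φ.Sat D' A' v := by
  induction φ with
  | rel R t => exact hD h
  | eq i t => exact h
  | neg φ _ => exact hφ.elim
  | and φ ψ ih₁ ih₂ => exact ⟨ih₁ hφ.1 h.1, ih₂ hφ.2 h.2⟩
  | or φ ψ ih₁ ih₂ => exact h.imp (ih₁ hφ.1) (ih₂ hφ.2)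
  | ex φ ih =>
    obtain ⟨a, ha, h⟩ := h
    exact ⟨a, hA ha, ih hφ h⟩
  | all φ _ => exact hφ.elim

theorem Formula.range_mono {n : ℕ} (φ : Formula τ U n) {D D' : Instance τ U} (hD : D ⊆ D') :
    φ.range D ⊆ φ.range D' := by
  classical
  exact Finset.union_subset_union_left (adom_mono hD)

theorem View.apply_mono {τ' : Schema} {V : View τ τ' U} (hV : ∀ R, (V R).IsUCQ)
    {D D' : Instance τ U} (hD : D ⊆ D') : V.apply D ⊆ V.apply D' := by
  rintro ⟨R, u⟩ hu
  rw [View.mem_apply] at hu ⊢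
  exact ⟨fun i => (V R).range_mono hD (hu.1 i), (hV R).sat_mono hD ((V R).range_mono hD) hu.2⟩

/-! ### Size bounds -/

/-- `a` is the largest arity and `c` the number of constants in the formula. -/
theorem Formula.exists_card_range_le {n : ℕ} (φ : Formula τ U n) :
    ∃ a c : ℕ, ∀ D, (φ.range D).card ≤ D.card * a + c := by
  classical
  refine ⟨Finset.univ.sup τ.arity, φ.consts.card, fun D => (Finset.card_union_le _ _).trans ?_⟩
  refine Nat.add_le_add_right (Finset.card_biUnion_le_card_mul _ _ _ fun f _ => ?_) _
  exact (Finset.card_image_le.trans_eq (by simp)).trans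
    (Finset.le_sup (f := τ.arity) (Finset.mem_univ f.1))

theorem card_apply_uni_le {k : ℕ} (V : View τ (uniSchema k) U) (D : Instance τ U) :
    (V.apply D).card ≤ ((V ()).range D).card ^ k := by
  classical
  rw [View.apply, Finset.card_sigma]
  calc ∑ R, ((V R).answers D).card = ((V ()).answers D).card :=
        Fintype.sum_unique fun R => ((V R).answers D).card
    _ ≤ (Fintype.piFinset fun _ : Fin k => (V ()).range D).card := Finset.card_filter_le _ _
    _ = _ := by simp

theorem PMF.tsum_map_mul {γ δ : Type*} (p : PMF γ) (F : γ → δ) (h : δ → ℝ≥0∞) :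
    ∑' x, p.map F x * h x = ∑' a, p a * h (F a) := by
  classical
  simp only [PMF.map_apply, ← ENNReal.tsum_mul_right]
  rw [ENNReal.tsum_comm]
  refine tsum_congr fun a => ?_
  rw [tsum_eq_single (F a)]
  · simp
  · intro b hb
    simp [hb]

/-- The schema with two nullary relation symbols. -/
def boolSchema : Schema := ⟨Bool, inferInstance, inferInstance, fun _ => 0⟩

def boolFact (b : Bool) : Fact boolSchema U := ⟨b, Fin.elim0⟩

theorem boolFact_ne : (boolFact true : Fact boolSchema U) ≠ boolFact false := fun h => by
  have := (Sigma.mk.inj_iff.1 h).1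
  simp at this

section Countable

variable [Countable U]

/-! ### Exclusive facts -/

/-- Exactly one of two facts holds, each with positive probability. Worlds of a tuple-independent
database that produce the one and the other lie in a common world, and there monotonicity produces
both facts. -/
theorem not_BID_le_ucqTI : ¬ BID U ≤ viewsOver (UCQ U) (TI U) := by
  classical
  intro hle
  set q : PDB boolSchema U := (PMF.uniformOfFintype Bool).map fun b => {boolFact b} with hq
  have hw : ∀ D, q D ≠ 0 ↔ ∃ b, {boolFact b} = D := fun D => by
    rw [← PMF.mem_support_iff, hq, PMF.mem_support_map_iff]
    simp
  have hqB : q ∈ BID U boolSchema := by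
    refine ⟨⊤, fun s hs => ?_, fun f g _ hfg => ?_⟩
    · rcases s.eq_empty_or_nonempty with rfl | ⟨f, hf⟩
      · simp [prob_eq]
      · have : s = {f} := by
          refine Finset.eq_singleton_iff_unique_mem.2 ⟨hf, fun g hg => ?_⟩
          by_contra hne
          exact hs g hg f hf hne trivial
        subst this
        simp
    · rw [prob_eq]
      refine le_antisymm (le_of_le_of_eq (toMeasure_mono_support q (T := ∅) ?_) measure_empty)
        zero_le
      rintro D hD ⟨h1, h2⟩
      obtain ⟨b, rfl⟩ := (hw D).1 hD
      rw [Finset.mem_singleton] at h1 h2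
      exact hfg (Subtype.ext (h1.trans h2.symm))
  obtain ⟨σ, p, V, hp, hV, heq⟩ := hle _ hqB
  have hpi := PDB.IsTI.blockInd hp
  have hex : ∀ b, ∃ D, p D ≠ 0 ∧ V.apply D = {boolFact b} := fun b => by
    have : ({boolFact b} : Instance boolSchema U) ∈ (p.map V.apply).support := by
      rw [← heq]; exact (hw _).2 ⟨b, rfl⟩
    rwa [PMF.mem_support_map_iff] at this
  obtain ⟨D₁, h1, h1'⟩ := hex true
  obtain ⟨D₂, h2, h2'⟩ := hex false
  obtain ⟨D, hD, hsub⟩ := hpi.exists_superset (s := D₁ ∪ D₂) Function.injective_id.injOn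
    fun f hf => (Finset.mem_union.1 hf).elim (mass_ne_zero_of_mem p h1) (mass_ne_zero_of_mem p h2)
  have hVD : q (V.apply D) ≠ 0 := by
    rw [heq, ← PMF.mem_support_iff, PMF.mem_support_map_iff]
    exact ⟨D, hD, rfl⟩
  obtain ⟨b, hb⟩ := (hw _).1 hVD
  have e1 : boolFact true ∈ V.apply D := View.apply_mono hV
    (Finset.union_subset_left hsub) (by rw [h1']; exact Finset.mem_singleton_self _)
  have e2 : boolFact false ∈ V.apply D := View.apply_mono hV
    (Finset.union_subset_right hsub) (by rw [h2']; exact Finset.mem_singleton_self _)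
  rw [← hb, Finset.mem_singleton] at e1 e2
  exact boolFact_ne (e1.trans e2.symm)

/-! ### Correlated facts -/

/-- Two copies of one fair coin always agree: they occur together, so they cannot share a block, and
they are not independent. -/
theorem not_sjfcqTI_le_BID : ¬ viewsOver (SjfCQ U) (TI U) ≤ BID U := by
  classical
  intro hle
  set V : View (uniSchema 0) boolSchema U := fun _ => .rel () Fin.elim0 with hV
  set p : PDB (uniSchema 0) U := coinPDB 2⁻¹ (by simp) with hp
  set q : PDB boolSchema U := p.map V.apply with hq
  obtain ⟨β, blk, -, hblk⟩ := PDB.IsBID.exists_blockInd (hle boolSchema (show q ∈ _ from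
    ⟨_, p, V, isTI_of_subsingleton p inferInstance, fun _ => ⟨trivial,
      List.nodup_singleton _⟩, rfl⟩))
  have hmem : ∀ b D, (boolFact b : Fact boolSchema U) ∈ V.apply D ↔ default ∈ D := fun b D => by
    refine (View.mem_apply V D b Fin.elim0).trans ((and_iff_right fun i => i.elim0).trans ?_)
    exact iff_of_eq (congrArg (· ∈ D) (Subsingleton.elim (α := Fact (uniSchema 0) U) _ _))
  have hpw : ∀ b : Bool, p (cond b ∅ {default}) ≠ 0 := fun b => by
    rw [← PMF.mem_support_iff, hp, coinPDB, PMF.mem_support_map_iff]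
    exact ⟨b, by cases b <;> simp, rfl⟩
  have hqw : ∀ D, p D ≠ 0 → q (V.apply D) ≠ 0 := fun D hD => by
    rw [← PMF.mem_support_iff, hq, PMF.mem_support_map_iff]
    exact ⟨D, hD, rfl⟩
  have hfull : ∀ b, (boolFact b : Fact boolSchema U) ∈ V.apply {default} := fun b =>
    (hmem b _).2 (Finset.mem_singleton_self _)
  have hsame : ∀ D, q D ≠ 0 → ∀ b b', (boolFact b : Fact boolSchema U) ∈ D → boolFact b' ∈ D := by
    intro D hD b b' h
    rw [← PMF.mem_support_iff, hq, PMF.mem_support_map_iff] at hD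
    obtain ⟨D, -, rfl⟩ := hD
    rw [hmem] at h ⊢
    exact h
  set m := mass q (boolFact true) with hm
  have hm0 : m ≠ 0 := mass_ne_zero_of_mem q (hqw _ (hpw false)) (hfull true)
  have hboth : q.toMeasure {D | boolFact true ∈ D ∧ boolFact false ∈ D} = m :=
    toMeasure_congr_support q fun D hD => ⟨fun h => h.1, fun h => ⟨h, hsame D hD _ _ h⟩⟩
  have hm' : mass q (boolFact false) = m :=
    toMeasure_congr_support q fun D hD => ⟨hsame D hD _ _, hsame D hD _ _⟩
  by_cases hb : blk (boolFact true) = blk (boolFact false)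
  · exact hm0 (hboth ▸ hblk.excl _ _ boolFact_ne hb)
  · have h1 := hblk.indep {boolFact true, boolFact false} (by
      rintro x hx y hy hxy
      simp only [Finset.coe_insert, Finset.coe_singleton, Set.mem_insert_iff,
        Set.mem_singleton_iff] at hx hy
      rcases hx with rfl | rfl <;> rcases hy with rfl | rfl
      · rfl
      · exact absurd hxy hb
      · exact absurd hxy.symm hb
      · rfl)
    rw [Finset.prod_pair boolFact_ne, hm'] at h1
    -- Independence of equal events leaves only `m = 1`, although the empty instance is possible.
    have h2 : m = m * m := by
      rw [← hboth]
      refine Eq.trans ?_ (h1.trans (by rw [hboth]))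
      congr 1
      ext D
      simp [Finset.insert_subset_iff]
    have h3 : m = 1 := by
      have hmt : m ≠ ∞ := ne_top_of_le_ne_top ENNReal.one_ne_top (mass_le_one q _)
      rw [← ENNReal.mul_left_inj hm0 hmt, ← h2, one_mul]
    have h4 : q.toMeasure {D | boolFact true ∈ D}ᶜ = 0 := by
      rw [prob_compl_eq_zero_iff .of_discrete]; exact h3
    refine hqw _ (hpw true) (apply_eq_zero_of_toMeasure q ?_ h4)
    change boolFact true ∉ V.apply ∅
    rw [hmem]
    simp

/-! ### A property without small minimal models -/

/-- There is a fact and every endpoint of a fact is the starting point of a fact. -/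
def NoSink (D : Instance (uniSchema 2) U) : Prop :=
  (∃ f ∈ D, True) ∧ ∀ f ∈ D, ∃ f' ∈ D, f.2 (1 : Fin 2) = f'.2 (0 : Fin 2)

omit [Countable U] in
theorem NoSink.definable : Definable 0 fun (D : Instance (uniSchema 2) U) _ => NoSink D := by
  have h1 : Definable 0 fun (D : Instance (uniSchema 2) U) _ =>
      ∀ f ∈ D, ∃ f' ∈ D, f.2 (1 : Fin 2) = f'.2 (0 : Fin 2) := by
    refine .forall_fact (n := 0) (σ := uniSchema 2)
      (Q := fun D f _ => ∃ f' ∈ D, f.2 (1 : Fin 2) = f'.2 (0 : Fin 2)) fun R => ?_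
    refine .ex_fact (n := 0 + 2) (σ := uniSchema 2) (Q := fun _ f' w =>
      w (Fin.natAdd 0 (1 : Fin 2)) = f'.2 (0 : Fin 2)) fun R' => ?_
    exact .eq _ _
  refine .and (.ex_fact (Q := fun _ _ _ => True) fun R => ?_) h1
  exact ⟨.verum, fun D A v _ => by simp [Formula.sat_verum]⟩

/-- With positive summable odds for all facts every instance is possible; after conditioning on a
sentence the worlds are exactly its models. -/
theorem exists_faithful : ∃ p : PDB τ U, p.IsTI ∧ ∀ D, p D ≠ 0 := by
  obtain ⟨w, hw0, c, hw, -⟩ := NNReal.exists_pos_sum_of_countable (one_ne_zero (α := ℝ≥0))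
    (Fact τ U)
  obtain ⟨p, h0, hp, hb, -⟩ := exists_independent w hw.summable
  refine ⟨p, hb.isTI, fun D => ?_⟩
  rw [hp]
  refine mul_ne_zero h0 (Finset.prod_ne_zero_iff.2 fun f _ => ?_)
  exact_mod_cast (hw0 f).ne'

variable [Infinite U]

/-- In a directed cycle, a nonempty set of edges without sinks contains the successor of each of its
edges, hence all of them. -/
theorem exists_cycle (m : ℕ) : ∃ C : Instance (uniSchema 2) U, C.card = m + 1 ∧ NoSink C ∧
    ∀ G ⊆ C, NoSink G → C ⊆ G := by
  classical
  obtain ⟨e, he⟩ := exists_enumeration (U := U)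
  set cyc : ℕ → Fact (uniSchema 2) U := fun i =>
    uniFact ![e (i % (m + 1)), e ((i + 1) % (m + 1))] with hcyc
  have hmod : ∀ i j, i % (m + 1) = j % (m + 1) ↔ cyc i = cyc j := fun i j => by
    constructor
    · intro h
      have h' : (i + 1) % (m + 1) = (j + 1) % (m + 1) := Nat.ModEq.add_right 1 h
      simp only [hcyc, h, h']
    · intro h
      exact he (congrFun (uniFact_injective h) 0)
  have hC : ∀ i, cyc i ∈ (Finset.range (m + 1)).image cyc := fun i =>
    Finset.mem_image.2 ⟨i % (m + 1), Finset.mem_range.2 (Nat.mod_lt _ m.succ_pos),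
      (hmod _ _).1 (Nat.mod_mod _ _)⟩
  refine ⟨(Finset.range (m + 1)).image cyc, ?_, ⟨⟨_, hC 0, trivial⟩, ?_⟩, ?_⟩
  · rw [Finset.card_image_of_injOn, Finset.card_range]
    intro i hi j hj h
    have := (hmod i j).2 h
    rwa [Nat.mod_eq_of_lt (Finset.mem_range.1 hi), Nat.mod_eq_of_lt (Finset.mem_range.1 hj)] at this
  · intro f hf
    obtain ⟨i, -, rfl⟩ := Finset.mem_image.1 hf
    exact ⟨_, hC (i + 1), rfl⟩
  · rintro G hGC ⟨⟨f, hf, -⟩, hG⟩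
    obtain ⟨i, -, rfl⟩ := Finset.mem_image.1 (hGC hf)
    have hall : ∀ k, cyc (i + k) ∈ G := by
      intro k
      induction k with
      | zero => exact hf
      | succ k ih =>
        obtain ⟨f', hf', h⟩ := hG _ ih
        obtain ⟨j, -, rfl⟩ := Finset.mem_image.1 (hGC hf')
        have h' : (i + k + 1) % (m + 1) = j % (m + 1) := he h
        rw [(hmod _ _).1 h'.symm] at hf'
        exact hf'
    intro g hg
    obtain ⟨j, -, rfl⟩ := Finset.mem_image.1 hg
    -- Going `m * i + j` steps beyond `i` leads to `j` modulo `m + 1`.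
    have := hall (m * i + j)
    rwa [(hmod (i + (m * i + j)) j).1 (by
      rw [show i + (m * i + j) = j + (m + 1) * i by ring, Nat.add_mul_mod_self_left])] at this

/-- A law with full support is conditioned on `NoSink`. In a monotone image of a block-independent
database every world contains the image of a bounded subworld, again a world; but a long cycle has
no proper subset that satisfies `NoSink`. -/
theorem not_foTI_le_ucqBID : ¬ viewsOver (FO U) (TI U) ≤ viewsOver (UCQ U) (BID U) := by
  classical
  intro hle
  obtain ⟨p, hp, hpos⟩ := exists_faithful (U := U) (τ := uniSchema 2)
  obtain ⟨φ, hφ⟩ := NoSink.definable (U := U)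
  have hφ' : ∀ D, φ.Holds D Fin.elim0 ↔ NoSink D := fun D => hφ D _ _ subset_rfl
  obtain ⟨C₀, -, hC₀, -⟩ := exists_cycle (U := U) 0
  have hex : ∃ D ∈ {D : Instance (uniSchema 2) U | φ.Holds D Fin.elim0}, D ∈ p.support :=
    ⟨C₀, (hφ' _).2 hC₀, hpos _⟩
  obtain ⟨σ, p', V, hp', hV, heq⟩ := hle _ (conditioned_TI_le _ ⟨p, φ, hex, hp, rfl⟩)
  have hw : ∀ D, NoSink D ↔ ∃ D', p' D' ≠ 0 ∧ V.apply D' = D := fun D => by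
    have h1 : D ∈ (p.filter {D | φ.Holds D Fin.elim0} hex).support ↔ NoSink D := by
      rw [PMF.mem_support_filter_iff]
      exact ⟨fun h => (hφ' D).1 h.1, fun h => ⟨(hφ' D).2 h, hpos D⟩⟩
    rw [← h1, heq, PMF.mem_support_map_iff]
    rfl
  obtain ⟨β, blk, -, hblk⟩ := PDB.IsBID.exists_blockInd hp'
  obtain ⟨N, hN⟩ := hblk.exists_bounded_subworld
  obtain ⟨a, c, hac⟩ := (V ()).exists_card_range_le
  -- `(N * a + c) ^ 2` bounds the number of pairs over the range of the query on a world of at most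
  -- `N` facts; the cycle has one edge more.
  obtain ⟨C, hcard, hC, hmin⟩ := exists_cycle (U := U) ((N * a + c) ^ 2)
  obtain ⟨D', hD', hDC⟩ := (hw C).1 hC
  obtain ⟨G, hGD, hG, hGN⟩ := hN D' hD'
  have h1 := Finset.card_le_card (hmin (V.apply G) (hDC ▸ View.apply_mono hV hGD)
    ((hw _).2 ⟨G, hG, rfl⟩))
  have h2 : (V.apply G).card ≤ (N * a + c) ^ 2 := (card_apply_uni_le V G).trans
    (Nat.pow_le_pow_left ((hac G).trans (by gcongr)) 2)
  omega

/-! ### Infinite expected size -/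

/-- Worlds of size `2 ^ (n + 1)` with probability `2 ^ -(n + 1)` have infinite expected size. The
output relation is unary, so the size of a view is at most linear in that of its input, whose
expectation is finite. -/
theorem not_AllPDB_le_foTI : ¬ AllPDB U ≤ viewsOver (FO U) (TI U) := by
  classical
  intro hle
  obtain ⟨e, he⟩ := exists_enumeration (U := U)
  have hone : ∑' n : ℕ, (2⁻¹ : ℝ≥0∞) ^ (n + 1) = 1 := by
    rw [ENNReal.tsum_geometric_add_one]
    simp [ENNReal.one_sub_inv_two, ENNReal.inv_mul_cancel]
  set g : PMF ℕ := ⟨fun n => 2⁻¹ ^ (n + 1), by rw [← hone]; exact ENNReal.summable.hasSum⟩ with hg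
  set E : ℕ → Instance (uniSchema 1) U := fun n =>
    (Finset.range (2 ^ (n + 1))).image fun i => uniFact ![e i] with hE
  have hEc : ∀ n, (E n).card = 2 ^ (n + 1) := fun n => by
    rw [hE, Finset.card_image_of_injective, Finset.card_range]
    exact fun i j h => he (congrFun (uniFact_injective h) 0)
  obtain ⟨σ, p, V, hp, -, heq⟩ := hle _ (show g.map E ∈ AllPDB U _ from trivial)
  have hinf : ∑' D, g.map E D * (D.card : ℝ≥0∞) = ∞ := by
    rw [PMF.tsum_map_mul]
    have : ∀ n, g n * ((E n).card : ℝ≥0∞) = 1 := fun n => by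
      rw [hEc]
      change (2⁻¹ : ℝ≥0∞) ^ (n + 1) * _ = 1
      push_cast
      rw [← mul_pow, ENNReal.inv_mul_cancel (by simp) (by simp), one_pow]
    simp only [this]
    exact ENNReal.tsum_const_eq_top_of_ne_zero one_ne_zero
  obtain ⟨a, c, hac⟩ := (V ()).exists_card_range_le
  refine absurd hinf ?_
  rw [heq, PMF.tsum_map_mul]
  refine ne_top_of_le_ne_top (b := (∑' f, mass p f) * a + c) ?_ ?_
  · exact ENNReal.add_ne_top.2 ⟨ENNReal.mul_ne_top (PDB.IsTI.blockInd hp).tsum_mass_ne_top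
      (ENNReal.natCast_ne_top a), ENNReal.natCast_ne_top c⟩
  · rw [tsum_mass]
    calc ∑' D, p D * ((V.apply D).card : ℝ≥0∞) ≤ ∑' D, (p D * D.card * a + p D * c) := by
          refine ENNReal.tsum_le_tsum fun D => ?_
          rw [mul_assoc, ← mul_add]
          gcongr
          have := (card_apply_uni_le V D).trans ((pow_one _).le.trans (hac D))
          exact_mod_cast this
      _ = _ := by
          rw [ENNReal.tsum_add, ENNReal.tsum_mul_right, ENNReal.tsum_mul_right, p.tsum_coe, one_mul]

end Countable

end ProbDB

/-! ### From six separations to the whole inclusion order -/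

namespace ProbDB

open MeasureTheory Set
open scoped ENNReal NNReal

universe v

variable {U : Type v} {τ : Schema}

/-! ### The diagram -/

theorem le_viewsOver_SjfCQ (C : PDBClass U) : C ≤ viewsOver (SjfCQ U) C := by
  intro τ p hp
  set V : View τ τ U := fun R => .rel R fun i => .var i with hV
  refine ⟨τ, p, V, hp, fun R => ⟨trivial, List.nodup_singleton R⟩, ?_⟩
  have : V.apply = id := funext fun D => by
    ext ⟨R, u⟩
    rw [View.mem_apply]
    refine ⟨fun h => h.2, fun h => ⟨fun i => ?_, h⟩⟩
    classical
    exact Finset.mem_union_left _ (mem_adom.2 ⟨_, h, i, rfl⟩)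
  rw [this, PMF.map_id]

theorem Formula.IsCQ.isUCQ {n : ℕ} {φ : Formula τ U n} (h : φ.IsCQ) : φ.IsUCQ := by
  induction φ with
  | rel R t => trivial
  | eq i t => trivial
  | neg φ _ => exact h.elim
  | and φ ψ ih₁ ih₂ => exact ⟨ih₁ h.1, ih₂ h.2⟩
  | or φ ψ _ _ => exact h.elim
  | ex φ ih => exact ih h
  | all φ _ => exact h.elim

theorem SjfCQ_subset_CQ (τ : Schema) (n : ℕ) : SjfCQ U τ n ⊆ CQ U τ n := fun _ h => h.1

theorem CQ_subset_UCQ (τ : Schema) (n : ℕ) : CQ U τ n ⊆ UCQ U τ n := fun _ h => h.isUCQ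

section Countable

variable [Countable U] [Infinite U]

theorem Edge.cls_le {a b : Node} (h : Edge a b) : a.cls U ≤ b.cls U := by
  have hBID : TI U ≤ BID U := TI_le_BID
  cases h
  · exact hBID
  · exact le_viewsOver_SjfCQ _
  · exact viewsOver_mono SjfCQ_subset_CQ le_rfl
  · exact viewsOver_mono CQ_subset_UCQ le_rfl
  · exact le_viewsOver_SjfCQ _
  · exact viewsOver_mono SjfCQ_subset_CQ le_rfl
  · exact viewsOver_mono CQ_subset_UCQ le_rfl
  · exact viewsOver_mono (fun _ _ => subset_rfl) hBID
  · exact viewsOver_mono (fun _ _ => subset_rfl) hBID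
  · exact viewsOver_mono (fun _ _ => subset_rfl) hBID
  · exact (viewsOver_mono (fun _ _ => subset_univ _) le_rfl).trans FO_BID.le
  · exact fun _ => subset_univ _

theorem Node.cls_le_of_path {a b : Node} (h : Relation.ReflTransGen Edge a b) :
    a.cls U ≤ b.cls U := by
  induction h with
  | refl => exact le_rfl
  | tail _ h ih => exact ih.trans h.cls_le

/-- The height of a node among the fragments of first-order logic. -/
def Node.level : Node → ℕ
  | .ti => 0
  | .bid => 0
  | .sjfcqTI => 1
  | .sjfcqBID => 1
  | .cqTI => 2
  | .cqBID => 2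
  | .ucqTI => 3
  | .ucqBID => 3
  | .foTI => 4
  | .pdb => 5

/-- The nodes that contain the block-independent disjoint PDBs. -/
def Node.hasBlocks : Node → Bool
  | .ti => false
  | .sjfcqTI => false
  | .cqTI => false
  | .ucqTI => false
  | _ => true

/-- Reachability in the diagram is the product order of these two coordinates, which is decidable.
-/
abbrev Node.Below (a b : Node) : Prop := a.level ≤ b.level ∧ a.hasBlocks ≤ b.hasBlocks

theorem Node.Below.exists_edge {a b : Node} (h : a.Below b) :
    a = b ∨ ∃ c, Edge a c ∧ c.Below b ∧
      a.level + a.hasBlocks.toNat < c.level + c.hasBlocks.toNat := by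
  revert h
  cases a <;> cases b <;> first
    | exact fun _ => .inl rfl
    | exact fun h => absurd h (by decide)
    | exact fun _ => .inr ⟨_, .ti_bid, by decide, by decide⟩
    | exact fun _ => .inr ⟨_, .ti_sjfcqTI, by decide, by decide⟩
    | exact fun _ => .inr ⟨_, .sjfcqTI_cqTI, by decide, by decide⟩
    | exact fun _ => .inr ⟨_, .cqTI_ucqTI, by decide, by decide⟩
    | exact fun _ => .inr ⟨_, .bid_sjfcqBID, by decide, by decide⟩
    | exact fun _ => .inr ⟨_, .sjfcqBID_cqBID, by decide, by decide⟩
    | exact fun _ => .inr ⟨_, .cqBID_ucqBID, by decide, by decide⟩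
    | exact fun _ => .inr ⟨_, .sjfcqTI_sjfcqBID, by decide, by decide⟩
    | exact fun _ => .inr ⟨_, .cqTI_cqBID, by decide, by decide⟩
    | exact fun _ => .inr ⟨_, .ucqTI_ucqBID, by decide, by decide⟩
    | exact fun _ => .inr ⟨_, .ucqBID_foTI, by decide, by decide⟩
    | exact fun _ => .inr ⟨_, .foTI_pdb, by decide, by decide⟩

theorem Node.Below.path {a b : Node} (h : a.Below b) : Relation.ReflTransGen Edge a b := by
  -- 6 is the largest value of the sum, attained at `pdb`.
  generalize hn : 6 - (a.level + a.hasBlocks.toNat) = n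
  induction n using Nat.strong_induction_on generalizing a with
  | _ n ih =>
    obtain rfl | ⟨c, hac, hcb, hlt⟩ := h.exists_edge
    · exact .refl
    · have hc : c.level + c.hasBlocks.toNat ≤ 6 := by cases c <;> decide
      exact .head hac (ih _ (by omega) hcb rfl)

/-- Failing to be below `b` means having blocks when `b` does not, or exceeding its level. The first
entries are the least nodes beyond such a threshold, the second entries the greatest nodes within
it. -/
theorem Node.exists_separation {a b : Node} (h : ¬ a.Below b) :
    ∃ s ∈ [(bid, ucqTI), (sjfcqTI, bid), (cqTI, sjfcqBID), (ucqTI, cqBID), (foTI, ucqBID),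
      (pdb, foTI)], s.1.Below a ∧ b.Below s.2 := by
  revert h
  cases a <;> cases b <;> decide

/-- An inclusion without a path would extend along paths to one of the six refuted inclusions. -/
theorem Node.cls_le_iff {a b : Node} : a.cls U ≤ b.cls U ↔ Relation.ReflTransGen Edge a b := by
  refine ⟨fun h => ?_, cls_le_of_path⟩
  by_contra hc
  obtain ⟨s, hs, h1, h2⟩ := exists_separation fun h => hc h.path
  have h3 : s.1.cls U ≤ s.2.cls U := (cls_le_of_path h1.path).trans (h.trans (cls_le_of_path h2.path))
  simp only [List.mem_cons, List.not_mem_nil, or_false] at hs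
  rcases hs with rfl | rfl | rfl | rfl | rfl | rfl
  · exact not_BID_le_ucqTI h3
  · exact not_sjfcqTI_le_BID h3
  · exact not_cqTI_le_sjfcqBID h3
  · exact not_ucqTI_le_cqBID h3
  · exact not_foTI_le_ucqBID h3
  · exact not_AllPDB_le_foTI h3

theorem Edge.level_lt {a b : Node} (h : Edge a b) :
    a.level + a.hasBlocks.toNat < b.level + b.hasBlocks.toNat := by
  cases h <;> decide

/-- The sum of level and block indicator increases strictly along edges, so there are no cycles. -/
theorem eq_of_paths {a b : Node} (h : Relation.ReflTransGen Edge a b)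
    (h' : Relation.ReflTransGen Edge b a) : a = b := by
  have key : ∀ {a b : Node}, Relation.ReflTransGen Edge a b →
      a = b ∨ a.level + a.hasBlocks.toNat < b.level + b.hasBlocks.toNat := by
    intro a b h
    induction h with
    | refl => exact .inl rfl
    | tail _ h ih =>
      rcases ih with rfl | ih
      · exact .inr h.level_lt
      · exact .inr (ih.trans h.level_lt)
  rcases key h with h | h
  · exact h
  · rcases key h' with h' | h'
    · exact h'.symm
    · omega

theorem Node.cls_injective : Function.Injective fun a : Node => a.cls U := fun _ _ h =>
  eq_of_paths (cls_le_iff.1 (le_of_eq h)) (cls_le_iff.1 (ge_of_eq h))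

theorem Edge.cls_lt {a b : Node} (h : Edge a b) : a.cls U < b.cls U := by
  refine lt_of_le_of_ne h.cls_le fun he => ?_
  obtain rfl := Node.cls_injective he
  exact lt_irrefl _ h.level_lt

end Countable

end ProbDB

theorem mainTheorem1 (U : Type*) [Countable U] [Infinite U] :
    -- the three classes of first-order views coincide
    ProbDB.viewsOver (ProbDB.FO U) (ProbDB.BID U) = ProbDB.viewsOver (ProbDB.FO U) (ProbDB.TI U) ∧
    ProbDB.viewsOver (ProbDB.FO U) (ProbDB.conditioned (ProbDB.TI U)) =
      ProbDB.viewsOver (ProbDB.FO U) (ProbDB.TI U) ∧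
    -- every drawn inclusion is proper
    (∀ a b : ProbDB.Node, ProbDB.Edge a b → a.cls U < b.cls U) ∧
    -- an inclusion holds exactly if the diagram shows an ascending path
    (∀ a b : ProbDB.Node, a.cls U ≤ b.cls U ↔ Relation.ReflTransGen ProbDB.Edge a b) ∧
    -- nodes that are not connected by an ascending path are incomparable
    (∀ a b : ProbDB.Node, ¬ Relation.ReflTransGen ProbDB.Edge a b →
      ¬ Relation.ReflTransGen ProbDB.Edge b a → ¬ a.cls U ≤ b.cls U ∧ ¬ b.cls U ≤ a.cls U) ∧
    -- in particular, the ten classes are pairwise distinct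
    Function.Injective (fun a : ProbDB.Node => a.cls U) :=
  ⟨ProbDB.FO_BID, ProbDB.FO_conditioned_TI, fun _ _ h => h.cls_lt,
    fun _ _ => ProbDB.Node.cls_le_iff,
    fun _ _ h h' => ⟨fun hle => h (ProbDB.Node.cls_le_iff.1 hle),
      fun hle => h' (ProbDB.Node.cls_le_iff.1 hle)⟩, ProbDB.Node.cls_injective⟩
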